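/- **Setting.** Let $\mathcal Y$ be a Polish space, $H$ a Borel probability measure on it, $\theta>0$, and let $g:\mathcal Y\to\mathbb R$ be measurable with $$\int_{\mathcal Y}\log\bigl(1+|g(y)|\bigr)\,\theta H(dy)<\infty. \tag{1}$$ Write $\mu(g)=\int g\,d\mu$ and $T=\mu(\mathcal Y)$. For a finite nonzero measure $\alpha$ on $\mathcal Y$ with total mass $|\alpha|$: * $\mathcal D(dP|\alpha)$ is the law of the Dirichlet process of shape $\alpha$: a random probability measure $P$ such that for every finite measurable partition $A_1,\dots,A_k$ of $\mathcal Y$ the vector $(P(A_1),\dots,P(A_k))$ is Dirichlet with parameters $(\alpha(A_1),\dots,\alpha(A_k))$. * $\mathcal G(d\mu|\alpha)$ is the law of the Gamma process of shape $\alpha$: a random finite measure $\mu$ with $E[e^{-\mu(f)}]=e^{-\int\log(1+f)\,d\alpha}$ for all bounded measurable $f\ge 0$. * For $d<|\alpha|$, the Beta-Gamma process has law $\mathcal{BG}(d\mu|\alpha,d)=\frac{\Gamma(|\alpha|)}{\Gamma(|\alpha|-d)}\,T^{-d}\,\mathcal G(d\mu|\alpha)$. * $\mathbb P(d\mathbf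 Y|\theta H)=\frac{\Gamma(\theta)}{\Gamma(\theta+n)}\,\theta H(dY_1)\prod_{i=2}^n\bigl(\theta H+\sum_{j<i}\delta_{Y_j}\bigr)(dY_i)$ is the Blackwell–MacQueen law of $\mathbf Y=(Y_1,\dots,Y_n)$ (for $n=0$, the point mass on the empty sample), and $(\theta+n)H_n=\theta H+\sum_{i=1}^n\delta_{Y_i}$. * $\mathcal B(du|a,b)$ is the Beta$(a,b)$ law on $(0,1)$. Complex powers and logarithms are principal branches. Given $q>0$, $z\in\mathbb C$ is called *admissible for $q$* if $\int|e^{-z\mu(g)}|\,\mathcal{BG}(d\mu|\theta H,\theta-q)<\infty$. **Theorem 2.1.** The functional $P(g)$ exists almost surely under $\mathcal D(dP|\theta H)$, and $\mu(g)$ exists almost surely under $\mathcal G(d\mu|\theta H)$ and, for every $n\ge0$ and every $(Y_1,\dots,Y_n)$, under $\mathcal G(d\mu|(\theta+n)H_n)$. Every $z$ with $\operatorname{Re}(z)\,g\ge 0$ $H$-a.e. is admissible for every $q>0$. (i) For all $q>0$, $\mathcal{BG}(d\mu|\theta H,\theta-q)$ is a probability law, and for every $z$ admissible for $q$ the left side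 below converges absolutely and $$\int(1+zP(g))^{-q}\,\mathcal D(dP|\theta H)=\int e^{-z\mu(g)}\,\mathcal{BG}(d\mu|\theta H,\theta-q).\tag{14}$$ (ii) For all $q>0$, all integers $n\ge0$ with $\theta+n-q>0$ and all $z$ admissible for $q$, both sides of (14) equal $$\int_{\mathcal Y^n}\Bigl[\int e^{-z\mu(g)}\,\mathcal{BG}(d\mu|(\theta+n)H_n,\theta+n-q)\Bigr]\mathbb P(d\mathbf Y|\theta H),$$ where the inner integral converges absolutely for $\mathbb P$-a.e. $\mathbf Y$ and is then $\mathbb P$-integrable. For every $\mathbf Y$ for which it converges absolutely, the inner integral equals $$\int_0^1e^{-\int\log[1+uzg(y)]\,\theta H(dy)}\prod_{j=1}^{n(\mathbf p)}\bigl(1+uzg(Y_j^*)\bigr)^{-e_{j,n}}\,\mathcal B(du|q,\theta+n-q),$$ where $Y_1^*,\dots,Y^*_{n(\mathbf p)}$ are the distinct values of $\mathbf Y$ and $e_{j,n}$ their multiplicities; this integral converges absolutely. If $H$ is nonatomic, both sides of (14) also equal $$\sum_{\mathbf p}\pi(\mathbf p|\theta)\int_0^1e^{-\int\log[1+uzg(y)]\,\theta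 H(dy)}\Bigl[\prod_{j=1}^{n(\mathbf p)}\int_{\mathcal Y}(1+uzg(y))^{-e_{j,n}}H(dy)\Bigr]\mathcal B(du|q,\theta+n-q),$$ with absolutely convergent $u$-integrals, where the sum is over all partitions $\mathbf p=\{C_1,\dots,C_{n(\mathbf p)}\}$ of $\{1,\dots,n\}$, $e_{j,n}=|C_j|$, and $\pi(\mathbf p|\theta)=\frac{\theta^{n(\mathbf p)}\Gamma(\theta)}{\Gamma(\theta+n)}\prod_{j}(e_{j,n}-1)!$. For every $n\ge1$ and every $z$ with $\int|e^{-z\mu(g)}|\,\mathcal G(d\mu|\theta H)<\infty$, the Laplace functional $\int e^{-z\mu(g)}\,\mathcal G(d\mu|\theta H)$ of the Gamma process has these representations (the mixture, and, for nonatomic $H$, the sum over partitions) with $q=\theta$. (iii) If $\theta>q>0$ and $z$ is admissible for $q$, then $$\int(1+zP(g))^{-q}\,\mathcal D(dP|\theta H)=\int_0^1e^{-\int\log[1+uzg(y)]\,\theta H(dy)}\,\mathcal B(du|q,\theta-q),$$ the right side converging absolutely. -/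

import Mathlib

open MeasureTheory

noncomputable section

namespace DirichletBetaGamma

/-- The gamma distribution with shape `a ≥ 0` and scale `1`; shape `0` is the point mass at `0`. -/
def gammaDist (a : ℝ) : Measure ℝ :=
  if a = 0 then Measure.dirac 0 else ProbabilityTheory.gammaMeasure a 1

/-- The Dirichlet distribution with parameters `a i ≥ 0` (not all zero): the law of
`(Z i / ∑ j, Z j)` for independent gamma variables `Z i` with shapes `a i`. -/
def dirichletDist {k : ℕ} (a : Fin k → ℝ) : Measure (Fin k → ℝ) :=
  (Measure.pi fun i => gammaDist (a i)).map fun x i => x i / ∑ j, x j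

/-- `D` is the law of a Dirichlet process with shape `α`: a random probability measure whose
values on any finite measurable partition have the Dirichlet distribution with the parameters
given by `α`. -/
structure IsDirichletProcess {Y : Type*} [MeasurableSpace Y] (α : Measure Y)
    (D : Measure (Measure Y)) : Prop where
  isProbabilityMeasure : IsProbabilityMeasure D
  ae_isProbabilityMeasure : ∀ᵐ P ∂D, IsProbabilityMeasure P
  map_eq : ∀ (k : ℕ) (A : Fin k → Set Y), (∀ i, MeasurableSet (A i)) →
    Pairwise (fun i j => Disjoint (A i) (A j)) → (⋃ i, A i) = Set.univ →
    D.map (fun P i => P.real (A i)) = dirichletDist fun i => α.real (A i)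

/-- `Γ` is the law of a gamma process with finite shape measure `α`, characterized by its Laplace
functional on the nonnegative bounded measurable functions. -/
structure IsGammaProcess {Y : Type*} [MeasurableSpace Y] (α : Measure Y)
    (Γ : Measure (Measure Y)) : Prop where
  isProbabilityMeasure : IsProbabilityMeasure Γ
  ae_isFiniteMeasure : ∀ᵐ μ ∂Γ, IsFiniteMeasure μ
  laplace_eq : ∀ g : Y → ℝ, Measurable g → (∀ y, 0 ≤ g y) → (∃ C, ∀ y, g y ≤ C) →
    ∫ μ, Real.exp (-∫ y, g y ∂μ) ∂Γ = Real.exp (-∫ y, Real.log (1 + g y) ∂α)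

/-- The law of the Beta-Gamma process with parameters `(α, d)`, where `Γ` is the law of the gamma
process with shape `α`: with `θ = α(Y)` and `T = μ(Y)`, it is `Γ(θ) / Γ(θ - d) T ^ (-d)` times the
law of the gamma process. -/
def betaGammaLaw {Y : Type*} [MeasurableSpace Y] (α : Measure Y) (Γ : Measure (Measure Y))
    (d : ℝ) : Measure (Measure Y) :=
  Γ.withDensity fun μ => ENNReal.ofReal
    (Real.Gamma (α.real Set.univ) / Real.Gamma (α.real Set.univ - d) *
      μ.real Set.univ ^ (-d))

/-- The shape `α + ∑ i, δ_{y i}`; for `α = θ H` this is `(θ + n) H_n`. -/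
def postShape {Y : Type*} [MeasurableSpace Y] (α : Measure Y) {n : ℕ} (y : Fin n → Y) :
    Measure Y :=
  α + ∑ i, Measure.dirac (y i)

/-- The unnormalized urn measure
`α(dy_1) (α + δ_{y_1})(dy_2) ⋯ (α + δ_{y_1} + ⋯ + δ_{y_{n-1}})(dy_n)`. -/
def urnMeasure {Y : Type*} [MeasurableSpace Y] (α : Measure Y) :
    (n : ℕ) → Measure (Fin n → Y)
  | 0 => Measure.dirac Fin.elim0
  | n + 1 => (urnMeasure α n).bind fun y =>
      (postShape α y).map fun x => (Fin.snoc y x : Fin (n + 1) → Y)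

/-- The Blackwell–MacQueen distribution of a sample of size `n`; here `θ = α(Y)`. -/
def blackwellMacQueen {Y : Type*} [MeasurableSpace Y] (α : Measure Y) (n : ℕ) :
    Measure (Fin n → Y) :=
  ENNReal.ofReal (Real.Gamma (α.real Set.univ) / Real.Gamma (α.real Set.univ + n)) •
    urnMeasure α n

/-- The Ewens weight of a partition `p` of the sample indices. -/
def ewensWeight (θ : ℝ) {n : ℕ} (p : Finpartition (Finset.univ : Finset (Fin n))) : ℝ :=
  θ ^ p.parts.card * Real.Gamma θ / Real.Gamma (θ + n) *
    ∏ C ∈ p.parts, ((C.card - 1).factorial : ℝ)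

/-- The Laplace functional `E[exp (-z μ(g))]` for `μ` with law `L`. -/
def laplaceFunctional {Y : Type*} [MeasurableSpace Y] (L : Measure (Measure Y)) (z : ℂ)
    (g : Y → ℝ) : ℂ :=
  ∫ μ, Complex.exp (-z * ((∫ y, g y ∂μ : ℝ) : ℂ)) ∂L

/-- The Laplace functional of `L` converges absolutely at `z`, `g`. -/
def LaplaceConverges {Y : Type*} [MeasurableSpace Y] (L : Measure (Measure Y)) (z : ℂ)
    (g : Y → ℝ) : Prop :=
  Integrable (fun μ : Measure Y => Complex.exp (-z * ((∫ y, g y ∂μ : ℝ) : ℂ))) L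

/-- `exp (-∫ log (1 + u z g) dα)`, with the principal branch of the logarithm. -/
def expLog {Y : Type*} [MeasurableSpace Y] (α : Measure Y) (z : ℂ) (g : Y → ℝ) (u : ℝ) : ℂ :=
  Complex.exp (-∫ y, Complex.log (1 + u * z * g y) ∂α)

open Classical in
/-- `exp (-∫ log (1 + u z g) dα) ∏_j (1 + u z g(y_j*)) ^ (-e_j)`, where the `y_j*` are the distinct
values in the sample `y` and the `e_j` their multiplicities. -/
def sampleIntegrand {Y : Type*} [MeasurableSpace Y] (α : Measure Y) (z : ℂ) (g : Y → ℝ)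
    {n : ℕ} (y : Fin n → Y) (u : ℝ) : ℂ :=
  expLog α z g u * ∏ v ∈ Finset.univ.image y,
    (1 + u * z * g v) ^ (-((Finset.univ.filter fun i => y i = v).card : ℤ))

/-- `exp (-∫ log (1 + u z g) θ dH) ∏_{C ∈ p} ∫ (1 + u z g) ^ (-|C|) dH`. -/
def partitionIntegrand {Y : Type*} [MeasurableSpace Y] (θ : ℝ) (H : Measure Y) (z : ℂ)
    (g : Y → ℝ) {n : ℕ} (p : Finpartition (Finset.univ : Finset (Fin n))) (u : ℝ) : ℂ :=
  expLog (ENNReal.ofReal θ • H) z g u *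
    ∏ C ∈ p.parts, ∫ y, (1 + u * z * g y) ^ (-(C.card : ℤ)) ∂H

end DirichletBetaGamma

end

/-! Everything rests on one fact about the gamma process μ of shape α = θH: its total mass T is a
Gamma(θ) variable independent of the normalization P = μ/T, which is a Dirichlet process
(`IsGammaProcess.eq_map_dirichlet`). A density that is a power of T changes only the law of T, so
the Beta-Gamma law with d = θ - q is the law of tP with t ~ Gamma(q) independent of P
(`betaGammaLaw_eq_map_dirichlet`). Integrating exp(-z t P(g)) over t first gives (1 + zP(g))^(-q),
the Markov–Krein identity (`markov_krein`).

The mixture comes from the Palm formula: biasing a gamma process by T amounts to choosing x from its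
shape measure and adding an independent exponential atom at x, which raises the shape by δ_x
(`IsGammaProcess.withDensity_mass`). Iteration makes the points x follow the urn scheme, and
T^(-(θ-q)) = T^n T^(-(θ+n-q)) turns the result into an identity between Beta-Gamma laws
(`betaGammaLaw_eq_bind`).

For the u-integrals, T^(-r) is a beta mixture of the weights u^(-(q+r)) exp(-sT) with s = (1-u)/u
(`lintegral_betaMeasure_exp`). The Laplace functional of a Beta-Gamma process is thus a mixture of
gamma Laplace functionals at s + zg, and 1 + s + zg = (1 + uzg)/u
(`IsGammaProcess.laplace_betaGamma`). Each atom of a posterior shape contributes a factor (1 +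
uzg(y_i))^(-1).

Absolute convergence is the only assumption on z, so E exp(-μ(f)) = exp(-∫ log(1+f) dβ) is needed on
its whole domain of convergence (`IsGammaProcess.laplace`). Convergence itself forces 1 + Re f > 0
almost everywhere and a finite exponential moment of μ((Re f)⁻)
(`IsGammaProcess.dominated_of_integrable`); dominated convergence from simple functions then
applies.

Finally, each urn draw is either fresh or a copy of an earlier one. Hence the urn measure is a sum
over partitions, with weights ∏ (|C|-1)!, of laws of samples constant on the parts
(`urnMeasure_eq_sum`), and an integrand that is a product over the sample factorizes over the parts.
-/

namespace DirichletBetaGamma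

open Filter Topology Set
open scoped ENNReal NNReal

/-! ### The gamma distribution and its complex Laplace transform -/

section Gamma

lemma gammaMeasure_eq_restrict (a : ℝ) :
    ProbabilityTheory.gammaMeasure a 1 = (volume.restrict (Ioi (0 : ℝ))).withDensity
      fun x => ENNReal.ofReal (x ^ (a - 1) * Real.exp (-x) / Real.Gamma a) := by
  rw [ProbabilityTheory.gammaMeasure, ← withDensity_indicator measurableSet_Ioi]
  refine withDensity_congr_ae ?_
  have h0 : ∀ᵐ x : ℝ, x ≠ 0 := by simp [ae_iff]
  filter_upwards [h0] with x hx
  rcases lt_or_gt_of_ne hx with h | h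
  · rw [ProbabilityTheory.gammaPDF_of_neg h, indicator_of_notMem (by simpa using h.le)]
  · rw [ProbabilityTheory.gammaPDF_of_nonneg h.le, indicator_of_mem (by simpa using h)]
    congr 1
    simp only [Real.one_rpow, one_mul]
    ring

lemma gammaDensity_measurable (a : ℝ) : Measurable
    fun x : ℝ => ENNReal.ofReal (x ^ (a - 1) * Real.exp (-x) / Real.Gamma a) := by fun_prop

lemma gammaMeasure_ae_pos (a : ℝ) : ∀ᵐ x ∂ProbabilityTheory.gammaMeasure a 1, 0 < x := by
  rw [gammaMeasure_eq_restrict]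
  refine (withDensity_absolutelyContinuous _ _).ae_le ?_
  exact ae_restrict_mem measurableSet_Ioi

/-- Tilting the gamma distribution by a power changes its shape. -/
lemma gammaMeasure_withDensity_rpow {a q : ℝ} (ha : 0 < a) (hq : 0 < q) :
    (ProbabilityTheory.gammaMeasure a 1).withDensity
      (fun x => ENNReal.ofReal (Real.Gamma a / Real.Gamma q * x ^ (-(a - q)))) =
      ProbabilityTheory.gammaMeasure q 1 := by
  rw [gammaMeasure_eq_restrict, gammaMeasure_eq_restrict,
    ← withDensity_mul _ (gammaDensity_measurable a) (by fun_prop)]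
  refine withDensity_congr_ae ?_
  filter_upwards [ae_restrict_mem measurableSet_Ioi] with x (hx : 0 < x)
  have h1 := Real.Gamma_pos_of_pos ha
  have h2 := Real.Gamma_pos_of_pos hq
  rw [Pi.mul_apply, ← ENNReal.ofReal_mul (by positivity)]
  congr 1
  have : x ^ (q - 1) = x ^ (a - 1) * x ^ (-(a - q)) := by
    rw [← Real.rpow_add hx]; congr 1; ring
  rw [this]
  field_simp

instance isProbabilityMeasure_gammaDist_of_nonneg {a : ℝ≥0} :
    IsProbabilityMeasure (gammaDist a) := by
  unfold gammaDist
  split_ifs with h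
  · infer_instance
  · exact ProbabilityTheory.isProbabilityMeasure_gammaMeasure
      (lt_of_le_of_ne a.2 (Ne.symm h)) one_pos

lemma isProbabilityMeasure_gammaDist {a : ℝ} (ha : 0 ≤ a) :
    IsProbabilityMeasure (gammaDist a) :=
  isProbabilityMeasure_gammaDist_of_nonneg (a := ⟨a, ha⟩)

lemma gammaDist_ae_nonneg (a : ℝ) : ∀ᵐ x ∂gammaDist a, 0 ≤ x := by
  unfold gammaDist
  split_ifs with h
  · rw [ae_dirac_iff measurableSet_Ici]
  · exact (gammaMeasure_ae_pos a).mono fun x hx => hx.le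

lemma integrable_exp_gammaMeasure_real {a c : ℝ} (ha : 0 < a) (hc : -1 < c) :
    Integrable (fun x => Real.exp (-c * x)) (ProbabilityTheory.gammaMeasure a 1) ∧
    ∫ x, Real.exp (-c * x) ∂ProbabilityTheory.gammaMeasure a 1 = (1 + c) ^ (-a) := by
  have hΓ := Real.Gamma_pos_of_pos ha
  have key : ∀ x ∈ Ioi (0 : ℝ), (ENNReal.ofReal
      (x ^ (a - 1) * Real.exp (-x) / Real.Gamma a)).toReal • Real.exp (-c * x) =
      (Real.Gamma a)⁻¹ * (x ^ (a - 1) * Real.exp (-((1 + c) * x))) := by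
    intro x (hx : 0 < x)
    rw [ENNReal.toReal_ofReal (by positivity), smul_eq_mul]
    rw [show -((1 + c) * x) = -x + -c * x by ring, Real.exp_add]
    ring
  have hint : IntegrableOn (fun x => (Real.Gamma a)⁻¹ *
      (x ^ (a - 1) * Real.exp (-((1 + c) * x)))) (Ioi 0) := by
    refine Integrable.const_mul ?_ _
    have := integrableOn_rpow_mul_exp_neg_mul_rpow (p := 1) (s := a - 1) (b := 1 + c)
      (by linarith) one_pos (by linarith)
    simpa only [Real.rpow_one, neg_mul, IntegrableOn] using this
  rw [gammaMeasure_eq_restrict]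
  constructor
  · rw [integrable_withDensity_iff_integrable_smul' (gammaDensity_measurable a) (by simp)]
    exact hint.congr ((ae_restrict_mem measurableSet_Ioi).mono fun x hx => (key x hx).symm)
  · rw [integral_withDensity_eq_integral_toReal_smul (gammaDensity_measurable a) (by simp),
      setIntegral_congr_fun measurableSet_Ioi key, integral_const_mul,
      Real.integral_rpow_mul_exp_neg_mul_Ioi ha (by linarith), Real.rpow_neg (by linarith),
      one_div, Real.inv_rpow (by linarith)]
    field_simp

lemma integrable_exp_gammaMeasure {a : ℝ} {c : ℂ} (ha : 0 < a) (hc : -1 < c.re) :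
    Integrable (fun x : ℝ => Complex.exp (-c * x)) (ProbabilityTheory.gammaMeasure a 1) := by
  refine ((integrable_exp_gammaMeasure_real ha hc).1).mono' (by fun_prop) (ae_of_all _ fun x => ?_)
  rw [Complex.norm_exp]
  simp

/-- The Laplace transform of the gamma distribution in the whole half-plane of convergence. -/
lemma integral_exp_gammaMeasure {a : ℝ} {c : ℂ} (ha : 0 < a) (hc : -1 < c.re) :
    ∫ x : ℝ, Complex.exp (-c * x) ∂ProbabilityTheory.gammaMeasure a 1 = (1 + c) ^ (-(a : ℂ)) := by
  set μ := ProbabilityTheory.gammaMeasure a 1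
  -- Identity theorem: the moment generating function is finite for real t < 1, hence analytic on
  -- the half-plane U, and it agrees with (1 - w)^(-a) at real points near 0.
  let U : Set ℂ := {w | w.re < 1}
  have hUo : IsOpen U := isOpen_lt Complex.continuous_re continuous_const
  have hsub : Iio (1 : ℝ) ⊆ ProbabilityTheory.integrableExpSet id μ := by
    intro t ht
    have := (integrable_exp_gammaMeasure_real ha (c := -t) (by linarith [mem_Iio.1 ht])).1
    simpa [ProbabilityTheory.integrableExpSet] using this
  have hf : AnalyticOnNhd ℂ (ProbabilityTheory.complexMGF id μ) U := by
    refine (ProbabilityTheory.analyticOnNhd_complexMGF).mono fun w hw => ?_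
    exact interior_mono hsub (by rw [isOpen_Iio.interior_eq]; exact hw)
  have hg : AnalyticOnNhd ℂ (fun w : ℂ => (1 - w) ^ (-(a : ℂ))) U := by
    refine DifferentiableOn.analyticOnNhd (fun w hw => ?_) hUo
    refine DifferentiableAt.differentiableWithinAt ?_
    refine DifferentiableAt.cpow (by fun_prop) (by fun_prop) ?_
    left
    simpa [U] using hw
  have hconv : IsPreconnected U := (convex_halfSpace_re_lt 1).isPreconnected
  have hfreq : ∃ᶠ w in 𝓝[≠] (0 : ℂ), ProbabilityTheory.complexMGF id μ w
      = (1 - w) ^ (-(a : ℂ)) := by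
    have hlim : Tendsto (fun t : ℝ => (t : ℂ)) (𝓝[≠] 0) (𝓝[≠] 0) := by
      refine tendsto_nhdsWithin_iff.2 ⟨?_, ?_⟩
      · exact (Complex.continuous_ofReal.tendsto' 0 0 (by simp)).mono_left nhdsWithin_le_nhds
      · exact eventually_mem_nhdsWithin.mono fun t ht => by simpa using ht
    refine hlim.frequently (Eventually.frequently ?_)
    have : ∀ᶠ t : ℝ in 𝓝[≠] 0, t < 1 := nhdsWithin_le_nhds (Iio_mem_nhds one_pos)
    filter_upwards [this] with t ht
    rw [ProbabilityTheory.complexMGF]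
    have h2 := (integrable_exp_gammaMeasure_real ha (c := -t) (by linarith)).2
    have h3 : (fun x : ℝ => Complex.exp ((t : ℂ) * (id x : ℝ))) =
        fun x : ℝ => ((Real.exp (-(-t) * x) : ℝ) : ℂ) := by
      funext x; push_cast; simp
    rw [h3, integral_complex_ofReal, h2, Complex.ofReal_cpow (by linarith)]
    push_cast
    ring_nf
  have := hf.eqOn_of_preconnected_of_frequently_eq hg hconv (z₀ := 0) (by simp [U]) hfreq
    (show -c ∈ U by simp only [U, mem_ofPred_eq, Complex.neg_re]; linarith)
  simpa [ProbabilityTheory.complexMGF] using this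

/-- Shape 0 is the point mass at 0 and leaves c unrestricted; this is why conditions on simple
functions need only hold almost everywhere for the shape measure. -/
lemma integrable_exp_gammaDist {a : ℝ} {c : ℂ} (ha : 0 ≤ a) (hc : a ≠ 0 → -1 < c.re) :
    Integrable (fun x : ℝ => Complex.exp (-c * x)) (gammaDist a) := by
  unfold gammaDist
  split_ifs with h
  · exact integrable_dirac (by simp)
  · exact integrable_exp_gammaMeasure (lt_of_le_of_ne ha (Ne.symm h)) (hc h)

lemma integral_exp_gammaDist {a : ℝ} {c : ℂ} (ha : 0 ≤ a) (hc : a ≠ 0 → -1 < c.re) :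
    ∫ x : ℝ, Complex.exp (-c * x) ∂gammaDist a = Complex.exp (-(a * Complex.log (1 + c))) := by
  unfold gammaDist
  split_ifs with h
  · simp [h]
  · have hc := hc h
    have : (1 + c) ≠ 0 := fun h0 => by
      have := congrArg Complex.re h0
      simp at this; linarith
    rw [integral_exp_gammaMeasure (lt_of_le_of_ne ha (Ne.symm h)) hc, Complex.cpow_def_of_ne_zero this]
    ring_nf

/-- Integrability of an exponential under a gamma distribution forces the exponent to lie in the
half-plane of convergence. -/
lemma neg_one_lt_re_of_integrable_exp {a : ℝ} {c : ℂ} (ha : 0 < a)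
    (h : Integrable (fun x : ℝ => Complex.exp (-c * x)) (ProbabilityTheory.gammaMeasure a 1)) :
    -1 < c.re := by
  by_contra! hc
  have hΓ := Real.Gamma_pos_of_pos ha
  rw [gammaMeasure_eq_restrict,
    integrable_withDensity_iff_integrable_smul' (gammaDensity_measurable a) (by simp)] at h
  -- If Re c ≤ -1, the exponential outweighs exp(-x), and x^(a-1) would be integrable on the whole
  -- half-line, which fails for every exponent.
  refine not_integrableOn_Ioi_rpow (a - 1) ?_
  have h2 := h.norm.const_mul (Real.Gamma a)
  refine h2.mono' (by fun_prop) ?_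
  filter_upwards [ae_restrict_mem measurableSet_Ioi] with x (hx : 0 < x)
  rw [norm_smul, Complex.norm_exp, Real.norm_of_nonneg (by positivity),
    Real.norm_of_nonneg ENNReal.toReal_nonneg, ENNReal.toReal_ofReal (by positivity)]
  simp only [Complex.mul_re, Complex.neg_re, Complex.ofReal_re, Complex.ofReal_im, mul_zero,
    sub_zero]
  rw [show Real.Gamma a * (x ^ (a - 1) * Real.exp (-x) / Real.Gamma a * Real.exp (-c.re * x)) =
    x ^ (a - 1) * (Real.exp (-x) * Real.exp (-c.re * x)) by field_simp, ← Real.exp_add]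
  have : 1 ≤ Real.exp (-x + -c.re * x) := Real.one_le_exp (by nlinarith)
  have h0 : 0 ≤ x ^ (a - 1) := by positivity
  nlinarith

end Gamma

/-! ### Uniqueness of Laplace transforms on the positive orthant -/

section LaplaceUniqueness

open BoundedContinuousFunction

/-- The bounded continuous functions `x ↦ exp (-∑ i, n i * x i)` on the positive orthant. -/
def expMonomials (ι : Type*) [Fintype ι] : Submonoid ((ι → ℝ≥0) →ᵇ ℝ) where
  carrier := {g | ∃ n : ι → ℕ, ∀ x, g x = Real.exp (-∑ i, n i * (x i : ℝ))}
  one_mem' := ⟨0, by simp⟩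
  mul_mem' := by
    rintro a b ⟨n, hn⟩ ⟨m, hm⟩
    refine ⟨n + m, fun x => ?_⟩
    rw [BoundedContinuousFunction.mul_apply, hn, hm, ← Real.exp_add, ← neg_add,
      ← Finset.sum_add_distrib]
    simp [add_mul]

/-- A finite measure on the positive orthant is determined by its Laplace transform at the lattice
points. -/
lemma ext_of_laplace_nnreal {ι : Type*} [Fintype ι] {P P' : Measure (ι → ℝ≥0)} [IsFiniteMeasure P]
    [IsFiniteMeasure P'] (h : ∀ n : ι → ℕ, ∫ x, Real.exp (-∑ i, n i * (x i : ℝ)) ∂P =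
      ∫ x, Real.exp (-∑ i, n i * (x i : ℝ)) ∂P') : P = P' := by
  classical
  -- The exponentials are closed under products, so the algebra they generate is their linear span
  -- and equality of integrals extends to it by linearity. It separates points, which suffices on a
  -- Polish space.
  let A : StarSubalgebra ℝ ((ι → ℝ≥0) →ᵇ ℝ) :=
    { Algebra.adjoin ℝ (expMonomials ι : Set ((ι → ℝ≥0) →ᵇ ℝ)) with
      star_mem' := by
        intro a ha
        have : star a = a := by ext x; simp
        rwa [this] }
  have hAspan : ∀ g ∈ A, g ∈ Submodule.span ℝ (expMonomials ι : Set ((ι → ℝ≥0) →ᵇ ℝ)) := by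
    intro g hg
    have h1 : g ∈ Subalgebra.toSubmodule
      (Algebra.adjoin ℝ (expMonomials ι : Set ((ι → ℝ≥0) →ᵇ ℝ))) := hg
    rwa [Algebra.adjoin_eq_span, Submonoid.closure_eq] at h1
  refine ext_of_forall_mem_subalgebra_integral_eq_of_polish (𝕜 := ℝ) (A := A) ?_ ?_
  · intro x y hxy
    obtain ⟨j, hj⟩ := Function.ne_iff.1 hxy
    let b : (ι → ℝ≥0) →ᵇ ℝ := BoundedContinuousFunction.ofNormedAddCommGroup
      (fun x => Real.exp (-(x j : ℝ))) (by fun_prop) 1 (fun x => by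
        rw [Real.norm_of_nonneg (Real.exp_pos _).le]
        exact Real.exp_le_one_iff.2 (by simp))
    have hb : b ∈ expMonomials ι := by
      refine ⟨Pi.single j 1, fun x => ?_⟩
      simp [b, Pi.single_apply]
    refine ⟨b, ⟨toContinuousMapStarₐ ℝ b, ?_, rfl⟩, ?_⟩
    · exact ⟨b, Algebra.subset_adjoin hb, rfl⟩
    · intro h
      apply hj
      have : Real.exp (-(x j : ℝ)) = Real.exp (-(y j : ℝ)) := h
      simpa using this
  · intro g hg
    refine Submodule.span_induction (p := fun g _ => ∫ x, g x ∂P = ∫ x, g x ∂P') ?_ ?_ ?_ ?_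
      (hAspan g hg)
    · rintro g ⟨n, hn⟩
      simp_rw [hn]
      exact h n
    · simp
    · intro f g _ _ hf hg
      simp only [BoundedContinuousFunction.add_apply]
      rw [integral_add (f.integrable _) (g.integrable _),
        integral_add (f.integrable _) (g.integrable _), hf, hg]
    · intro c f _ hf
      simp only [BoundedContinuousFunction.coe_smul, integral_smul, hf]

/-- Nonnegative random vectors with the same Laplace transform at the lattice points have the same
law. -/
lemma map_eq_of_laplace {ι Ω Ω' : Type*} [Fintype ι] [MeasurableSpace Ω] [MeasurableSpace Ω']
    {P : Measure Ω} {P' : Measure Ω'} [IsFiniteMeasure P] [IsFiniteMeasure P']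
    {X : Ω → ι → ℝ} {X' : Ω' → ι → ℝ} (hX : Measurable X) (hX' : Measurable X')
    (h0 : ∀ᵐ ω ∂P, ∀ i, 0 ≤ X ω i) (h0' : ∀ᵐ ω ∂P', ∀ i, 0 ≤ X' ω i)
    (h : ∀ n : ι → ℕ, ∫ ω, Real.exp (-∑ i, n i * X ω i) ∂P =
      ∫ ω, Real.exp (-∑ i, n i * X' ω i) ∂P') : P.map X = P'.map X' := by
  -- The exponentials are bounded only on the orthant, so the vectors are moved there and back; by
  -- nonnegativity nothing changes almost surely.
  let N : (ι → ℝ) → ι → ℝ≥0 := fun x i => (x i).toNNReal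
  let C : (ι → ℝ≥0) → ι → ℝ := fun x i => x i
  have hN : Measurable N := by fun_prop
  have hC : Measurable C := by fun_prop
  have key : P.map (N ∘ X) = P'.map (N ∘ X') := by
    have := Measure.isFiniteMeasure_map P (N ∘ X)
    have := Measure.isFiniteMeasure_map P' (N ∘ X')
    refine ext_of_laplace_nnreal fun n => ?_
    have hc : Continuous fun x : ι → ℝ≥0 => Real.exp (-∑ i, n i * (x i : ℝ)) := by fun_prop
    rw [integral_map (by fun_prop) hc.aestronglyMeasurable,
      integral_map (by fun_prop) hc.aestronglyMeasurable]
    refine (integral_congr_ae ?_).trans ((h n).trans (integral_congr_ae ?_))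
    · filter_upwards [h0] with ω hω
      simp [N, hω]
    · filter_upwards [h0'] with ω hω
      simp [N, hω]
  have h1 : P.map X = (P.map (N ∘ X)).map C := by
    rw [Measure.map_map hC (hN.comp hX)]
    refine Measure.map_congr ?_
    filter_upwards [h0] with ω hω
    ext i
    simp [C, N, hω]
  have h2 : P'.map X' = (P'.map (N ∘ X')).map C := by
    rw [Measure.map_map hC (hN.comp hX')]
    refine Measure.map_congr ?_
    filter_upwards [h0'] with ω hω
    ext i
    simp [C, N, hω]
  rw [h1, h2, key]

end LaplaceUniqueness

/-! ### Laws of random measures -/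

section RandomMeasure

variable {Y : Type*} [MeasurableSpace Y]

lemma measurable_measureReal {A : Set Y} (hA : MeasurableSet A) :
    Measurable fun μ : Measure Y => μ.real A :=
  (Measure.measurable_coe hA).ennreal_toReal

/-- Lets a random measure be treated as a stochastic process indexed by the measurable sets, so that
its law is determined by finite-dimensional distributions. -/
lemma measurableSpace_measure_eq_comap :
    (inferInstance : MeasurableSpace (Measure Y)) = MeasurableSpace.comap
      (fun (μ : Measure Y) (A : {A : Set Y // MeasurableSet A}) => μ A) inferInstance := by
  apply le_antisymm
  · refine iSup₂_le fun s hs => ?_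
    rintro _ ⟨B, hB, rfl⟩
    refine ⟨(fun f : {A : Set Y // MeasurableSet A} → ℝ≥0∞ => f ⟨s, hs⟩) ⁻¹' B, ?_, rfl⟩
    have hB' : MeasurableSet B := by rwa [← BorelSpace.measurable_eq (α := ℝ≥0∞)] at hB
    exact (measurable_pi_apply _) hB'
  · refine Measurable.comap_le ?_
    exact measurable_pi_lambda _ fun A => Measure.measurable_coe A.2

/-- The law of a random finite measure is determined by its Laplace functional on the nonnegative
simple functions. -/
lemma ext_of_laplace_simpleFunc {L L' : Measure (Measure Y)} [IsFiniteMeasure L]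
    [IsFiniteMeasure L'] (hL : ∀ᵐ μ ∂L, IsFiniteMeasure μ) (hL' : ∀ᵐ μ ∂L', IsFiniteMeasure μ)
    (h : ∀ f : SimpleFunc Y ℝ, (∀ y, 0 ≤ f y) →
      ∫ μ, Real.exp (-∫ y, f y ∂μ) ∂L = ∫ μ, Real.exp (-∫ y, f y ∂μ) ∂L') : L = L' := by
  classical
  let Φ : Measure Y → {A : Set Y // MeasurableSet A} → ℝ≥0∞ := fun μ A => μ A
  have hΦ : Measurable Φ := measurable_pi_lambda _ fun A => Measure.measurable_coe A.2
  have key : L.map Φ = L'.map Φ := by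
    have := Measure.isFiniteMeasure_map L Φ
    -- Both image laws on the product space are projective limits of the same finite-dimensional
    -- marginals.
    refine IsProjectiveLimit.unique (P := fun I => (L.map Φ).map I.restrict) (fun I => rfl) ?_
    intro I
    have hr : Measurable (I.restrict : ({A : Set Y // MeasurableSet A} → ℝ≥0∞) → _) := by fun_prop
    change (L'.map Φ).map I.restrict = (L.map Φ).map I.restrict
    rw [Measure.map_map hr hΦ, Measure.map_map hr hΦ]
    let X : Measure Y → I → ℝ := fun μ A => μ.real A.1.1
    have hX : Measurable X := measurable_pi_lambda _ fun A => measurable_measureReal A.1.2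
    let E : (I → ℝ) → I → ℝ≥0∞ := fun x A => ENNReal.ofReal (x A)
    have hE : Measurable E := by fun_prop
    have hXX : L.map X = L'.map X := by
      refine map_eq_of_laplace hX hX (ae_of_all _ fun μ i => measureReal_nonneg)
        (ae_of_all _ fun μ i => measureReal_nonneg) fun n => ?_
      -- The sets A may overlap; the sum of the n_A 1_A is still simple, and its integral is the
      -- exponent of the joint Laplace transform of the masses.
      let f : SimpleFunc Y ℝ := ∑ A : I, SimpleFunc.piecewise A.1.1 A.1.2
        (SimpleFunc.const Y (n A : ℝ)) (SimpleFunc.const Y 0)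
      have hfy : ∀ y, f y = ∑ A : I, A.1.1.indicator (fun _ => (n A : ℝ)) y := by
        intro y
        exact map_sum (⟨⟨fun f : SimpleFunc Y ℝ => f y, rfl⟩, fun _ _ => rfl⟩ :
          SimpleFunc Y ℝ →+ ℝ) _ _
      have hfμ : ∀ μ : Measure Y, IsFiniteMeasure μ → ∫ y, f y ∂μ = ∑ A : I, n A * X μ A := by
        intro μ hμ
        simp_rw [hfy]
        rw [integral_finsetSum _ fun A _ => (integrable_const _).indicator A.1.2]
        refine Finset.sum_congr rfl fun A _ => ?_
        rw [integral_indicator_const _ A.1.2, smul_eq_mul, mul_comm]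
      have := h f fun y => by
        rw [hfy]
        exact Finset.sum_nonneg fun A _ => indicator_nonneg (fun _ _ => by positivity) _
      rw [integral_congr_ae (g := fun μ => Real.exp (-∑ A : I, n A * X μ A))
        (hL.mono fun μ hμ => by simp only [hfμ μ hμ]),
        integral_congr_ae (μ := L') (g := fun μ => Real.exp (-∑ A : I, n A * X μ A))
        (hL'.mono fun μ hμ => by simp only [hfμ μ hμ])] at this
      exact this
    have e1 : L'.map (I.restrict ∘ Φ) = (L'.map X).map E := by
      rw [Measure.map_map hE hX]
      refine Measure.map_congr (hL'.mono fun μ hμ => ?_)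
      ext A
      simp [E, X, Φ]
    have e2 : L.map (I.restrict ∘ Φ) = (L.map X).map E := by
      rw [Measure.map_map hE hX]
      refine Measure.map_congr (hL.mono fun μ hμ => ?_)
      ext A
      simp [E, X, Φ]
    rw [e1, e2, hXX]
  ext S hS
  rw [show (Measure.instMeasurableSpace : MeasurableSpace (Measure Y)) = _ from
    measurableSpace_measure_eq_comap] at hS
  obtain ⟨B, hB, rfl⟩ := hS
  rw [← Measure.map_apply hΦ hB, ← Measure.map_apply hΦ hB, key]

end RandomMeasure

/-! ### Gamma processes: independence on disjoint sets, null sets, simple functions -/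

section GammaProcess

lemma integral_exp_gammaDist_real {a c : ℝ} (ha : 0 ≤ a) (hc : -1 < c) :
    ∫ x : ℝ, Real.exp (-(c * x)) ∂gammaDist a = Real.exp (-(a * Real.log (1 + c))) := by
  have := integral_exp_gammaDist (c := (c : ℂ)) ha (fun _ => by simpa using hc)
  rw [← Complex.ofReal_one, ← Complex.ofReal_add, ← Complex.ofReal_log (by linarith)] at this
  have h2 : ∀ x : ℝ, Complex.exp (-c * x) = ((Real.exp (-(c * x)) : ℝ) : ℂ) := by
    intro x; push_cast; ring_nf
  simp_rw [h2] at this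
  rw [integral_complex_ofReal] at this
  exact_mod_cast this

variable {Y : Type*} [MeasurableSpace Y] {β : Measure Y} {Γ : Measure (Measure Y)}

lemma IsGammaProcess.unique {Γ' : Measure (Measure Y)} (h : IsGammaProcess β Γ)
    (h' : IsGammaProcess β Γ') : Γ = Γ' := by
  have := h.isProbabilityMeasure
  have := h'.isProbabilityMeasure
  refine ext_of_laplace_simpleFunc h.ae_isFiniteMeasure h'.ae_isFiniteMeasure fun f hf => ?_
  obtain ⟨C, hC⟩ := f.exists_forall_norm_le
  have hC' : ∃ C, ∀ y, f y ≤ C := ⟨C, fun y => (le_abs_self _).trans (hC y)⟩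
  rw [h.laplace_eq f f.measurable hf hC', h'.laplace_eq f f.measurable hf hC']

/-- The values of a gamma process on disjoint sets are independent and gamma distributed. -/
lemma IsGammaProcess.map_eq [IsFiniteMeasure β] (hΓ : IsGammaProcess β Γ) {ι : Type*} [Fintype ι]
    {A : ι → Set Y} (hA : ∀ i, MeasurableSet (A i))
    (hd : Pairwise (fun i j => Disjoint (A i) (A j))) :
    Γ.map (fun μ i => μ.real (A i)) = Measure.pi fun i => gammaDist (β.real (A i)) := by
  classical
  have := hΓ.isProbabilityMeasure
  have hp : ∀ i, IsProbabilityMeasure (gammaDist (β.real (A i))) := fun i =>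
    isProbabilityMeasure_gammaDist measureReal_nonneg
  have hX : Measurable fun (μ : Measure Y) i => μ.real (A i) :=
    measurable_pi_lambda _ fun i => measurable_measureReal (hA i)
  refine (map_eq_of_laplace (X' := id) hX measurable_id
    (ae_of_all _ fun μ i => measureReal_nonneg) ?_ fun n => ?_).trans Measure.map_id
  · refine ae_all_iff.2 fun i => ?_
    exact (measurePreserving_eval _ i).quasiMeasurePreserving.ae (gammaDist_ae_nonneg _)
  -- By disjointness, log(1 + g) is the sum of the log(1 + n_i) 1_{A_i}, so the Laplace functional
  -- splits into a product of gamma transforms.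
  · let g : Y → ℝ := fun y => ∑ i, (A i).indicator (fun _ => (n i : ℝ)) y
    have hgm : Measurable g :=
      Finset.measurable_fun_sum _ fun i _ => measurable_const.indicator (hA i)
    have hg0 : ∀ y, 0 ≤ g y := fun y =>
      Finset.sum_nonneg fun i _ => indicator_nonneg (fun _ _ => by positivity) _
    have hgC : ∃ C, ∀ y, g y ≤ C := ⟨∑ i, n i, fun y => Finset.sum_le_sum fun i _ =>
      indicator_le_self' (fun _ _ => by positivity) _⟩
    have h1 := hΓ.laplace_eq g hgm hg0 hgC
    have h2 : ∀ y, Real.log (1 + g y) = ∑ i, (A i).indicator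
        (fun _ => Real.log (1 + n i)) y := by
      intro y
      by_cases hy : ∃ i, y ∈ A i
      · obtain ⟨i, hi⟩ := hy
        have hne : ∀ j, j ≠ i → y ∉ A j := fun j hj hyj =>
          (hd hj).le_bot ⟨hyj, hi⟩
        simp only [g]
        rw [Finset.sum_eq_single i (fun j _ hj => indicator_of_notMem (hne j hj) _) (by simp),
          Finset.sum_eq_single i (fun j _ hj => indicator_of_notMem (hne j hj) _) (by simp),
          indicator_of_mem hi, indicator_of_mem hi]
      · push Not at hy
        simp [g, hy]
    have h3 : ∫ y, Real.log (1 + g y) ∂β = ∑ i, β.real (A i) * Real.log (1 + n i) := by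
      simp_rw [h2]
      rw [integral_finsetSum _ fun i _ => (integrable_const _).indicator (hA i)]
      exact Finset.sum_congr rfl fun i _ => by rw [integral_indicator_const _ (hA i), smul_eq_mul]
    have h4 : ∀ᵐ μ ∂Γ, Real.exp (-∫ y, g y ∂μ) = Real.exp (-∑ i, n i * μ.real (A i)) := by
      filter_upwards [hΓ.ae_isFiniteMeasure] with μ hμ
      simp only [g]
      rw [integral_finsetSum _ fun i _ => (integrable_const _).indicator (hA i)]
      congr 2
      exact Finset.sum_congr rfl fun i _ => by
        rw [integral_indicator_const _ (hA i), smul_eq_mul, mul_comm]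
    rw [← integral_congr_ae h4, h1, h3, ← Finset.sum_neg_distrib, Real.exp_sum]
    simp only [id]
    simp_rw [← Finset.sum_neg_distrib, Real.exp_sum]
    rw [integral_fintype_prod_eq_prod (𝕜 := ℝ)
      (f := fun i x => Real.exp (-((n i : ℝ) * x)))]
    refine Finset.prod_congr rfl fun i _ => ?_
    rw [integral_exp_gammaDist_real measureReal_nonneg]
    linarith [Nat.cast_nonneg (α := ℝ) (n i)]

lemma IsGammaProcess.map_measureReal [IsFiniteMeasure β] (hΓ : IsGammaProcess β Γ)
    {A : Set Y} (hA : MeasurableSet A) :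
    Γ.map (fun μ => μ.real A) = gammaDist (β.real A) := by
  have := isProbabilityMeasure_gammaDist (measureReal_nonneg (μ := β) (s := A))
  have h := hΓ.map_eq (ι := Unit) (A := fun _ => A) (fun _ => hA)
    (fun i j hij => (hij rfl).elim)
  have h2 := congrArg (fun ν => ν.map (fun x : Unit → ℝ => x ())) h
  rw [Measure.map_map (measurable_pi_apply _)
    (measurable_pi_lambda _ fun i => measurable_measureReal hA)] at h2
  exact h2.trans (measurePreserving_eval _ ()).map_eq

/-- The mass of a null set of the shape is a gamma variable of shape 0. This carries
almost-everywhere statements from the shape measure to almost every realization. -/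
lemma IsGammaProcess.ae_measure_eq_zero [IsFiniteMeasure β] (hΓ : IsGammaProcess β Γ)
    {A : Set Y} (hA : MeasurableSet A) (h0 : β A = 0) : ∀ᵐ μ ∂Γ, μ A = 0 := by
  have h := hΓ.map_measureReal hA
  rw [measureReal_def, h0, ENNReal.toReal_zero, gammaDist, if_pos rfl] at h
  have h1 : ∀ᵐ x ∂Γ.map (fun μ => μ.real A), x = 0 := by
    rw [h]
    exact (ae_dirac_iff (p := fun x : ℝ => x = 0) (measurableSet_singleton 0)).2 rfl
  have h2 := ae_of_ae_map (measurable_measureReal hA).aemeasurable h1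
  filter_upwards [h2, hΓ.ae_isFiniteMeasure] with μ hμ hf
  exact (measureReal_eq_zero_iff).1 hμ

lemma IsGammaProcess.ae_ae_of_ae [IsFiniteMeasure β] (hΓ : IsGammaProcess β Γ)
    {p : Y → Prop} (h : ∀ᵐ y ∂β, p y) : ∀ᵐ μ ∂Γ, ∀ᵐ y ∂μ, p y := by
  obtain ⟨t, hst, ht, h0⟩ := exists_measurable_superset_of_null h
  filter_upwards [hΓ.ae_measure_eq_zero ht h0] with μ hμ
  exact measure_mono_null hst hμ

lemma IsGammaProcess.ae_pos [IsFiniteMeasure β] (hΓ : IsGammaProcess β Γ)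
    (h0 : 0 < β.real univ) : ∀ᵐ μ ∂Γ, 0 < μ.real univ := by
  have h := hΓ.map_measureReal MeasurableSet.univ
  rw [gammaDist, if_neg h0.ne'] at h
  have h1 := gammaMeasure_ae_pos (β.real univ)
  rw [← h] at h1
  exact ae_of_ae_map (measurable_measureReal MeasurableSet.univ).aemeasurable h1

lemma measurable_betaGammaDensity (c d : ℝ) : Measurable fun μ : Measure Y =>
    ENNReal.ofReal (c * μ.real univ ^ (-d)) := by
  have := measurable_measureReal (Y := Y) MeasurableSet.univ
  fun_prop

/-- The density depends on μ only through T ~ Gamma(θ), and the power tilt turns this law into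
Gamma(q), whatever the sign of θ - q. -/
lemma isProbabilityMeasure_betaGammaLaw [IsFiniteMeasure β] (hΓ : IsGammaProcess β Γ)
    (h0 : 0 < β.real univ) {q : ℝ} (hq : 0 < q) :
    IsProbabilityMeasure (betaGammaLaw β Γ (β.real univ - q)) := by
  have h := hΓ.map_measureReal MeasurableSet.univ
  rw [gammaDist, if_neg h0.ne'] at h
  constructor
  have := ProbabilityTheory.isProbabilityMeasure_gammaMeasure hq one_pos
  rw [betaGammaLaw, withDensity_apply _ MeasurableSet.univ, setLIntegral_univ, sub_sub_cancel,
    ← measure_univ (μ := ProbabilityTheory.gammaMeasure q 1),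
    ← gammaMeasure_withDensity_rpow h0 hq, withDensity_apply _ MeasurableSet.univ,
    setLIntegral_univ, ← h, lintegral_map (by fun_prop) (measurable_measureReal MeasurableSet.univ)]

/-- The Laplace functional of a gamma process at complex simple functions. -/
lemma IsGammaProcess.laplace_simpleFunc [IsFiniteMeasure β] (hΓ : IsGammaProcess β Γ)
    (f : SimpleFunc Y ℂ) (hf : ∀ᵐ y ∂β, -1 < (f y).re) :
    Integrable (fun μ : Measure Y => Complex.exp (-∫ y, f y ∂μ)) Γ ∧
    ∫ μ : Measure Y, Complex.exp (-∫ y, f y ∂μ) ∂Γ =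
      Complex.exp (-∫ y, Complex.log (1 + f y) ∂β) := by
  classical
  -- The masses of the fibres of f are independent gamma variables, so the exponential is a product
  -- with one independent factor for each value of f.
  have hA : ∀ v : f.range, MeasurableSet (f ⁻¹' {v.1}) := fun v => f.measurableSet_fiber _
  have hm := hΓ.map_eq (ι := f.range) (A := fun v => f ⁻¹' {v.1}) hA
    (fun i j hij => Disjoint.preimage _ (by simpa [Subtype.coe_inj] using hij))
  set X : Measure Y → f.range → ℝ := fun μ v => μ.real (f ⁻¹' {v.1})
  have hX : Measurable X := measurable_pi_lambda _ fun i => measurable_measureReal (hA i)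
  have hp : ∀ v : f.range, IsProbabilityMeasure (gammaDist (β.real (f ⁻¹' {v.1}))) := fun i =>
    isProbabilityMeasure_gammaDist measureReal_nonneg
  have hre : ∀ v : f.range, β.real (f ⁻¹' {v.1}) ≠ 0 → -1 < v.1.re := by
    intro v hv
    by_contra hle
    refine hv ?_
    rw [measureReal_eq_zero_iff]
    refine measure_mono_null (fun y hy => ?_) hf
    have : f y = v.1 := hy
    simpa [this] using hle
  have e1 : ∀ᵐ μ ∂Γ, Complex.exp (-∫ y, f y ∂μ) =
      ∏ v : f.range, Complex.exp (-(v.1) * X μ v) := by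
    filter_upwards [hΓ.ae_isFiniteMeasure] with μ hμ
    rw [← SimpleFunc.integral_eq_integral f (SimpleFunc.integrable_of_isFiniteMeasure f),
      SimpleFunc.integral_eq, ← Complex.exp_sum, ← Finset.sum_coe_sort, ← Finset.sum_neg_distrib]
    congr 1
    refine Finset.sum_congr rfl fun v _ => ?_
    rw [Complex.real_smul]
    ring
  have e2 : ∫ y, Complex.log (1 + f y) ∂β =
      ∑ v : f.range, β.real (f ⁻¹' {v.1}) * Complex.log (1 + v.1) := by
    have h1 := SimpleFunc.integral_eq_integral (μ := β) (f.map fun v => Complex.log (1 + v))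
      (SimpleFunc.integrable_of_isFiniteMeasure _)
    have h2 := SimpleFunc.map_integral (μ := β) f (fun v => Complex.log (1 + v) - Complex.log 1)
      (SimpleFunc.integrable_of_isFiniteMeasure f) (by simp)
    simp only [Complex.log_one, sub_zero] at h2
    rw [h2] at h1
    simp only [SimpleFunc.map_apply] at h1
    rw [← h1, ← Finset.sum_coe_sort]
    simp [Complex.real_smul]
  have hint : Integrable (fun x : f.range → ℝ => ∏ v : f.range, Complex.exp (-(v.1) * x v))
      (Measure.pi fun v : f.range => gammaDist (β.real (f ⁻¹' {v.1}))) :=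
    Integrable.fintype_prod (f := fun (v : f.range) (x : ℝ) => Complex.exp (-(v.1) * x))
      fun v => integrable_exp_gammaDist measureReal_nonneg (hre v)
  rw [← hm] at hint
  refine ⟨?_, ?_⟩
  · rw [integrable_map_measure hint.1 hX.aemeasurable] at hint
    exact hint.congr (e1.mono fun μ hμ => hμ.symm)
  · rw [integral_congr_ae e1]
    have := integral_map hX.aemeasurable hint.1
    rw [← this, hm, integral_fintype_prod_eq_prod (𝕜 := ℂ)
      (f := fun (v : f.range) (x : ℝ) => Complex.exp (-(v.1) * x)), e2, ← Finset.sum_neg_distrib,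
      Complex.exp_sum]
    exact Finset.prod_congr rfl fun v _ => integral_exp_gammaDist measureReal_nonneg (hre v)

end GammaProcess

/-! ### Approximation by simple functions and a dominating function -/

section Approximation

variable {Y : Type*} [MeasurableSpace Y]

lemma exists_simpleFunc_tendsto_nonneg {k : Y → ℝ} (hk : Measurable k) (h0 : ∀ y, 0 ≤ k y) :
    ∃ φ : ℕ → SimpleFunc Y ℝ, (∀ n y, 0 ≤ φ n y ∧ φ n y ≤ k y) ∧
      ∀ y, Tendsto (fun n => φ n y) atTop (𝓝 (k y)) := by
  have hm : Measurable fun y => ENNReal.ofReal (k y) := hk.ennreal_ofReal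
  refine ⟨fun n => (SimpleFunc.eapprox (fun y => ENNReal.ofReal (k y)) n).map ENNReal.toReal,
    fun n y => ⟨ENNReal.toReal_nonneg, ?_⟩, fun y => ?_⟩
  · refine ENNReal.toReal_le_of_le_ofReal (h0 y) ?_
    refine le_trans ?_ (SimpleFunc.iSup_eapprox_apply hm y).le
    exact le_iSup (fun n => (SimpleFunc.eapprox (fun y => ENNReal.ofReal (k y)) n) y) n
  · have := (ENNReal.tendsto_toReal ENNReal.ofReal_ne_top).comp (SimpleFunc.tendsto_eapprox hm y)
    rwa [ENNReal.toReal_ofReal (h0 y)] at this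

/-- A real measurable function is a pointwise limit of simple functions that lie between its
negative and its positive part. -/
lemma exists_simpleFunc_tendsto {k : Y → ℝ} (hk : Measurable k) :
    ∃ φ : ℕ → SimpleFunc Y ℝ, (∀ n y, -max (-k y) 0 ≤ φ n y ∧ φ n y ≤ max (k y) 0) ∧
      ∀ y, Tendsto (fun n => φ n y) atTop (𝓝 (k y)) := by
  obtain ⟨φ, hφ, hφt⟩ := exists_simpleFunc_tendsto_nonneg (k := fun y => max (k y) 0)
    (hk.max measurable_const) fun y => le_max_right _ _
  obtain ⟨ψ, hψ, hψt⟩ := exists_simpleFunc_tendsto_nonneg (k := fun y => max (-k y) 0)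
    (hk.neg.max measurable_const) fun y => le_max_right _ _
  refine ⟨fun n => φ n - ψ n, fun n y => ?_, fun y => ?_⟩
  · have h1 := hφ n y
    have h2 := hψ n y
    rw [SimpleFunc.coe_sub, Pi.sub_apply]
    constructor <;> linarith
  · have := (hφt y).sub (hψt y)
    rwa [max_zero_sub_max_neg_zero_eq_self] at this

/-- The real part of the logarithm is the log of the modulus, bounded above by growth and below
through Re(1 + w) ≥ 1 - m; the argument costs π. The factor 2 leaves room for approximating real and
imaginary parts separately. -/
lemma norm_log_one_add_le {w : ℂ} {m R : ℝ} (hm : m < 1) (hre : -m ≤ w.re)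
    (hw : ‖w‖ ≤ 2 * R) :
    ‖Complex.log (1 + w)‖ ≤ Real.log 2 + Real.log (1 + R) + |Real.log (1 - m)| + Real.pi := by
  have hR : 0 ≤ R := by linarith [norm_nonneg w]
  have h1 : ‖Complex.log (1 + w)‖ ≤ |Real.log ‖1 + w‖| + Real.pi := by
    refine (Complex.norm_le_abs_re_add_abs_im _).trans ?_
    rw [Complex.log_re, Complex.log_im]
    gcongr
    exact Complex.abs_arg_le_pi _
  have h2 : 1 - m ≤ ‖1 + w‖ := by
    refine le_trans ?_ (Complex.re_le_norm _)
    simp; linarith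
  have h3 : Real.log (1 - m) ≤ Real.log ‖1 + w‖ := Real.log_le_log (by linarith) h2
  have h4 : Real.log ‖1 + w‖ ≤ Real.log 2 + Real.log (1 + R) := by
    rw [← Real.log_mul (by norm_num) (by positivity)]
    refine Real.log_le_log (by linarith) ((norm_add_le _ _).trans ?_)
    simp; linarith
  have h5 : 0 ≤ Real.log 2 + Real.log (1 + R) :=
    add_nonneg (Real.log_nonneg (by norm_num)) (Real.log_nonneg (by linarith))
  have h6 := neg_abs_le (Real.log (1 - m))
  have h7 := abs_nonneg (Real.log (1 - m))
  have : |Real.log ‖1 + w‖| ≤ Real.log 2 + Real.log (1 + R) + |Real.log (1 - m)| :=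
    abs_le.2 ⟨by linarith, by linarith⟩
  linarith

end Approximation

/-! ### Almost sure existence of μ(g) -/

section LaplaceFunctional

/-- Fatou's lemma for convergent sequences of nonnegative functions with bounded integrals. -/
lemma integrable_of_tendsto_of_integral_le {Ω : Type*} [MeasurableSpace Ω] {P : Measure Ω}
    {F : ℕ → Ω → ℝ} {f : Ω → ℝ} {K : ℝ} (hF : ∀ n, Integrable (F n) P)
    (h0 : ∀ n, ∀ᵐ ω ∂P, 0 ≤ F n ω) (hK : ∀ n, ∫ ω, F n ω ∂P ≤ K)
    (hlim : ∀ᵐ ω ∂P, Tendsto (fun n => F n ω) atTop (𝓝 (f ω))) : Integrable f P := by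
  refine ⟨aestronglyMeasurable_of_tendsto_ae _ (fun n => (hF n).1) hlim, ?_⟩
  have h1 : ∫⁻ ω, ‖f ω‖ₑ ∂P ≤ liminf (fun n => ∫⁻ ω, ‖F n ω‖ₑ ∂P) atTop := by
    refine le_trans (lintegral_mono_ae ?_) (lintegral_liminf_le' fun n => (hF n).1.enorm)
    filter_upwards [hlim] with ω hω using hω.enorm.liminf_eq.ge
  refine lt_of_le_of_lt (b := ENNReal.ofReal K) (h1.trans ?_) ENNReal.ofReal_lt_top
  refine liminf_le_of_frequently_le' (Frequently.of_forall fun n => ?_)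
  rw [lintegral_congr_ae ((h0 n).mono fun ω hω => by
    rw [Real.enorm_eq_ofReal hω] : _ =ᵐ[P] fun ω => ENNReal.ofReal (F n ω)),
    ← ofReal_integral_eq_lintegral_ofReal (hF n) (h0 n)]
  exact ENNReal.ofReal_le_ofReal (hK n)

variable {Y : Type*} [MeasurableSpace Y] {β : Measure Y} {Γ : Measure (Measure Y)}

/-- A function `g` with `log (1 + |g|)` integrable for the shape measure is almost surely integrable
for the gamma process. -/
lemma IsGammaProcess.ae_integrable (hΓ : IsGammaProcess β Γ) {g : Y → ℝ} (hg : Measurable g)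
    (hlog : Integrable (fun y => Real.log (1 + |g y|)) β) : ∀ᵐ μ ∂Γ, Integrable g μ := by
  have := hΓ.isProbabilityMeasure
  set S : Set (Measure Y) := {μ | ∫⁻ y, ‖g y‖ₑ ∂μ = ∞}
  have hS : MeasurableSet S := by
    have : Measurable fun μ : Measure Y => ∫⁻ y, ‖g y‖ₑ ∂μ :=
      Measure.measurable_lintegral hg.enorm
    exact this (measurableSet_singleton ∞)
  have hlog0 : ∀ (t : ℝ) (y : Y), 0 < t → 0 ≤ Real.log (1 + t * |g y|) := fun t y ht =>
    Real.log_nonneg (by have := abs_nonneg (g y); nlinarith)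
  have hlogle : ∀ (t : ℝ) (y : Y), 0 < t → t ≤ 1 →
      Real.log (1 + t * |g y|) ≤ Real.log (1 + |g y|) := fun t y ht ht1 =>
    Real.log_le_log (by positivity) (by have := abs_nonneg (g y); nlinarith)
  have hlogm : ∀ t : ℝ, Measurable fun y => Real.log (1 + t * |g y|) := fun t =>
    Measurable.log (by fun_prop)
  have hlogint : ∀ t : ℝ, 0 < t → t ≤ 1 → Integrable (fun y => Real.log (1 + t * |g y|)) β :=
    fun t ht ht1 => hlog.mono' (hlogm t).aestronglyMeasurable (ae_of_all _ fun y => by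
      rw [Real.norm_of_nonneg (hlog0 t y ht)]
      exact hlogle t y ht ht1)
  -- The exponential exp(-tμ(|g|)) vanishes where μ(|g|) = ∞ and is at most 1 elsewhere, so its
  -- expectation is at most the probability of Sᶜ. Truncating |g| at N keeps the test functions
  -- bounded, as the defining Laplace identity requires.
  have key : ∀ t : ℝ, 0 < t → t ≤ 1 →
      Real.exp (-∫ y, Real.log (1 + t * |g y|) ∂β) ≤ Γ.real Sᶜ := by
    intro t ht ht1
    set k : ℕ → Y → ℝ := fun N y => t * min |g y| N
    have hk : ∀ N, Measurable (k N) := fun N => by fun_prop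
    have hk0 : ∀ N y, 0 ≤ k N y := fun N y => by positivity
    have hkC : ∀ N y, k N y ≤ t * N := fun N y => by
      simp only [k]; gcongr; exact min_le_right _ _
    have hkg : ∀ N y, k N y ≤ t * |g y| := fun N y => by
      simp only [k]; gcongr; exact min_le_left _ _
    have hmeas : ∀ N, Measurable fun μ : Measure Y => (∫⁻ y, ENNReal.ofReal (k N y) ∂μ).toReal :=
      fun N => (Measure.measurable_lintegral (hk N).ennreal_ofReal).ennreal_toReal
    have hI : ∀ N (μ : Measure Y), ∫ y, k N y ∂μ = (∫⁻ y, ENNReal.ofReal (k N y) ∂μ).toReal :=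
      fun N μ => integral_eq_lintegral_of_nonneg_ae (ae_of_all _ (hk0 N))
        (hk N).aestronglyMeasurable
    have hexpm : ∀ N, Measurable fun μ : Measure Y => Real.exp (-∫ y, k N y ∂μ) := fun N => by
      simp_rw [hI]
      exact (hmeas N).neg.exp
    have hle1 : ∀ N (μ : Measure Y), Real.exp (-∫ y, k N y ∂μ) ≤ 1 := fun N μ =>
      Real.exp_le_one_iff.2 (neg_nonpos.2 (integral_nonneg (hk0 N)))
    have hint : ∀ N, Integrable (fun μ : Measure Y => Real.exp (-∫ y, k N y ∂μ)) Γ := fun N =>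
      (integrable_const (1 : ℝ)).mono' (hexpm N).aestronglyMeasurable (ae_of_all _ fun μ => by
        rw [Real.norm_of_nonneg (Real.exp_pos _).le]; exact hle1 N μ)
    have hlap : ∀ N, Real.exp (-∫ y, Real.log (1 + t * |g y|) ∂β) ≤
        ∫ μ, Real.exp (-∫ y, k N y ∂μ) ∂Γ := by
      intro N
      rw [hΓ.laplace_eq (k N) (hk N) (hk0 N) ⟨_, hkC N⟩]
      refine Real.exp_le_exp.2 (neg_le_neg (integral_mono_of_nonneg (ae_of_all _ fun y =>
        Real.log_nonneg (by linarith [hk0 N y])) (hlogint t ht ht1) (ae_of_all _ fun y =>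
        Real.log_le_log (by linarith [hk0 N y]) (by linarith [hkg N y]))))
    have hsplit : ∀ N, ∫ μ, Real.exp (-∫ y, k N y ∂μ) ∂Γ ≤
        Γ.real Sᶜ + ∫ μ in S, Real.exp (-∫ y, k N y ∂μ) ∂Γ := by
      intro N
      rw [← integral_add_compl hS (hint N), add_comm]
      gcongr
      calc ∫ μ in Sᶜ, Real.exp (-∫ y, k N y ∂μ) ∂Γ ≤ ∫ μ in Sᶜ, (1 : ℝ) ∂Γ :=
            integral_mono (hint N).integrableOn (integrable_const _) (hle1 N)
        _ = Γ.real Sᶜ := by simp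
    have hlim : Tendsto (fun N => ∫ μ in S, Real.exp (-∫ y, k N y ∂μ) ∂Γ) atTop (𝓝 0) := by
      have h0 : ∫ μ in S, (0 : ℝ) ∂Γ = 0 := by simp
      rw [← h0]
      refine tendsto_integral_of_dominated_convergence (fun _ => 1)
        (fun N => (hexpm N).aestronglyMeasurable) (integrable_const _)
        (fun N => ae_of_all _ fun μ => by
          rw [Real.norm_of_nonneg (Real.exp_pos _).le]; exact hle1 N μ) ?_
      filter_upwards [ae_restrict_mem hS, ae_restrict_of_ae hΓ.ae_isFiniteMeasure] with μ hμ hf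
      refine Real.tendsto_exp_neg_atTop_nhds_zero.comp ?_
      have hinf : ∫⁻ y, ENNReal.ofReal (t * |g y|) ∂μ = ∞ := by
        have h1 : ∀ y, ENNReal.ofReal (t * |g y|) = ENNReal.ofReal t * ‖g y‖ₑ := fun y => by
          rw [ENNReal.ofReal_mul ht.le, Real.enorm_eq_ofReal_abs]
        simp_rw [h1]
        rw [lintegral_const_mul _ hg.enorm, (show ∫⁻ y, ‖g y‖ₑ ∂μ = ∞ from hμ),
          ENNReal.mul_top (by simpa using ht)]
      have hmon : Tendsto (fun N => ∫⁻ y, ENNReal.ofReal (k N y) ∂μ) atTop (𝓝 ∞) := by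
        rw [← hinf]
        refine lintegral_tendsto_of_tendsto_of_monotone
          (fun N => (hk N).ennreal_ofReal.aemeasurable)
          (ae_of_all _ fun y N M hNM => ENNReal.ofReal_le_ofReal (by
            simp only [k]; gcongr)) (ae_of_all _ fun y => ?_)
        refine tendsto_atTop_of_eventually_const (i₀ := ⌈|g y|⌉₊) fun N hN => ?_
        simp only [k]
        rw [min_eq_left]
        exact (Nat.le_ceil _).trans (by exact_mod_cast hN)
      have hne : ∀ N, ∫⁻ y, ENNReal.ofReal (k N y) ∂μ ≠ ∞ := by
        intro N
        refine ne_top_of_le_ne_top (b := ∫⁻ y, ENNReal.ofReal (t * N) ∂μ) ?_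
          (lintegral_mono fun y => ENNReal.ofReal_le_ofReal (hkC N y))
        rw [lintegral_const]
        exact ENNReal.mul_ne_top ENNReal.ofReal_ne_top (measure_ne_top _ _)
      simp_rw [hI]
      rw [tendsto_atTop]
      intro b
      filter_upwards [hmon.eventually (lt_mem_nhds (ENNReal.ofReal_lt_top (r := b)))] with N hN
      exact (ENNReal.ofReal_le_iff_le_toReal (hne N)).1 hN.le
    have : Tendsto (fun N => Γ.real Sᶜ + ∫ μ in S, Real.exp (-∫ y, k N y ∂μ) ∂Γ) atTop
        (𝓝 (Γ.real Sᶜ + 0)) := tendsto_const_nhds.add hlim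
    rw [add_zero] at this
    exact ge_of_tendsto' this fun N => (hlap N).trans (hsplit N)
  -- Letting t = 1/(n+1) tend to 0, with log(1 + |g|) as dominating function, forces Sᶜ to have
  -- probability 1.
  have hlim : Tendsto (fun n : ℕ => Real.exp (-∫ y, Real.log (1 + (1 / ((n : ℝ) + 1)) * |g y|) ∂β))
      atTop (𝓝 1) := by
    have h0 : Real.exp (-∫ y, (0 : ℝ) ∂β) = 1 := by simp
    suffices h : Tendsto (fun n : ℕ => ∫ y, Real.log (1 + (1 / ((n : ℝ) + 1)) * |g y|) ∂β)
        atTop (𝓝 (∫ y, (0 : ℝ) ∂β)) by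
      have := (Real.continuous_exp.tendsto _).comp h.neg
      rwa [h0] at this
    refine tendsto_integral_of_dominated_convergence (fun y => Real.log (1 + |g y|))
      (fun n => (hlogm _).aestronglyMeasurable) hlog (fun n => ae_of_all _ fun y => ?_) (ae_of_all _ fun y => ?_)
    · rw [Real.norm_of_nonneg (hlog0 _ y (by positivity))]
      refine hlogle _ y (by positivity) ?_
      rw [div_le_one (by positivity)]
      linarith [Nat.cast_nonneg (α := ℝ) n]
    · have h1 : Tendsto (fun n : ℕ => 1 + (1 / ((n : ℝ) + 1)) * |g y|) atTop (𝓝 1) := by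
        have := (tendsto_one_div_add_atTop_nhds_zero_nat (𝕜 := ℝ)).mul_const |g y|
        simpa using this.const_add 1
      have := (Real.continuousAt_log one_ne_zero).tendsto.comp h1
      simpa [Function.comp_def] using this
  have h1 : 1 ≤ Γ.real Sᶜ := le_of_tendsto' hlim fun n => key _ (by positivity) (by
    rw [div_le_one (by positivity)]
    linarith [Nat.cast_nonneg (α := ℝ) n])
  have h2 : Γ S = 0 := by
    have := probReal_compl_eq_one_sub (μ := Γ) hS
    have h3 : Γ.real S = 0 := le_antisymm (by linarith) measureReal_nonneg
    exact (measureReal_eq_zero_iff).1 h3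
  have h3 : ∀ᵐ μ ∂Γ, μ ∉ S := measure_eq_zero_iff_ae_notMem.1 h2
  filter_upwards [h3] with μ hμ
  exact ⟨hg.aestronglyMeasurable, lt_top_iff_ne_top.2 hμ⟩

end LaplaceFunctional

/-! ### The complex Laplace functional on its full domain of convergence -/

section LaplaceFunctional

variable {Y : Type*} [MeasurableSpace Y] {β : Measure Y} {Γ : Measure (Measure Y)}

lemma abs_le_of_between {x k : ℝ} (h1 : -max (-k) 0 ≤ x) (h2 : x ≤ max k 0) : |x| ≤ |k| := by
  refine abs_le.2 ⟨le_trans ?_ h1, h2.trans ?_⟩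
  · exact neg_le_neg (max_le (neg_le_abs k) (abs_nonneg k))
  · exact max_le (le_abs_self k) (abs_nonneg k)

lemma IsGammaProcess.ae_integrable_complex (hΓ : IsGammaProcess β Γ) {f : Y → ℂ}
    (hf : Measurable f) (hlog : Integrable (fun y => Real.log (1 + ‖f y‖)) β) :
    ∀ᵐ μ ∂Γ, Integrable f μ := by
  have h := hΓ.ae_integrable hf.norm (by simpa using hlog)
  filter_upwards [h] with μ hμ
  exact (integrable_norm_iff hf.aestronglyMeasurable).1 hμ

/-- The Laplace functional of a gamma process at complex functions `f`, provided that
`exp (μ ((Re f)⁻))` is integrable. -/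
lemma IsGammaProcess.laplace_of_dominated [IsFiniteMeasure β] (hΓ : IsGammaProcess β Γ)
    {f : Y → ℂ} (hf : Measurable f) (hlog : Integrable (fun y => Real.log (1 + ‖f y‖)) β)
    (hre : ∀ᵐ y ∂β, -1 < (f y).re)
    (hneg : Integrable (fun y => Real.log (1 - max (-(f y).re) 0)) β)
    (hexp : Integrable (fun μ : Measure Y => Real.exp (∫ y, max (-(f y).re) 0 ∂μ)) Γ) :
    Integrable (fun y => Complex.log (1 + f y)) β ∧
    Integrable (fun μ : Measure Y => Complex.exp (-∫ y, f y ∂μ)) Γ ∧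
    ∫ μ : Measure Y, Complex.exp (-∫ y, f y ∂μ) ∂Γ =
      Complex.exp (-∫ y, Complex.log (1 + f y) ∂β) := by
  have hfre : Measurable fun y => (f y).re := Complex.measurable_re.comp hf
  have hfim : Measurable fun y => (f y).im := Complex.measurable_im.comp hf
  obtain ⟨φ, hφ, hφt⟩ := exists_simpleFunc_tendsto hfre
  obtain ⟨ψ, hψ, hψt⟩ := exists_simpleFunc_tendsto hfim
  -- The real part of F n never drops below -(Re f)⁻. Hence Re F n > -1 almost everywhere for β, and
  -- exp(μ((Re f)⁻)) dominates all the exponentials.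
  let F : ℕ → SimpleFunc Y ℂ := fun n => (φ n).map (fun x : ℝ => (x : ℂ)) +
    (ψ n).map (fun x : ℝ => (x : ℂ) * Complex.I)
  have hF : ∀ n y, F n y = φ n y + ψ n y * Complex.I := fun n y => rfl
  have hFre : ∀ n y, (F n y).re = φ n y := fun n y => by simp [hF]
  have hFim : ∀ n y, (F n y).im = ψ n y := fun n y => by simp [hF]
  have hFlim : ∀ y, Tendsto (fun n => F n y) atTop (𝓝 (f y)) := by
    intro y
    have h1 : Tendsto (fun n => ((φ n y : ℝ) : ℂ) + ψ n y * Complex.I) atTop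
        (𝓝 (((f y).re : ℂ) + (f y).im * Complex.I)) :=
      ((Complex.continuous_ofReal.tendsto _).comp (hφt y)).add
        (((Complex.continuous_ofReal.tendsto _).comp (hψt y)).mul_const _)
    rwa [Complex.re_add_im] at h1
  have hFnorm : ∀ n y, ‖F n y‖ ≤ 2 * ‖f y‖ := by
    intro n y
    refine (Complex.norm_le_abs_re_add_abs_im _).trans ?_
    rw [hFre, hFim]
    have h1 := (abs_le_of_between (hφ n y).1 (hφ n y).2).trans (Complex.abs_re_le_norm _)
    have h2 := (abs_le_of_between (hψ n y).1 (hψ n y).2).trans (Complex.abs_im_le_norm _)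
    linarith
  have hFre1 : ∀ n, ∀ᵐ y ∂β, -1 < (F n y).re := by
    intro n
    filter_upwards [hre] with y hy
    rw [hFre]
    have : max (-(f y).re) 0 < 1 := max_lt (by linarith) one_pos
    linarith [(hφ n y).1]
  set B : Y → ℝ := fun y => Real.log 2 + Real.log (1 + ‖f y‖) +
    |Real.log (1 - max (-(f y).re) 0)| + Real.pi
  have hB : Integrable B β := (((integrable_const _).add hlog).add hneg.abs).add (integrable_const _)
  have hbound : ∀ n, ∀ᵐ y ∂β, ‖Complex.log (1 + F n y)‖ ≤ B y := by
    intro n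
    filter_upwards [hre] with y hy
    exact norm_log_one_add_le (max_lt (by linarith) one_pos) (by rw [hFre]; exact (hφ n y).1)
      (hFnorm n y)
  have hbound' : ∀ᵐ y ∂β, ‖Complex.log (1 + f y)‖ ≤ B y := by
    filter_upwards [hre] with y hy
    refine norm_log_one_add_le (max_lt (by linarith) one_pos)
      (by linarith [le_max_left (-(f y).re) 0]) (by linarith [norm_nonneg (f y)])
  have hloglim : Tendsto (fun n => ∫ y, Complex.log (1 + F n y) ∂β) atTop
      (𝓝 (∫ y, Complex.log (1 + f y) ∂β)) := by
    refine tendsto_integral_of_dominated_convergence B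
      (fun n => (Measurable.clog (by fun_prop)).aestronglyMeasurable) hB hbound ?_
    filter_upwards [hre] with y hy
    refine Tendsto.clog ((hFlim y).const_add 1) ?_
    left
    simp; linarith
  have hfint := hΓ.ae_integrable_complex hf hlog
  have hle : ∀ n, ∀ᵐ μ ∂Γ, ‖Complex.exp (-∫ y, F n y ∂μ)‖ ≤
      Real.exp (∫ y, max (-(f y).re) 0 ∂μ) := by
    intro n
    filter_upwards [hfint, hΓ.ae_isFiniteMeasure] with μ hμ hfin
    have hFi : Integrable (F n) μ := SimpleFunc.integrable_of_isFiniteMeasure _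
    rw [Complex.norm_exp, Complex.neg_re]
    refine Real.exp_le_exp.2 ?_
    have h1 : (∫ y, F n y ∂μ).re = ∫ y, (F n y).re ∂μ := (integral_re hFi).symm
    rw [h1, ← integral_neg]
    refine integral_mono hFi.re.neg ((hμ.re.neg).sup (integrable_const 0)) fun y => ?_
    have := (hφ n y).1
    change -(F n y).re ≤ max (-(f y).re) 0
    rw [hFre]
    linarith
  have hlim : ∀ᵐ μ ∂Γ, Tendsto (fun n => Complex.exp (-∫ y, F n y ∂μ)) atTop
      (𝓝 (Complex.exp (-∫ y, f y ∂μ))) := by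
    filter_upwards [hfint] with μ hμ
    refine (Complex.continuous_exp.tendsto _).comp (Tendsto.neg ?_)
    exact tendsto_integral_of_dominated_convergence (fun y => 2 * ‖f y‖)
      (fun n => (F n).measurable.aestronglyMeasurable) (hμ.norm.const_mul 2)
      (fun n => ae_of_all _ (hFnorm n)) (ae_of_all _ hFlim)
  have hsm : ∀ n, AEStronglyMeasurable (fun μ : Measure Y => Complex.exp (-∫ y, F n y ∂μ)) Γ :=
    fun n => (hΓ.laplace_simpleFunc (F n) (hFre1 n)).1.1
  refine ⟨hB.mono' (Measurable.clog (by fun_prop)).aestronglyMeasurable hbound',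
    hexp.mono' (aestronglyMeasurable_of_tendsto_ae _ hsm hlim) ?_, ?_⟩
  · filter_upwards [hlim, ae_all_iff.2 hle] with μ h1 h2
    exact le_of_tendsto' h1.norm h2
  · have h1 := tendsto_integral_of_dominated_convergence _ hsm hexp hle hlim
    have h2 : Tendsto (fun n => ∫ μ : Measure Y, Complex.exp (-∫ y, F n y ∂μ) ∂Γ) atTop
        (𝓝 (Complex.exp (-∫ y, Complex.log (1 + f y) ∂β))) := by
      simp_rw [fun n => (hΓ.laplace_simpleFunc (F n) (hFre1 n)).2]
      exact (Complex.continuous_exp.tendsto _).comp hloglim.neg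
    exact tendsto_nhds_unique h1 h2

/-- The Laplace functional at `-φ` for nonnegative simple functions `φ < 1`. -/
lemma IsGammaProcess.laplace_neg_simpleFunc [IsFiniteMeasure β] (hΓ : IsGammaProcess β Γ)
    (φ : SimpleFunc Y ℝ) (hφ1 : ∀ᵐ y ∂β, φ y < 1) :
    Integrable (fun μ : Measure Y => Real.exp (∫ y, φ y ∂μ)) Γ ∧
    ∫ μ : Measure Y, Real.exp (∫ y, φ y ∂μ) ∂Γ = Real.exp (-∫ y, Real.log (1 - φ y) ∂β) := by
  have h := hΓ.laplace_simpleFunc (φ.map fun x : ℝ => (-x : ℂ)) (hφ1.mono fun y hy => by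
    simp; linarith)
  have e1 : ∀ μ : Measure Y, Complex.exp (-∫ y, (φ.map fun x : ℝ => (-x : ℂ)) y ∂μ) =
      ((Real.exp (∫ y, φ y ∂μ) : ℝ) : ℂ) := by
    intro μ
    simp only [SimpleFunc.map_apply, integral_neg, neg_neg, Complex.ofReal_exp]
    rw [integral_complex_ofReal]
  have e2 : ∫ y, Complex.log (1 + (φ.map fun x : ℝ => (-x : ℂ)) y) ∂β =
      ((∫ y, Real.log (1 - φ y) ∂β : ℝ) : ℂ) := by
    rw [← integral_complex_ofReal]
    refine integral_congr_ae (hφ1.mono fun y hy => ?_)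
    simp only [SimpleFunc.map_apply]
    rw [Complex.ofReal_log (by linarith)]
    push_cast
    ring_nf
  simp_rw [e1] at h
  rw [e2, integral_complex_ofReal] at h
  exact ⟨by simpa only [RCLike.re_to_complex, Complex.ofReal_re] using h.1.re,
    by exact_mod_cast h.2⟩

lemma log_one_sub_nonpos {x : ℝ} (h0 : 0 ≤ x) (h1 : x < 1) : Real.log (1 - x) ≤ 0 :=
  Real.log_nonpos (by linarith) (by linarith)

/-- If `E[exp (-μ(h))]` is finite then `1 + h` is almost everywhere positive, and `exp (μ(h⁻))` is
integrable. -/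
lemma IsGammaProcess.dominated_of_integrable [IsFiniteMeasure β] (hΓ : IsGammaProcess β Γ)
    {h : Y → ℝ} (hh : Measurable h) (hlog : Integrable (fun y => Real.log (1 + |h y|)) β)
    (hexp : Integrable (fun μ : Measure Y => Real.exp (-∫ y, h y ∂μ)) Γ) :
    (∀ᵐ y ∂β, -1 < h y) ∧ Integrable (fun y => Real.log (1 - max (-h y) 0)) β ∧
    Integrable (fun μ : Measure Y => Real.exp (∫ y, max (-h y) 0 ∂μ)) Γ := by
  have := hΓ.isProbabilityMeasure
  have hint := hΓ.ae_integrable hh hlog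
  set M := ∫ μ, Real.exp (-∫ y, h y ∂μ) ∂Γ
  set c := ∫ y, Real.log (1 + max (h y) 0) ∂β
  have hlogp : Integrable (fun y => Real.log (1 + max (h y) 0)) β := by
    refine hlog.mono' (Measurable.log (by fun_prop)).aestronglyMeasurable
      (ae_of_all _ fun y => ?_)
    have h0 : 0 ≤ max (h y) 0 := le_max_right _ _
    rw [Real.norm_of_nonneg (Real.log_nonneg (by linarith))]
    exact Real.log_le_log (by linarith) (by
      linarith [max_le (le_abs_self (h y)) (abs_nonneg (h y))])
  -- Since h ≤ h⁺ - φ whenever φ ≤ h⁻, the Laplace functional at h⁺ - φ is at most M. It equals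
  -- exp(-c) exp(-∫ log(1-φ) dβ), because h⁺ and φ live on disjoint sets. The resulting bound is
  -- uniform in φ.
  have key : ∀ φ : SimpleFunc Y ℝ, (∀ y, 0 ≤ φ y) → (∀ y, φ y ≤ max (-h y) 0) →
      (∀ᵐ y ∂β, φ y < 1) → Real.exp (-∫ y, Real.log (1 - φ y) ∂β) ≤ M * Real.exp c := by
    intro φ h0 hle h1
    obtain ⟨hφi, -⟩ := hΓ.laplace_neg_simpleFunc φ h1
    have hlogφ : Integrable (fun y => Real.log (1 - φ y)) β := by
      have := SimpleFunc.integrable_of_isFiniteMeasure (μ := β)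
        (φ.map fun x => Real.log (1 - x))
      exact this
    have hneg : ∀ y, max (-(max (h y) 0 - φ y)) 0 = φ y := by
      intro y
      rcases le_total 0 (h y) with hy | hy
      · have : φ y = 0 := le_antisymm ((hle y).trans (max_le (by linarith) le_rfl)) (h0 y)
        rw [this, max_eq_left hy]
        simpa using hy
      · rw [max_eq_right hy]
        simpa using h0 y
    have hfm : Measurable fun y => ((max (h y) 0 - φ y : ℝ) : ℂ) :=
      Complex.measurable_ofReal.comp ((hh.max measurable_const).sub φ.measurable)
    have hres := hΓ.laplace_of_dominated (f := fun y => ((max (h y) 0 - φ y : ℝ) : ℂ)) hfm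
      (hlog.mono' (Measurable.log (by fun_prop)).aestronglyMeasurable (ae_of_all _ fun y => by
        have hn := norm_nonneg ((max (h y) 0 - φ y : ℝ) : ℂ)
        rw [Real.norm_of_nonneg (Real.log_nonneg (by linarith))]
        refine Real.log_le_log (by positivity) ?_
        rw [Complex.norm_real, Real.norm_eq_abs]
        refine add_le_add le_rfl (abs_le_of_between ?_ ?_)
        · linarith [hle y, le_max_right (h y) 0]
        · linarith [h0 y]))
      (by filter_upwards [h1] with y hy
          rw [Complex.ofReal_re]
          linarith [le_max_right (h y) 0])
      (by simpa only [Complex.ofReal_re, hneg] using hlogφ)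
      (by simpa only [Complex.ofReal_re, hneg] using hφi)
    obtain ⟨-, hi, he⟩ := hres
    have e1 : ∀ μ : Measure Y, Complex.exp (-∫ y, ((max (h y) 0 - φ y : ℝ) : ℂ) ∂μ) =
        ((Real.exp (-∫ y, (max (h y) 0 - φ y) ∂μ) : ℝ) : ℂ) := by
      intro μ
      rw [integral_complex_ofReal]
      push_cast
      rfl
    have e2 : ∫ y, Complex.log (1 + ((max (h y) 0 - φ y : ℝ) : ℂ)) ∂β =
        ((c + ∫ y, Real.log (1 - φ y) ∂β : ℝ) : ℂ) := by
      rw [← integral_add hlogp hlogφ, ← integral_complex_ofReal]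
      refine integral_congr_ae (h1.mono fun y hy => ?_)
      have h2 : 0 ≤ max (h y) 0 := le_max_right _ _
      simp only
      rw [← Complex.ofReal_one, ← Complex.ofReal_add, ← Complex.ofReal_log (by linarith)]
      congr 1
      rcases le_total 0 (h y) with hy0 | hy0
      · have : φ y = 0 := le_antisymm ((hle y).trans (max_le (by linarith) le_rfl)) (h0 y)
        simp [this]
      · rw [max_eq_right hy0]
        simp [sub_eq_add_neg]
    simp_rw [e1] at hi he
    rw [e2, integral_complex_ofReal] at he
    have he' : ∫ μ, Real.exp (-∫ y, (max (h y) 0 - φ y) ∂μ) ∂Γ =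
        Real.exp (-(c + ∫ y, Real.log (1 - φ y) ∂β)) := by exact_mod_cast he
    have hle2 : ∫ μ, Real.exp (-∫ y, (max (h y) 0 - φ y) ∂μ) ∂Γ ≤ M := by
      refine integral_mono_ae (by simpa only [RCLike.re_to_complex, Complex.ofReal_re] using hi.re)
        hexp ?_
      filter_upwards [hint, hΓ.ae_isFiniteMeasure] with μ hμ hf
      refine Real.exp_le_exp.2 (neg_le_neg ?_)
      refine integral_mono hμ ((hμ.sup (integrable_const 0)).sub
        (SimpleFunc.integrable_of_isFiniteMeasure φ)) fun y => ?_
      have := hle y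
      have h3 := max_zero_sub_max_neg_zero_eq_self (h y)
      change h y ≤ max (h y) 0 - φ y
      linarith
    rw [he', neg_add, Real.exp_add] at hle2
    have := Real.exp_pos c
    calc Real.exp (-∫ y, Real.log (1 - φ y) ∂β)
        = Real.exp c * (Real.exp (-c) * Real.exp (-∫ y, Real.log (1 - φ y) ∂β)) := by
          rw [← mul_assoc, ← Real.exp_add]; simp
      _ ≤ Real.exp c * M := by gcongr
      _ = M * Real.exp c := mul_comm _ _
  have hpos : 0 < M * Real.exp c := (Real.exp_pos _).trans_le
    (key 0 (fun y => le_rfl) (fun y => le_max_right _ _) (ae_of_all _ fun y => one_pos))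
  have hgt : ∀ᵐ y ∂β, -1 < h y := by
    have hA : MeasurableSet {y | h y ≤ -1} := hh measurableSet_Iic
    suffices h0 : β.real {y | h y ≤ -1} = 0 by
      rw [measureReal_eq_zero_iff] at h0
      filter_upwards [measure_eq_zero_iff_ae_notMem.1 h0] with y hy using not_le.1 hy
    by_contra hne
    set a := β.real {y | h y ≤ -1}
    have ha : 0 < a := lt_of_le_of_ne measureReal_nonneg (Ne.symm hne)
    -- With φ = 1 - exp(-x) on {h ≤ -1}, the integral of -log(1-φ) is ax; this x makes it exceed
    -- log(M exp(c)) and contradicts `key`.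
    set x := (|Real.log (M * Real.exp c)| + 1) / a
    have hx : 0 < x := by positivity
    have hex : Real.exp (-x) < 1 := by simpa using hx
    let φ : SimpleFunc Y ℝ := SimpleFunc.piecewise {y | h y ≤ -1} hA
      (SimpleFunc.const Y (1 - Real.exp (-x))) (SimpleFunc.const Y 0)
    have hφ : ∀ y, φ y = {y | h y ≤ -1}.indicator (fun _ => 1 - Real.exp (-x)) y := fun y => rfl
    have h1 := key φ (fun y => by
        rw [hφ]; exact indicator_nonneg (fun _ _ => by linarith) _) (fun y => by
        rw [hφ]
        by_cases hy : y ∈ {y | h y ≤ -1}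
        · rw [indicator_of_mem hy]
          exact le_max_of_le_left (by linarith [Real.exp_pos (-x), (show h y ≤ -1 from hy)])
        · rw [indicator_of_notMem hy]
          exact le_max_right _ _) (ae_of_all _ fun y => by
        rw [hφ]
        by_cases hy : y ∈ {y | h y ≤ -1}
        · rw [indicator_of_mem hy]
          linarith [Real.exp_pos (-x)]
        · rw [indicator_of_notMem hy]
          exact one_pos)
    have h2 : ∀ y, Real.log (1 - φ y) = {y | h y ≤ -1}.indicator (fun _ => -x) y := by
      intro y
      rw [hφ]
      by_cases hy : y ∈ {y | h y ≤ -1}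
      · rw [indicator_of_mem hy, indicator_of_mem hy]
        simp
      · rw [indicator_of_notMem hy, indicator_of_notMem hy]
        simp
    simp_rw [h2] at h1
    rw [integral_indicator_const _ hA, smul_eq_mul, ← Real.le_log_iff_exp_le hpos] at h1
    have h3 : a * x = |Real.log (M * Real.exp c)| + 1 := by
      simp only [x]; field_simp
    have h4 := le_abs_self (Real.log (M * Real.exp c))
    have h5 : -(a * -x) ≤ Real.log (M * Real.exp c) := h1
    linarith
  obtain ⟨φ, hφ, hφt⟩ := exists_simpleFunc_tendsto_nonneg (k := fun y => max (-h y) 0)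
    (hh.neg.max measurable_const) fun y => le_max_right _ _
  have hlt : ∀ᵐ y ∂β, max (-h y) 0 < 1 := by
    filter_upwards [hgt] with y hy using max_lt (by linarith) one_pos
  have hφ1 : ∀ n, ∀ᵐ y ∂β, φ n y < 1 := fun n => by
    filter_upwards [hlt] with y hy using ((hφ n y).2).trans_lt hy
  -- Simple functions φ n → h⁻ share this bound, so Fatou's lemma yields both integrability claims.
  have hφK := fun n => key (φ n) (fun y => (hφ n y).1) (fun y => (hφ n y).2) (hφ1 n)
  refine ⟨hgt, ?_, ?_⟩
  · have : Integrable (fun y => -Real.log (1 - max (-h y) 0)) β := by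
      refine integrable_of_tendsto_of_integral_le (F := fun n y => -Real.log (1 - φ n y))
        (K := Real.log (M * Real.exp c)) (fun n => ?_) (fun n => ?_) (fun n => ?_) ?_
      · exact (SimpleFunc.integrable_of_isFiniteMeasure (μ := β)
          ((φ n).map fun x => Real.log (1 - x))).neg
      · filter_upwards [hφ1 n] with y hy
        linarith [log_one_sub_nonpos (hφ n y).1 hy]
      · rw [integral_neg, Real.le_log_iff_exp_le hpos]
        exact hφK n
      · filter_upwards [hlt] with y hy
        exact (((hφt y).const_sub 1).log (by linarith)).neg
    simpa using this.neg
  · refine integrable_of_tendsto_of_integral_le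
      (F := fun n (μ : Measure Y) => Real.exp (∫ y, φ n y ∂μ)) (K := M * Real.exp c)
      (fun n => (hΓ.laplace_neg_simpleFunc (φ n) (hφ1 n)).1)
      (fun n => ae_of_all _ fun μ => (Real.exp_pos _).le) (fun n => ?_) ?_
    · rw [(hΓ.laplace_neg_simpleFunc (φ n) (hφ1 n)).2]
      exact hφK n
    · filter_upwards [hint] with μ hμ
      refine (Real.continuous_exp.tendsto _).comp ?_
      refine tendsto_integral_of_dominated_convergence (fun y => |h y|)
        (fun n => (φ n).measurable.aestronglyMeasurable) hμ.abs
        (fun n => ae_of_all _ fun y => ?_) (ae_of_all _ hφt)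
      rw [Real.norm_of_nonneg (hφ n y).1]
      exact (hφ n y).2.trans (max_le (neg_le_abs _) (abs_nonneg _))

/-- The Laplace functional of a gamma process wherever it converges absolutely. -/
theorem IsGammaProcess.laplace [IsFiniteMeasure β] (hΓ : IsGammaProcess β Γ) {f : Y → ℂ}
    (hf : Measurable f) (hlog : Integrable (fun y => Real.log (1 + ‖f y‖)) β)
    (hint : Integrable (fun μ : Measure Y => Complex.exp (-∫ y, f y ∂μ)) Γ) :
    (∀ᵐ y ∂β, -1 < (f y).re) ∧ Integrable (fun y => Complex.log (1 + f y)) β ∧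
    ∫ μ : Measure Y, Complex.exp (-∫ y, f y ∂μ) ∂Γ =
      Complex.exp (-∫ y, Complex.log (1 + f y) ∂β) := by
  have hfre : Measurable fun y => (f y).re := Complex.measurable_re.comp hf
  have hlogre : Integrable (fun y => Real.log (1 + |(f y).re|)) β := by
    refine hlog.mono' (Measurable.log (by fun_prop)).aestronglyMeasurable (ae_of_all _ fun y => ?_)
    rw [Real.norm_of_nonneg (Real.log_nonneg (by linarith [abs_nonneg (f y).re]))]
    exact Real.log_le_log (by positivity) (by linarith [Complex.abs_re_le_norm (f y)])
  -- The modulus of exp(-μ(f)) is exp(-μ(Re f)), which reduces the convergence question to the real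
  -- function Re f.
  have hexp : Integrable (fun μ : Measure Y => Real.exp (-∫ y, (f y).re ∂μ)) Γ := by
    refine hint.norm.congr ?_
    filter_upwards [hΓ.ae_integrable_complex hf hlog] with μ hμ
    rw [Complex.norm_exp, Complex.neg_re]
    congr 2
    exact (integral_re hμ).symm
  obtain ⟨h1, h2, h3⟩ := hΓ.dominated_of_integrable hfre hlogre hexp
  obtain ⟨h4, -, h6⟩ := hΓ.laplace_of_dominated hf hlog h1 h2 h3
  exact ⟨h1, h4, h6⟩

end LaplaceFunctional

/-! ### Powers of the total mass as beta mixtures of exponential tilts -/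

section BetaRepresentation

/-- The change of variables u = 1/(1+s), that is s = (1-u)/u, between the beta parameter and the
exponential tilt. -/
lemma image_inv_one_add_Ioi : (fun s : ℝ => (1 + s)⁻¹) '' Ioi 0 = Ioo 0 1 := by
  ext u
  constructor
  · rintro ⟨s, hs, rfl⟩
    have hs : 0 < s := hs
    exact ⟨by positivity, inv_lt_one_of_one_lt₀ (by linarith)⟩
  · rintro ⟨h0, h1⟩
    refine ⟨u⁻¹ - 1, ?_, by simp⟩
    have := (one_lt_inv₀ h0).2 h1
    simpa using this

/-- The power `T ^ (-r)` as a beta mixture of exponentials. -/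
lemma lintegral_betaMeasure_exp {q r T : ℝ} (hq : 0 < q) (hr : 0 < r) (hT : 0 < T) :
    ∫⁻ u, ENNReal.ofReal (u ^ (-(q + r)) * Real.exp (-((1 - u) / u * T)))
      ∂ProbabilityTheory.betaMeasure q r =
      ENNReal.ofReal (Real.Gamma (q + r) / Real.Gamma q * T ^ (-r)) := by
  have hΓq := Real.Gamma_pos_of_pos hq
  have hΓr := Real.Gamma_pos_of_pos hr
  have hΓqr := Real.Gamma_pos_of_pos (add_pos hq hr)
  have hB := ProbabilityTheory.beta_pos hq hr
  set B := ProbabilityTheory.beta q r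
  have hpdf : Measurable (ProbabilityTheory.betaPDF q r) :=
    (ProbabilityTheory.measurable_betaPDFReal q r).ennreal_ofReal
  rw [ProbabilityTheory.betaMeasure, lintegral_withDensity_eq_lintegral_mul _ hpdf (by fun_prop)]
  have h1 : ∫⁻ u, (ProbabilityTheory.betaPDF q r *
      fun u => ENNReal.ofReal (u ^ (-(q + r)) * Real.exp (-((1 - u) / u * T)))) u =
      ∫⁻ u in Ioo 0 1, ENNReal.ofReal ((1 / B * u ^ (q - 1) * (1 - u) ^ (r - 1)) *
        (u ^ (-(q + r)) * Real.exp (-((1 - u) / u * T)))) := by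
    rw [← lintegral_indicator measurableSet_Ioo]
    refine lintegral_congr fun u => ?_
    by_cases hu : u ∈ Ioo (0 : ℝ) 1
    · rw [indicator_of_mem hu, Pi.mul_apply, ProbabilityTheory.betaPDF_of_pos_lt_one hu.1 hu.2,
        ← ENNReal.ofReal_mul]
      have h1 : 0 < u := hu.1
      have h2 : 0 < 1 - u := sub_pos.2 hu.2
      positivity
    · rw [indicator_of_notMem hu, Pi.mul_apply, ProbabilityTheory.betaPDF_eq,
        if_neg (by simpa using hu)]
      simp
  have hderiv : ∀ s ∈ Ioi (0 : ℝ), HasDerivWithinAt (fun s : ℝ => (1 + s)⁻¹)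
      (-1 / (1 + s) ^ 2) (Ioi 0) s := by
    intro s hs
    have hs : 0 < s := hs
    exact (((hasDerivAt_id s).const_add 1).fun_inv (by simp; linarith)).hasDerivWithinAt
  have hinj : InjOn (fun s : ℝ => (1 + s)⁻¹) (Ioi 0) := by
    intro s _ t _ h
    simpa using h
  rw [h1, ← image_inv_one_add_Ioi,
    lintegral_image_eq_lintegral_abs_deriv_mul measurableSet_Ioi hderiv hinj]
  -- After the substitution all powers of 1 + s cancel: those of the beta density, of u^(-(q+r)) and
  -- of the Jacobian. A gamma integral in s remains.
  have h2 : ∀ s ∈ Ioi (0 : ℝ), ENNReal.ofReal |-1 / (1 + s) ^ 2| *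
      ENNReal.ofReal ((1 / B * (1 + s)⁻¹ ^ (q - 1) * (1 - (1 + s)⁻¹) ^ (r - 1)) *
        ((1 + s)⁻¹ ^ (-(q + r)) * Real.exp (-((1 - (1 + s)⁻¹) / (1 + s)⁻¹ * T)))) =
      ENNReal.ofReal (1 / B * (s ^ (r - 1) * Real.exp (-(T * s)))) := by
    intro s hs
    have hs : 0 < s := hs
    have hs1 : 0 < 1 + s := by linarith
    rw [← ENNReal.ofReal_mul (abs_nonneg _)]
    congr 1
    have e1 : 1 - (1 + s)⁻¹ = s / (1 + s) := by field_simp; ring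
    have e2 : s / (1 + s) / (1 + s)⁻¹ * T = T * s := by field_simp
    rw [e1, e2, Real.div_rpow hs.le hs1.le, Real.inv_rpow hs1.le, Real.inv_rpow hs1.le,
      Real.rpow_neg hs1.le, inv_inv, abs_div, abs_neg, abs_one, abs_of_pos (by positivity)]
    have e3 : (1 + s) ^ (q + r) = (1 + s) ^ (q - 1) * (1 + s) ^ (r - 1) * (1 + s) ^ 2 := by
      rw [← Real.rpow_natCast (1 + s) 2, ← Real.rpow_add hs1, ← Real.rpow_add hs1]
      congr 1
      push_cast
      ring
    rw [e3]
    have p1 : 0 < (1 + s) ^ (q - 1) := by positivity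
    have p2 : 0 < (1 + s) ^ (r - 1) := by positivity
    field_simp
  rw [setLIntegral_congr_fun measurableSet_Ioi h2, ← ofReal_integral_eq_lintegral_ofReal]
  · rw [integral_const_mul, Real.integral_rpow_mul_exp_neg_mul_Ioi hr hT]
    congr 1
    simp only [B, ProbabilityTheory.beta]
    rw [one_div, one_div, Real.inv_rpow hT.le, ← Real.rpow_neg hT.le]
    field_simp
  · refine Integrable.const_mul ?_ _
    have := integrableOn_rpow_mul_exp_neg_mul_rpow (p := 1) (s := r - 1) (b := T)
      (by linarith) one_pos hT
    simpa only [Real.rpow_one, neg_mul, IntegrableOn] using this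
  · filter_upwards [ae_restrict_mem measurableSet_Ioi] with s hs
    have hs : 0 < s := hs
    change 0 ≤ 1 / B * (s ^ (r - 1) * Real.exp (-(T * s)))
    positivity

lemma betaMeasure_ae_mem_Ioo (q r : ℝ) :
    ∀ᵐ u ∂ProbabilityTheory.betaMeasure q r, u ∈ Ioo (0 : ℝ) 1 := by
  have hpdf : Measurable (ProbabilityTheory.betaPDF q r) :=
    (ProbabilityTheory.measurable_betaPDFReal q r).ennreal_ofReal
  rw [ProbabilityTheory.betaMeasure, ae_withDensity_iff hpdf]
  refine ae_of_all _ fun u hu => ?_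
  by_contra h
  exact hu (by rw [ProbabilityTheory.betaPDF_eq, if_neg (by simpa using h)]; simp)

variable {Y : Type*} [MeasurableSpace Y] {β : Measure Y} {Γ : Measure (Measure Y)}

/-- The integral is 0 by convention where g is not integrable. Integrability is a measurable
condition on μ, and where it holds the integral is a difference of two measurable Lebesgue
integrals. -/
lemma measurable_integral_measure {g : Y → ℝ} (hg : Measurable g) :
    Measurable fun μ : Measure Y => ∫ y, g y ∂μ := by
  have h1 : (fun μ : Measure Y => ∫ y, g y ∂μ) = fun μ => if ∫⁻ y, ‖g y‖ₑ ∂μ < ∞ then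
      (∫⁻ y, ENNReal.ofReal (g y) ∂μ).toReal - (∫⁻ y, ENNReal.ofReal (-g y) ∂μ).toReal
      else 0 := by
    funext μ
    split_ifs with h
    · exact integral_eq_lintegral_pos_part_sub_lintegral_neg_part ⟨hg.aestronglyMeasurable, h⟩
    · exact integral_undef fun hi => h hi.2
  rw [h1]
  refine Measurable.ite (measurableSet_lt (Measure.measurable_lintegral hg.enorm)
    measurable_const) ?_ measurable_const
  exact (Measure.measurable_lintegral hg.ennreal_ofReal).ennreal_toReal.sub
    (Measure.measurable_lintegral hg.neg.ennreal_ofReal).ennreal_toReal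

lemma measurable_exp_integral {g : Y → ℝ} (hg : Measurable g) (z : ℂ) :
    Measurable fun μ : Measure Y => Complex.exp (-z * ((∫ y, g y ∂μ : ℝ) : ℂ)) :=
  ((Complex.measurable_ofReal.comp (measurable_integral_measure hg)).const_mul _).cexp

/-- From 1 + |s + zg| ≤ (1 + |s|)(1 + |z|)(1 + |g|): the growth condition survives adding the tilt s
to zg. -/
lemma integrable_log_affine [IsFiniteMeasure β] {g : Y → ℝ} (hg : Measurable g)
    (hlog : Integrable (fun y => Real.log (1 + |g y|)) β) (s z : ℂ) :
    Integrable (fun y => Real.log (1 + ‖s + z * g y‖)) β := by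
  refine ((integrable_const (Real.log (1 + ‖s‖) + Real.log (1 + ‖z‖))).add hlog).mono'
    (Measurable.log (by fun_prop)).aestronglyMeasurable (ae_of_all _ fun y => ?_)
  rw [Real.norm_of_nonneg (Real.log_nonneg (by linarith [norm_nonneg (s + z * g y)])), Pi.add_apply,
    ← Real.log_mul (by positivity) (by positivity), ← Real.log_mul (by positivity) (by positivity)]
  refine Real.log_le_log (by positivity) ?_
  have h1 : ‖s + z * g y‖ ≤ ‖s‖ + ‖z‖ * |g y| := (norm_add_le _ _).trans (by
    rw [norm_mul, Complex.norm_real, Real.norm_eq_abs])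
  have h2 : 0 ≤ ‖s‖ * ‖z‖ := by positivity
  have h3 : 0 ≤ ‖s‖ * |g y| := by positivity
  have h4 : 0 ≤ ‖s‖ * ‖z‖ * |g y| := by positivity
  nlinarith [norm_nonneg s, norm_nonneg z, abs_nonneg (g y)]

/-- The weight `u ^ (-b) exp (-(1 - u) / u * μ(Y))`, whose beta mixture is the density of the
Beta-Gamma process. -/
noncomputable def tiltWeight (b : ℝ) (μ : Measure Y) (u : ℝ) : ℝ :=
  u ^ (-b) * Real.exp (-((1 - u) / u * μ.real univ))

lemma measurable_tiltWeight (b : ℝ) :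
    Measurable fun p : Measure Y × ℝ => tiltWeight b p.1 p.2 := by
  have : Measurable fun p : Measure Y × ℝ => p.1.real univ :=
    (measurable_measureReal (Y := Y) MeasurableSet.univ).comp measurable_fst
  unfold tiltWeight
  fun_prop

lemma tiltWeight_nonneg {b u : ℝ} (hu : 0 < u) (μ : Measure Y) : 0 ≤ tiltWeight b μ u := by
  unfold tiltWeight
  positivity

/-- Mixing the tilts over the beta distribution gives the density of the Beta-Gamma process. -/
lemma integral_tiltWeight {b q : ℝ} (hq : 0 < q) (hr : 0 < b - q) {μ : Measure Y}
    (hμ : 0 < μ.real univ) :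
    Integrable (fun u => tiltWeight b μ u) (ProbabilityTheory.betaMeasure q (b - q)) ∧
    ∫ u, tiltWeight b μ u ∂ProbabilityTheory.betaMeasure q (b - q) =
      (ENNReal.ofReal (Real.Gamma b / Real.Gamma (b - (b - q)) *
        μ.real univ ^ (-(b - q)))).toReal := by
  have h0 : 0 ≤ᵐ[ProbabilityTheory.betaMeasure q (b - q)] fun u => tiltWeight b μ u := by
    filter_upwards [betaMeasure_ae_mem_Ioo q (b - q)] with u hu using tiltWeight_nonneg hu.1 μ
  have hm : AEStronglyMeasurable (fun u => tiltWeight b μ u)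
      (ProbabilityTheory.betaMeasure q (b - q)) :=
    ((measurable_tiltWeight b).comp measurable_prodMk_left).aestronglyMeasurable
  have h1 := lintegral_betaMeasure_exp hq hr hμ
  rw [show q + (b - q) = b by ring] at h1
  have h2 : ∫⁻ u, ENNReal.ofReal (tiltWeight b μ u) ∂ProbabilityTheory.betaMeasure q (b - q) = _ :=
    h1
  rw [sub_sub_cancel]
  refine ⟨⟨hm, ?_⟩, ?_⟩
  · rw [hasFiniteIntegral_iff_ofReal h0, h2]
    exact ENNReal.ofReal_lt_top
  · rw [integral_eq_lintegral_of_nonneg_ae h0 hm, h2]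

/-- The Laplace functional of a tilted gamma process. -/
lemma IsGammaProcess.integral_tiltWeight_smul [IsFiniteMeasure β] (hΓ : IsGammaProcess β Γ)
    {g : Y → ℝ} (hg : Measurable g) (hlog : Integrable (fun y => Real.log (1 + |g y|)) β) {z : ℂ}
    {u : ℝ} (hu : u ∈ Ioo (0 : ℝ) 1)
    (hint : Integrable (fun μ : Measure Y => tiltWeight (β.real univ) μ u •
      Complex.exp (-z * ((∫ y, g y ∂μ : ℝ) : ℂ))) Γ) :
    (∀ᵐ y ∂β, 0 < (1 + u * z * g y : ℂ).re) ∧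
    Integrable (fun y => Complex.log (1 + u * z * g y)) β ∧
    ∫ μ : Measure Y, tiltWeight (β.real univ) μ u • Complex.exp (-z * ((∫ y, g y ∂μ : ℝ) : ℂ)) ∂Γ =
      expLog β z g u := by
  obtain ⟨hu0, hu1⟩ := hu
  set b := β.real univ with hb
  -- The weight exp(-sT) replaces zg by s + zg, and 1 + s = 1/u. The factor 1/u is positive, so the
  -- principal logarithm of (1 + uzg)/u splits into -log u + log(1 + uzg).
  obtain ⟨s, hs⟩ : ∃ s, s = (1 - u) / u := ⟨_, rfl⟩
  have hs1 : 1 + s = u⁻¹ := by rw [hs]; field_simp; ring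
  let f : Y → ℂ := fun y => (s : ℂ) + z * g y
  have hf : Measurable f := by fun_prop
  have hflog : Integrable (fun y => Real.log (1 + ‖f y‖)) β :=
    integrable_log_affine hg hlog (s : ℂ) z
  have hfK : ∀ᵐ μ ∂Γ, tiltWeight b μ u • Complex.exp (-z * ((∫ y, g y ∂μ : ℝ) : ℂ)) =
      ((u ^ (-b) : ℝ) : ℂ) * Complex.exp (-∫ y, f y ∂μ) := by
    filter_upwards [hΓ.ae_integrable hg hlog, hΓ.ae_isFiniteMeasure] with μ hμ hfin
    have h1 : ∫ y, f y ∂μ = s * μ.real univ + z * ((∫ y, g y ∂μ : ℝ) : ℂ) := by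
      simp only [f]
      have hgi : Integrable (fun y => z * (g y : ℂ)) μ := hμ.ofReal.const_mul z
      rw [integral_add (integrable_const _) hgi, integral_const,
        integral_const_mul, integral_complex_ofReal, Complex.real_smul]
      ring
    rw [h1, tiltWeight, ← hs, Complex.real_smul, neg_add, Complex.exp_add]
    push_cast
    ring_nf
  have hup : ((u ^ (-b) : ℝ) : ℂ) ≠ 0 := by
    have : 0 < u ^ (-b) := by positivity
    exact_mod_cast this.ne'
  have hfI : Integrable (fun μ : Measure Y => Complex.exp (-∫ y, f y ∂μ)) Γ := by
    have h1 := (hint.congr hfK).const_mul ((u ^ (-b) : ℝ) : ℂ)⁻¹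
    refine h1.congr (ae_of_all _ fun μ => ?_)
    simp only [inv_mul_cancel_left₀ hup]
  obtain ⟨h1, h2, h3⟩ := hΓ.laplace hf hflog hfI
  have huC : (u : ℂ) ≠ 0 := by exact_mod_cast hu0.ne'
  have hfeq : ∀ y, 1 + f y = ((u⁻¹ : ℝ) : ℂ) * (1 + u * z * g y) := by
    intro y
    simp only [f]
    rw [← add_assoc, ← Complex.ofReal_one, ← Complex.ofReal_add, hs1]
    push_cast
    field_simp
  have hre : ∀ᵐ y ∂β, 0 < (1 + u * z * g y : ℂ).re := by
    filter_upwards [h1] with y hy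
    have h4 : 0 < (1 + f y).re := by
      rw [Complex.add_re, Complex.one_re]; linarith
    rw [hfeq, Complex.re_ofReal_mul] at h4
    exact (pos_iff_pos_of_mul_pos h4).1 (by positivity)
  have hlogeq : ∀ᵐ y ∂β, Complex.log (1 + f y) =
      ((-Real.log u : ℝ) : ℂ) + Complex.log (1 + u * z * g y) := by
    filter_upwards [hre] with y hy
    rw [hfeq, Complex.log_ofReal_mul (by positivity), Real.log_inv]
    intro h0
    rw [h0] at hy
    simp at hy
  have hlogI : Integrable (fun y => Complex.log (1 + u * z * g y)) β := by
    refine ((h2.congr hlogeq).sub (integrable_const ((-Real.log u : ℝ) : ℂ))).congr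
      (ae_of_all _ fun y => ?_)
    simp
  refine ⟨hre, hlogI, ?_⟩
  -- The constant -log u integrates against β to -b log u, with b the total mass of β; its
  -- exponential cancels the prefactor u^(-b) exactly.
  have hexpu : ((u ^ (-b) : ℝ) : ℂ) * Complex.exp (-(b • ((-Real.log u : ℝ) : ℂ))) = 1 := by
    rw [Real.rpow_def_of_pos hu0, Complex.ofReal_exp, ← Complex.exp_add, Complex.real_smul]
    push_cast
    ring_nf
    exact Complex.exp_zero
  rw [integral_congr_ae hfK, integral_const_mul, h3, integral_congr_ae hlogeq,
    integral_add (integrable_const _) hlogI, integral_const, expLog, neg_add, Complex.exp_add,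
    ← mul_assoc, ← hb, hexpu, one_mul]

lemma laplaceConverges_iff {d : ℝ} {z : ℂ} {g : Y → ℝ} :
    LaplaceConverges (betaGammaLaw β Γ d) z g ↔
      Integrable (fun μ : Measure Y => (ENNReal.ofReal (Real.Gamma (β.real univ) /
        Real.Gamma (β.real univ - d) * μ.real univ ^ (-d))).toReal •
        Complex.exp (-z * ((∫ y, g y ∂μ : ℝ) : ℂ))) Γ := by
  rw [LaplaceConverges, betaGammaLaw,
    integrable_withDensity_iff_integrable_smul' (measurable_betaGammaDensity _ _) (by simp)]

lemma laplaceFunctional_betaGammaLaw (d : ℝ) (z : ℂ) (g : Y → ℝ) :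
    laplaceFunctional (betaGammaLaw β Γ d) z g =
      ∫ μ : Measure Y, (ENNReal.ofReal (Real.Gamma (β.real univ) /
        Real.Gamma (β.real univ - d) * μ.real univ ^ (-d))).toReal •
        Complex.exp (-z * ((∫ y, g y ∂μ : ℝ) : ℂ)) ∂Γ := by
  rw [laplaceFunctional, betaGammaLaw,
    integral_withDensity_eq_integral_toReal_smul (measurable_betaGammaDensity _ _) (by simp)]

/-- Justifies Fubini: integrating the modulus over u first returns the Beta-Gamma density times the
modulus of the exponential, so joint integrability reduces to absolute convergence of the Laplace
functional. -/
lemma IsGammaProcess.integrable_tiltWeight_prod [IsFiniteMeasure β] (hΓ : IsGammaProcess β Γ)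
    {q : ℝ} (hq : 0 < q) (hr : 0 < β.real univ - q) {g : Y → ℝ} (hg : Measurable g) {z : ℂ}
    (hz : LaplaceConverges (betaGammaLaw β Γ (β.real univ - q)) z g) :
    Integrable (fun p : Measure Y × ℝ => tiltWeight (β.real univ) p.1 p.2 •
      Complex.exp (-z * ((∫ y, g y ∂p.1 : ℝ) : ℂ)))
      (Γ.prod (ProbabilityTheory.betaMeasure q (β.real univ - q))) := by
  have := hΓ.isProbabilityMeasure
  have := ProbabilityTheory.isProbabilityMeasureBeta hq hr
  have hpos : ∀ᵐ μ ∂Γ, 0 < μ.real univ := hΓ.ae_pos (by linarith)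
  have hm : Measurable fun p : Measure Y × ℝ => tiltWeight (β.real univ) p.1 p.2 •
      Complex.exp (-z * ((∫ y, g y ∂p.1 : ℝ) : ℂ)) :=
    (measurable_tiltWeight _).smul ((measurable_exp_integral hg z).comp measurable_fst)
  have hz' := (laplaceConverges_iff.1 hz).norm
  refine (integrable_prod_iff hm.aestronglyMeasurable).2 ⟨?_, ?_⟩
  · filter_upwards [hpos] with μ hμ
    exact (integral_tiltWeight hq hr hμ).1.smul_const _
  · refine hz'.congr ?_
    filter_upwards [hpos] with μ hμ
    rw [norm_smul, Real.norm_of_nonneg ENNReal.toReal_nonneg, ← (integral_tiltWeight hq hr hμ).2,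
      ← integral_mul_const]
    refine integral_congr_ae ?_
    filter_upwards [betaMeasure_ae_mem_Ioo q (β.real univ - q)] with u hu
    rw [norm_smul, Real.norm_of_nonneg (tiltWeight_nonneg hu.1 μ)]

/-- The Laplace functional of a Beta-Gamma process as a beta mixture. -/
theorem IsGammaProcess.laplace_betaGamma [IsFiniteMeasure β] (hΓ : IsGammaProcess β Γ) {q : ℝ}
    (hq : 0 < q) (hr : 0 < β.real univ - q) {g : Y → ℝ} (hg : Measurable g)
    (hlog : Integrable (fun y => Real.log (1 + |g y|)) β) {z : ℂ}
    (hz : LaplaceConverges (betaGammaLaw β Γ (β.real univ - q)) z g) :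
    (∀ᵐ u : ℝ ∂ProbabilityTheory.betaMeasure q (β.real univ - q), u ∈ Ioo (0 : ℝ) 1 ∧
      (∀ᵐ y ∂β, 0 < (1 + u * z * g y : ℂ).re) ∧
      Integrable (fun y => Complex.log (1 + u * z * g y)) β) ∧
    Integrable (expLog β z g) (ProbabilityTheory.betaMeasure q (β.real univ - q)) ∧
    laplaceFunctional (betaGammaLaw β Γ (β.real univ - q)) z g =
      ∫ u, expLog β z g u ∂ProbabilityTheory.betaMeasure q (β.real univ - q) := by
  have := hΓ.isProbabilityMeasure
  have := ProbabilityTheory.isProbabilityMeasureBeta hq hr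
  have hK := hΓ.integrable_tiltWeight_prod hq hr hg hz
  have hmain : ∀ᵐ u : ℝ ∂ProbabilityTheory.betaMeasure q (β.real univ - q),
      (u ∈ Ioo (0 : ℝ) 1 ∧ (∀ᵐ y ∂β, 0 < (1 + u * z * g y : ℂ).re) ∧
      Integrable (fun y => Complex.log (1 + u * z * g y)) β) ∧
      ∫ μ : Measure Y, tiltWeight (β.real univ) μ u •
        Complex.exp (-z * ((∫ y, g y ∂μ : ℝ) : ℂ)) ∂Γ = expLog β z g u := by
    filter_upwards [hK.prod_left_ae, betaMeasure_ae_mem_Ioo q (β.real univ - q)] with u hu hu01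
    obtain ⟨h1, h2, h3⟩ := hΓ.integral_tiltWeight_smul hg hlog hu01 hu
    exact ⟨⟨hu01, h1, h2⟩, h3⟩
  refine ⟨hmain.mono fun u hu => hu.1, ?_, ?_⟩
  · exact hK.integral_prod_right.congr (hmain.mono fun u hu => hu.2)
  · have h1 : laplaceFunctional (betaGammaLaw β Γ (β.real univ - q)) z g = ∫ μ : Measure Y,
        ∫ u, tiltWeight (β.real univ) μ u • Complex.exp (-z * ((∫ y, g y ∂μ : ℝ) : ℂ))
          ∂ProbabilityTheory.betaMeasure q (β.real univ - q) ∂Γ := by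
      rw [laplaceFunctional_betaGammaLaw]
      refine integral_congr_ae ?_
      filter_upwards [hΓ.ae_pos (by linarith)] with μ hμ
      rw [integral_smul_const, (integral_tiltWeight hq hr hμ).2]
    rw [h1, integral_integral_swap hK]
    exact integral_congr_ae (hmain.mono fun u hu => hu.2)

end BetaRepresentation

/-! ### Gamma vectors and Dirichlet vectors -/

section FiniteDimensional

variable {k : ℕ} {a : Fin k → ℝ}

/-- Exponential tilting of independent gamma variables amounts to rescaling. -/
lemma pi_gammaDist_withDensity (ha : ∀ i, 0 ≤ a i) {c : ℝ} (hc : 0 ≤ c) :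
    (Measure.pi fun i => gammaDist (a i)).withDensity
      (fun x => ENNReal.ofReal (Real.exp (-(c * ∑ i, x i)))) =
    ENNReal.ofReal (Real.exp (-((∑ i, a i) * Real.log (1 + c)))) •
      (Measure.pi fun i => gammaDist (a i)).map fun x i => x i / (1 + c) := by
  have hp : ∀ i, IsProbabilityMeasure (gammaDist (a i)) := fun i =>
    isProbabilityMeasure_gammaDist (ha i)
  set P := Measure.pi fun i => gammaDist (a i)
  have hP0 : ∀ᵐ x ∂P, ∀ i, 0 ≤ x i := ae_all_iff.2 fun i =>
    (measurePreserving_eval _ i).quasiMeasurePreserving.ae (gammaDist_ae_nonneg _)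
  have hdm : Measurable fun x : Fin k → ℝ => ENNReal.ofReal (Real.exp (-(c * ∑ i, x i))) := by
    fun_prop
  have hsm : Measurable fun (x : Fin k → ℝ) i => x i / (1 + c) := by fun_prop
  have hfin : IsFiniteMeasure (P.withDensity
      (fun x => ENNReal.ofReal (Real.exp (-(c * ∑ i, x i))))) := by
    refine isFiniteMeasure_withDensity (ne_top_of_le_ne_top (b := ∫⁻ x, 1 ∂P) (by simp) ?_)
    refine lintegral_mono_ae ?_
    filter_upwards [hP0] with x hx
    refine ENNReal.ofReal_le_one.2 (Real.exp_le_one_iff.2 (neg_nonpos.2 ?_))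
    exact mul_nonneg hc (Finset.sum_nonneg fun i _ => hx i)
  have hfin2 := Measure.isFiniteMeasure_map P fun x i => x i / (1 + c)
  have hfin3 : IsFiniteMeasure (ENNReal.ofReal (Real.exp (-((∑ i, a i) * Real.log (1 + c)))) •
      P.map fun x i => x i / (1 + c)) :=
    ⟨by simpa using ENNReal.mul_lt_top ENNReal.ofReal_lt_top (measure_lt_top _ univ)⟩
  have key := map_eq_of_laplace (X := id) (X' := id) (P := P.withDensity
      (fun x => ENNReal.ofReal (Real.exp (-(c * ∑ i, x i)))))
      (P' := ENNReal.ofReal (Real.exp (-((∑ i, a i) * Real.log (1 + c)))) •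
      P.map fun x i => x i / (1 + c)) measurable_id measurable_id
      ((withDensity_absolutelyContinuous _ _).ae_le hP0) ?_ fun m => ?_
  · simpa using key
  · refine Measure.ae_smul_measure ?_ _
    have hS : MeasurableSet {x : Fin k → ℝ | ∀ i, 0 ≤ x i} := by
      rw [ofPred_forall]
      exact MeasurableSet.iInter fun i => measurableSet_le measurable_const (measurable_pi_apply i)
    refine (ae_map_iff hsm.aemeasurable hS).2 ?_
    filter_upwards [hP0] with x hx i using div_nonneg (hx i) (by linarith)
  · have hL : ∀ c : Fin k → ℝ, (∀ i, 0 ≤ c i) →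
        ∫ x, Real.exp (-∑ i, c i * x i) ∂P = ∏ i, Real.exp (-(a i * Real.log (1 + c i))) := by
      intro c hc
      simp_rw [← Finset.sum_neg_distrib, Real.exp_sum]
      rw [integral_fintype_prod_eq_prod (𝕜 := ℝ) (f := fun i x => Real.exp (-(c i * x)))]
      exact Finset.prod_congr rfl fun i _ =>
        integral_exp_gammaDist_real (ha i) (by linarith [hc i])
    rw [integral_withDensity_eq_integral_toReal_smul hdm (by simp), integral_smul_measure,
      integral_map hsm.aemeasurable (Measurable.aestronglyMeasurable (by fun_prop))]
    have e1 : ∀ x : Fin k → ℝ, (ENNReal.ofReal (Real.exp (-(c * ∑ i, x i)))).toReal •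
        Real.exp (-∑ i, (m i : ℝ) * id x i) = Real.exp (-∑ i, (c + m i) * x i) := by
      intro x
      rw [ENNReal.toReal_ofReal (Real.exp_pos _).le, smul_eq_mul, ← Real.exp_add, ← neg_add,
        Finset.mul_sum, ← Finset.sum_add_distrib]
      simp [add_mul]
    have e2 : ∀ x : Fin k → ℝ, Real.exp (-∑ i, (m i : ℝ) * id (fun i => x i / (1 + c)) i) =
        Real.exp (-∑ i, (m i / (1 + c)) * x i) := by
      intro x
      congr 2
      exact Finset.sum_congr rfl fun i _ => by simp only [id]; ring
    simp_rw [e1, e2]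
    rw [hL _ fun i => by positivity, hL _ fun i => by positivity,
      ENNReal.toReal_ofReal (Real.exp_pos _).le, smul_eq_mul, Finset.sum_mul,
      ← Finset.sum_neg_distrib, Real.exp_sum, ← Finset.prod_mul_distrib]
    refine Finset.prod_congr rfl fun i _ => ?_
    -- Coordinatewise the two Laplace transforms agree because (1 + c)(1 + m_i/(1 + c)) = 1 + c +
    -- m_i.
    rw [← Real.exp_add, ← neg_add, ← mul_add, ← Real.log_mul (by positivity) (by positivity)]
    congr 4
    field_simp
    ring

/-- A Dirichlet vector multiplied by an independent gamma variable whose shape is the sum of its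
parameters has independent gamma components. -/
lemma map_mul_gamma_dirichlet (ha : ∀ i, 0 ≤ a i) (hpos : 0 < ∑ i, a i) :
    ((ProbabilityTheory.gammaMeasure (∑ i, a i) 1).prod (dirichletDist a)).map
      (fun p i => p.1 * p.2 i) = Measure.pi fun i => gammaDist (a i) := by
  have hp : ∀ i, IsProbabilityMeasure (gammaDist (a i)) := fun i =>
    isProbabilityMeasure_gammaDist (ha i)
  have hg := ProbabilityTheory.isProbabilityMeasure_gammaMeasure hpos one_pos
  set P := Measure.pi fun i => gammaDist (a i) with hPdef
  set γ := ProbabilityTheory.gammaMeasure (∑ i, a i) 1 with hγ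
  have hP0 : ∀ᵐ x ∂P, ∀ i, 0 ≤ x i := ae_all_iff.2 fun i =>
    (measurePreserving_eval _ i).quasiMeasurePreserving.ae (gammaDist_ae_nonneg _)
  let W : (Fin k → ℝ) → Fin k → ℝ := fun x i => x i / ∑ j, x j
  have hW : Measurable W := by fun_prop
  have hDir : dirichletDist a = P.map W := rfl
  have hDirP : IsProbabilityMeasure (dirichletDist a) := by
    rw [hDir]; exact Measure.isProbabilityMeasure_map hW.aemeasurable
  -- The sum, in slot `none`, is recorded together with the normalized vector, so that their
  -- independence can be read off a joint Laplace transform.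
  let X : (Fin k → ℝ) → Option (Fin k) → ℝ := fun x o => o.elim (∑ j, x j) (W x)
  let X' : ℝ × (Fin k → ℝ) → Option (Fin k) → ℝ := fun p o => o.elim p.1 p.2
  have hX : Measurable X := by
    refine measurable_pi_lambda _ fun o => ?_
    rcases o with _ | i
    · simp only [X, Option.elim]; fun_prop
    · exact (measurable_pi_apply i).comp hW
  have hX' : Measurable X' := by
    refine measurable_pi_lambda _ fun o => ?_
    rcases o with _ | i
    · exact measurable_fst
    · exact (measurable_pi_apply i).comp measurable_snd
  have hD0 : ∀ᵐ w ∂dirichletDist a, ∀ i, 0 ≤ w i := by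
    have hS : MeasurableSet {x : Fin k → ℝ | ∀ i, 0 ≤ x i} := by
      rw [ofPred_forall]
      exact MeasurableSet.iInter fun i => measurableSet_le measurable_const (measurable_pi_apply i)
    rw [hDir, ae_map_iff hW.aemeasurable hS]
    filter_upwards [hP0] with x hx i
    exact div_nonneg (hx i) (Finset.sum_nonneg fun j _ => hx j)
  have hXX : P.map X = (γ.prod (dirichletDist a)).map X' := by
    refine map_eq_of_laplace hX hX' ?_ ?_ fun n => ?_
    · filter_upwards [hP0] with x hx o
      rcases o with _ | i
      · exact Finset.sum_nonneg fun j _ => hx j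
      · exact div_nonneg (hx i) (Finset.sum_nonneg fun j _ => hx j)
    · have h1 : ∀ᵐ p ∂γ.prod (dirichletDist a), 0 < p.1 :=
        Measure.quasiMeasurePreserving_fst.ae (gammaMeasure_ae_pos _)
      have h2 : ∀ᵐ p ∂γ.prod (dirichletDist a), ∀ i, 0 ≤ p.2 i :=
        Measure.quasiMeasurePreserving_snd.ae hD0
      filter_upwards [h1, h2] with p h1 h2 o
      rcases o with _ | i
      · exact h1.le
      · exact h2 i
    · have hm2 : AEStronglyMeasurable (fun w : Fin k → ℝ =>
          Real.exp (-∑ i, (n (some i) : ℝ) * w i)) (P.map W) :=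
        Measurable.aestronglyMeasurable (by fun_prop)
      have r1 : ∫ p, Real.exp (-∑ o, (n o : ℝ) * X' p o) ∂γ.prod (dirichletDist a) =
          Real.exp (-((∑ i, a i) * Real.log (1 + n none))) *
          ∫ x, Real.exp (-∑ i, (n (some i) : ℝ) * W x i) ∂P := by
        rw [← integral_map hW.aemeasurable hm2, ← hDir]
        have h1 : Real.exp (-((∑ i, a i) * Real.log (1 + n none))) =
            ∫ t, Real.exp (-((n none : ℝ) * t)) ∂γ := by
          have h0 := integral_exp_gammaDist_real hpos.le (c := n none)
            (by linarith [Nat.cast_nonneg (α := ℝ) (n none)])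
          rw [← h0, gammaDist, if_neg hpos.ne']
        rw [h1, ← integral_prod_mul]
        refine integral_congr_ae (ae_of_all _ fun p => ?_)
        simp only [X', Fintype.sum_option, Option.elim]
        rw [← Real.exp_add, neg_add]
      -- The Laplace variable of the sum acts as an exponential tilt, which is a rescaling up to a
      -- constant. Rescaling does not move the normalized vector, so the transform factorizes.
      have r2 : ∫ x, Real.exp (-∑ o, (n o : ℝ) * X x o) ∂P =
          ∫ x, Real.exp (-∑ i, (n (some i) : ℝ) * W x i) ∂P.withDensity
            (fun x => ENNReal.ofReal (Real.exp (-((n none : ℝ) * ∑ i, x i)))) := by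
        rw [integral_withDensity_eq_integral_toReal_smul (by fun_prop) (by simp)]
        refine integral_congr_ae (ae_of_all _ fun x => ?_)
        simp only [X, Fintype.sum_option, Option.elim]
        rw [ENNReal.toReal_ofReal (Real.exp_pos _).le, smul_eq_mul, ← Real.exp_add, neg_add]
      have hsm : Measurable fun (x : Fin k → ℝ) i => x i / (1 + (n none : ℝ)) := by fun_prop
      rw [r1, r2, pi_gammaDist_withDensity ha (Nat.cast_nonneg _), integral_smul_measure,
        integral_map hsm.aemeasurable (Measurable.aestronglyMeasurable (by fun_prop)), ENNReal.toReal_ofReal (Real.exp_pos _).le,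
        smul_eq_mul]
      congr 1
      refine integral_congr_ae (ae_of_all _ fun x => ?_)
      simp only [W, ← Finset.sum_div]
      have h1 : (1 + (n none : ℝ)) ≠ 0 := by positivity
      simp_rw [div_div_div_cancel_right₀ h1]
  let f : (Option (Fin k) → ℝ) → Fin k → ℝ := fun x i => x none * x (some i)
  have hf : Measurable f := by fun_prop
  have h1 := congrArg (fun ν => ν.map f) hXX
  rw [Measure.map_map hf hX, Measure.map_map hf hX'] at h1
  have h2 : P.map (f ∘ X) = P := by
    conv_rhs => rw [← Measure.map_id (μ := P)]
    refine Measure.map_congr ?_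
    filter_upwards [hP0] with x hx
    funext i
    simp only [f, X, W, Function.comp, Option.elim, id]
    -- If the sum is 0, so is every nonnegative coordinate, which agrees with the product 0 · (x i /
    -- 0).
    by_cases hS : ∑ j, x j = 0
    · rw [hS, zero_mul]
      exact ((Finset.sum_eq_zero_iff_of_nonneg fun j _ => hx j).1 hS i (Finset.mem_univ i)).symm
    · field_simp
  rw [h2] at h1
  exact h1.symm

end FiniteDimensional

/-! ### Total mass and normalization; the Markov–Krein identity -/

section Disintegration

variable {Y : Type*} [MeasurableSpace Y] {β : Measure Y} {Γ D : Measure (Measure Y)}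

/-- The measure with total mass `p.1` and normalization `p.2`. -/
noncomputable def scaleMeasure (p : ℝ × Measure Y) : Measure Y := ENNReal.ofReal p.1 • p.2

lemma measurable_scaleMeasure : Measurable (scaleMeasure (Y := Y)) := by
  refine Measure.measurable_of_measurable_coe _ fun s hs => ?_
  simp only [scaleMeasure, Measure.smul_apply, smul_eq_mul]
  exact measurable_fst.ennreal_ofReal.mul ((Measure.measurable_coe hs).comp measurable_snd)

lemma scaleMeasure_real {p : ℝ × Measure Y} (hp : 0 ≤ p.1) (A : Set Y) :
    (scaleMeasure p).real A = p.1 * p.2.real A := by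
  rw [scaleMeasure, measureReal_ennreal_smul_apply, ENNReal.toReal_ofReal hp]

lemma integral_scaleMeasure {p : ℝ × Measure Y} (hp : 0 ≤ p.1) (g : Y → ℝ) :
    ∫ y, g y ∂scaleMeasure p = p.1 * ∫ y, g y ∂p.2 := by
  rw [scaleMeasure, integral_smul_measure, ENNReal.toReal_ofReal hp, smul_eq_mul]

/-- The gamma process is the product of a gamma variable and an independent Dirichlet process. -/
theorem IsGammaProcess.eq_map_dirichlet [IsFiniteMeasure β] (hΓ : IsGammaProcess β Γ)
    (hD : IsDirichletProcess β D) (h0 : 0 < β.real univ) :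
    Γ = ((ProbabilityTheory.gammaMeasure (β.real univ) 1).prod D).map scaleMeasure := by
  have := hΓ.isProbabilityMeasure
  have := hD.isProbabilityMeasure
  have hγ := ProbabilityTheory.isProbabilityMeasure_gammaMeasure h0 one_pos
  set γ := ProbabilityTheory.gammaMeasure (β.real univ) 1 with hγdef
  have hfst : ∀ᵐ p ∂γ.prod D, 0 < p.1 :=
    Measure.quasiMeasurePreserving_fst.ae (gammaMeasure_ae_pos _)
  have hsnd : ∀ᵐ p ∂γ.prod D, IsProbabilityMeasure p.2 :=
    Measure.quasiMeasurePreserving_snd.ae hD.ae_isProbabilityMeasure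
  have hfinite : ∀ᵐ μ ∂(γ.prod D).map scaleMeasure, IsFiniteMeasure μ := by
    have hS : MeasurableSet {μ : Measure Y | μ univ < ∞} :=
      measurableSet_lt (Measure.measurable_coe MeasurableSet.univ) measurable_const
    have h1 : ∀ᵐ μ ∂(γ.prod D).map scaleMeasure, μ univ < ∞ := by
      rw [ae_map_iff measurable_scaleMeasure.aemeasurable hS]
      filter_upwards [hsnd] with p hp
      simp only [scaleMeasure, Measure.smul_apply, smul_eq_mul]
      exact ENNReal.mul_lt_top ENNReal.ofReal_lt_top (measure_lt_top _ _)
    exact h1.mono fun μ hμ => ⟨hμ⟩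
  have := Measure.isProbabilityMeasure_map (μ := γ.prod D) measurable_scaleMeasure.aemeasurable
  refine ext_of_laplace_simpleFunc hΓ.ae_isFiniteMeasure hfinite fun f hf => ?_
  classical
  -- The fibres of f form a finite partition. On it both laws give independent gamma masses, and the
  -- integral of f is a linear function of these masses.
  let e : Fin f.range.card ≃ f.range := f.range.equivFin.symm
  let A : Fin f.range.card → Set Y := fun i => f ⁻¹' {(e i).1}
  have hA : ∀ i, MeasurableSet (A i) := fun i => f.measurableSet_fiber _
  have hd : Pairwise fun i j => Disjoint (A i) (A j) := fun i j hij =>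
    Disjoint.preimage _ (by
      rw [disjoint_singleton]
      exact fun h => hij (e.injective (Subtype.ext h)))
  have hU : ⋃ i, A i = univ := by
    refine eq_univ_of_forall fun y => mem_iUnion.2 ⟨e.symm ⟨f y, f.mem_range_self y⟩, ?_⟩
    simp [A]
  have hsum : ∑ i, β.real (A i) = β.real univ := by
    rw [← hU, measureReal_iUnion_fintype hd hA]
  have hfμ : ∀ μ : Measure Y, IsFiniteMeasure μ → ∫ y, f y ∂μ = ∑ i, (e i).1 * μ.real (A i) := by
    intro μ hμ
    rw [← SimpleFunc.integral_eq_integral f (SimpleFunc.integrable_of_isFiniteMeasure f),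
      SimpleFunc.integral_eq, ← Finset.sum_coe_sort, ← e.sum_comp]
    exact Finset.sum_congr rfl fun i _ => by rw [smul_eq_mul, mul_comm]
  have hX : Measurable fun (μ : Measure Y) i => μ.real (A i) :=
    measurable_pi_lambda _ fun i => measurable_measureReal (hA i)
  let F : (Fin f.range.card → ℝ) → ℝ := fun x => Real.exp (-∑ i, (e i).1 * x i)
  have hF : Measurable F := by fun_prop
  have hmapΓ : Γ.map (fun μ i => μ.real (A i)) = Measure.pi fun i => gammaDist (β.real (A i)) :=
    hΓ.map_eq hA hd
  have hmapD : ((γ.prod D).map scaleMeasure).map (fun μ i => μ.real (A i)) =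
      Measure.pi fun i => gammaDist (β.real (A i)) := by
    rw [← map_mul_gamma_dirichlet (fun i => measureReal_nonneg) (by rwa [hsum]),
      ← hD.map_eq _ A hA hd hU, hsum, ← hγdef, Measure.map_map hX measurable_scaleMeasure]
    have h1 : γ.prod (D.map fun P i => P.real (A i)) =
        (γ.prod D).map (Prod.map id fun P i => P.real (A i)) := by
      have := Measure.map_prod_map γ D measurable_id hX
      rwa [Measure.map_id] at this
    rw [h1, Measure.map_map (by fun_prop) (measurable_id.prodMap hX)]
    refine Measure.map_congr ?_
    filter_upwards [hfst] with p hp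
    funext i
    exact scaleMeasure_real hp.le _
  have key : ∀ L : Measure (Measure Y), (∀ᵐ μ ∂L, IsFiniteMeasure μ) →
      ∫ μ, Real.exp (-∫ y, f y ∂μ) ∂L = ∫ x, F x ∂L.map (fun μ i => μ.real (A i)) := by
    intro L hL
    rw [integral_map hX.aemeasurable hF.aestronglyMeasurable]
    exact integral_congr_ae (hL.mono fun μ hμ => by simp only [F, hfμ μ hμ])
  rw [key _ hΓ.ae_isFiniteMeasure, key _ hfinite, hmapΓ, hmapD]

/-- By Fubini, some single t > 0 makes g integrable for tP for almost every P, and scaling by t does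
not affect integrability. -/
lemma IsDirichletProcess.ae_integrable [IsFiniteMeasure β] (hD : IsDirichletProcess β D)
    (hΓ : IsGammaProcess β Γ) (h0 : 0 < β.real univ) {g : Y → ℝ} (hg : Measurable g)
    (hlog : Integrable (fun y => Real.log (1 + |g y|)) β) : ∀ᵐ P ∂D, Integrable g P := by
  have := hD.isProbabilityMeasure
  have hγ := ProbabilityTheory.isProbabilityMeasure_gammaMeasure h0 one_pos
  have h1 := hΓ.ae_integrable hg hlog
  rw [hΓ.eq_map_dirichlet hD h0] at h1
  have h2 := Measure.ae_ae_of_ae_prod (ae_of_ae_map measurable_scaleMeasure.aemeasurable h1)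
  obtain ⟨t, ht, ht0⟩ := (h2.and (gammaMeasure_ae_pos _)).exists
  filter_upwards [ht] with P hP
  have : ENNReal.ofReal t ≠ 0 := by simpa using ht0
  exact (integrable_smul_measure this ENNReal.ofReal_ne_top).1 hP

lemma map_withDensity_comp {A B : Type*} [MeasurableSpace A] [MeasurableSpace B] {ν : Measure A}
    {f : A → B} (hf : Measurable f) {h : B → ℝ≥0∞} (hh : Measurable h) :
    (ν.map f).withDensity h = (ν.withDensity (h ∘ f)).map f := by
  ext s hs
  rw [withDensity_apply _ hs, Measure.map_apply hf hs, withDensity_apply _ (hf hs),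
    setLIntegral_map hs hh hf]
  rfl

/-- The Beta-Gamma process is the product of a gamma variable and an independent Dirichlet
process. -/
theorem betaGammaLaw_eq_map_dirichlet [IsFiniteMeasure β] (hΓ : IsGammaProcess β Γ)
    (hD : IsDirichletProcess β D) (h0 : 0 < β.real univ) {q : ℝ} (hq : 0 < q) :
    betaGammaLaw β Γ (β.real univ - q) =
      ((ProbabilityTheory.gammaMeasure q 1).prod D).map scaleMeasure := by
  have := hD.isProbabilityMeasure
  have hγ := ProbabilityTheory.isProbabilityMeasure_gammaMeasure h0 one_pos
  conv_lhs => rw [betaGammaLaw, hΓ.eq_map_dirichlet hD h0]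
  -- As P has mass 1, the total mass of tP is t; the density is a function of t alone and changes
  -- the gamma factor from shape θ to shape q.
  rw [map_withDensity_comp measurable_scaleMeasure (measurable_betaGammaDensity _ _),
    ← gammaMeasure_withDensity_rpow h0 hq, prod_withDensity_left (by fun_prop)]
  congr 1
  refine withDensity_congr_ae ?_
  have hfst : ∀ᵐ p ∂(ProbabilityTheory.gammaMeasure (β.real univ) 1).prod D, 0 < p.1 :=
    Measure.quasiMeasurePreserving_fst.ae (gammaMeasure_ae_pos _)
  have hsnd : ∀ᵐ p ∂(ProbabilityTheory.gammaMeasure (β.real univ) 1).prod D,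
      IsProbabilityMeasure p.2 :=
    Measure.quasiMeasurePreserving_snd.ae hD.ae_isProbabilityMeasure
  filter_upwards [hfst, hsnd] with p hp hP
  simp only [Function.comp]
  rw [scaleMeasure_real hp.le, probReal_univ (μ := p.2), mul_one, sub_sub_cancel]

/-- The Markov–Krein identity. -/
theorem markov_krein [IsFiniteMeasure β] (hΓ : IsGammaProcess β Γ) (hD : IsDirichletProcess β D)
    (h0 : 0 < β.real univ) {q : ℝ} (hq : 0 < q) {g : Y → ℝ} (hg : Measurable g) {z : ℂ}
    (hz : LaplaceConverges (betaGammaLaw β Γ (β.real univ - q)) z g) :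
    Integrable (fun P : Measure Y => (1 + z * ((∫ y, g y ∂P : ℝ) : ℂ)) ^ (-(q : ℂ))) D ∧
    ∫ P, (1 + z * ((∫ y, g y ∂P : ℝ) : ℂ)) ^ (-(q : ℂ)) ∂D =
      laplaceFunctional (betaGammaLaw β Γ (β.real univ - q)) z g := by
  have := hD.isProbabilityMeasure
  have hγ := ProbabilityTheory.isProbabilityMeasure_gammaMeasure hq one_pos
  have hem := measurable_exp_integral hg z
  have hfst : ∀ᵐ p ∂(ProbabilityTheory.gammaMeasure q 1).prod D, 0 < p.1 :=
    Measure.quasiMeasurePreserving_fst.ae (gammaMeasure_ae_pos _)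
  have hcongr : ∀ᵐ p ∂(ProbabilityTheory.gammaMeasure q 1).prod D,
      Complex.exp (-z * ((∫ y, g y ∂scaleMeasure p : ℝ) : ℂ)) =
      Complex.exp (-(z * ((∫ y, g y ∂p.2 : ℝ) : ℂ)) * p.1) := by
    filter_upwards [hfst] with p hp
    rw [integral_scaleMeasure hp.le]
    push_cast
    ring_nf
  rw [LaplaceConverges, betaGammaLaw_eq_map_dirichlet hΓ hD h0 hq,
    integrable_map_measure hem.aestronglyMeasurable measurable_scaleMeasure.aemeasurable] at hz
  have hI : Integrable (fun p : ℝ × Measure Y =>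
      Complex.exp (-(z * ((∫ y, g y ∂p.2 : ℝ) : ℂ)) * p.1))
      ((ProbabilityTheory.gammaMeasure q 1).prod D) := hz.congr hcongr
  -- For almost every P, Fubini gives integrability in t, which forces Re(zP(g)) > -1; the closed
  -- form of the gamma transform then applies without a sign condition on g.
  have hP : ∀ᵐ P ∂D, ∫ t : ℝ, Complex.exp (-(z * ((∫ y, g y ∂P : ℝ) : ℂ)) * t)
      ∂ProbabilityTheory.gammaMeasure q 1 =
      (1 + z * ((∫ y, g y ∂P : ℝ) : ℂ)) ^ (-(q : ℂ)) := by
    filter_upwards [hI.prod_left_ae] with P hP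
    exact integral_exp_gammaMeasure hq (neg_one_lt_re_of_integrable_exp hq hP)
  refine ⟨hI.integral_prod_right.congr hP, ?_⟩
  rw [laplaceFunctional, betaGammaLaw_eq_map_dirichlet hΓ hD h0 hq,
    integral_map measurable_scaleMeasure.aemeasurable hem.aestronglyMeasurable,
    integral_congr_ae hcongr, integral_prod_symm _ hI]
  exact (integral_congr_ae hP).symm

lemma laplaceConverges_of_nonneg [IsFiniteMeasure β] (hΓ : IsGammaProcess β Γ)
    (h0 : 0 < β.real univ) {q : ℝ} (hq : 0 < q) {g : Y → ℝ} (hg : Measurable g) {z : ℂ}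
    (hz : ∀ᵐ y ∂β, 0 ≤ z.re * g y) :
    LaplaceConverges (betaGammaLaw β Γ (β.real univ - q)) z g := by
  have := isProbabilityMeasure_betaGammaLaw hΓ h0 hq
  refine (integrable_const (1 : ℝ)).mono' (measurable_exp_integral hg z).aestronglyMeasurable ?_
  refine (withDensity_absolutelyContinuous _ _).ae_le ?_
  filter_upwards [hΓ.ae_ae_of_ae hz] with μ hμ
  rw [Complex.norm_exp, Real.exp_le_one_iff]
  simp only [Complex.mul_re, Complex.neg_re, Complex.ofReal_re, Complex.ofReal_im, mul_zero,
    sub_zero, neg_mul, Left.neg_nonpos_iff]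
  rw [← integral_const_mul]
  exact integral_nonneg_of_ae hμ

end Disintegration

/-! ### Adding exponential atoms; differentiating the Laplace functional -/

section Posterior

variable {Y : Type*} [MeasurableSpace Y] {β : Measure Y} {Γ : Measure (Measure Y)} {n : ℕ}

instance isFiniteMeasure_postShape [IsFiniteMeasure β] (y : Fin n → Y) :
    IsFiniteMeasure (postShape β y) := by
  unfold postShape; infer_instance

lemma postShape_real_univ [IsFiniteMeasure β] (y : Fin n → Y) :
    (postShape β y).real univ = β.real univ + n := by
  rw [postShape, measureReal_add_apply, measureReal_def (∑ i, Measure.dirac (y i)),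
    Measure.coe_finsetSum, Finset.sum_apply]
  simp

lemma integrable_postShape {E : Type*} [NormedAddCommGroup E] {h : Y → E}
    (hm : StronglyMeasurable h) (y : Fin n → Y) : Integrable h (postShape β y) ↔ Integrable h β := by
  rw [postShape, integrable_add_measure, integrable_finsetSum_measure]
  exact ⟨fun h => h.1, fun hi => ⟨hi, fun i _ => integrable_dirac' hm (by simp)⟩⟩

lemma integral_postShape {E : Type*} [NormedAddCommGroup E] [NormedSpace ℝ E] [CompleteSpace E]
    {h : Y → E} (hm : StronglyMeasurable h) (hi : Integrable h β) (y : Fin n → Y) :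
    ∫ x, h x ∂postShape β y = ∫ x, h x ∂β + ∑ i, h (y i) := by
  have hd : ∀ i ∈ Finset.univ, Integrable h (Measure.dirac (y i)) := fun i _ =>
    integrable_dirac' hm (by simp)
  rw [postShape, integral_add_measure hi (integrable_finsetSum_measure.2 hd),
    integral_finsetSum_measure hd]
  simp_rw [integral_dirac' h _ hm]

/-- Adding atoms at `y i` with masses `p.2 i`. -/
noncomputable def addAtoms (y : Fin n → Y) (p : Measure Y × (Fin n → ℝ)) : Measure Y :=
  p.1 + ∑ i, ENNReal.ofReal (p.2 i) • Measure.dirac (y i)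

lemma addAtoms_apply (y : Fin n → Y) (p : Measure Y × (Fin n → ℝ)) {s : Set Y}
    (hs : MeasurableSet s) : addAtoms y p s =
      p.1 s + ∑ i, ENNReal.ofReal (p.2 i) * s.indicator (fun _ => 1) (y i) := by
  rw [addAtoms, Measure.add_apply, Measure.coe_finsetSum, Finset.sum_apply]
  simp only [Measure.smul_apply, smul_eq_mul, Measure.dirac_apply' _ hs]
  rfl

lemma measurable_addAtoms_prod : Measurable
    fun q : (Fin n → Y) × (Measure Y × (Fin n → ℝ)) => addAtoms q.1 q.2 := by
  refine Measure.measurable_of_measurable_coe _ fun s hs => ?_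
  simp_rw [addAtoms_apply _ _ hs]
  refine ((Measure.measurable_coe hs).comp (measurable_fst.comp measurable_snd)).add
    (Finset.measurable_fun_sum _ fun i _ => ?_)
  refine Measurable.mul ?_ ?_
  · exact ((measurable_pi_apply i).comp (measurable_snd.comp measurable_snd)).ennreal_ofReal
  · exact (measurable_const.indicator hs).comp ((measurable_pi_apply i).comp measurable_fst)

/-- The law of a gamma process with additional independent exponential atoms at `y i`. -/
noncomputable def gammaPosterior (Γ : Measure (Measure Y)) (y : Fin n → Y) :
    Measure (Measure Y) :=
  (Γ.prod (Measure.pi fun _ : Fin n => ProbabilityTheory.gammaMeasure 1 1)).map (addAtoms y)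

lemma measurable_addAtoms (y : Fin n → Y) : Measurable (addAtoms y) :=
  measurable_addAtoms_prod.comp measurable_prodMk_left

/-- The explicit construction makes the dependence on y measurable. Any other family of gamma
processes with these shapes coincides with it by uniqueness. -/
lemma measurable_gammaPosterior [SFinite Γ] :
    Measurable fun y : Fin n → Y => gammaPosterior Γ y := by
  have hγ := ProbabilityTheory.isProbabilityMeasure_gammaMeasure one_pos one_pos
  refine Measure.measurable_of_measurable_coe _ fun s hs => ?_
  simp_rw [gammaPosterior, Measure.map_apply (measurable_addAtoms _) hs]
  exact measurable_measure_prodMk_left (measurable_addAtoms_prod hs)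

/-- An independent exponential mass at y multiplies the Laplace functional by 1/(1 + g(y)), which is
what a unit atom δ_y in the shape contributes; the exponential law is the gamma law of shape 1. -/
lemma isGammaProcess_gammaPosterior [IsFiniteMeasure β] (hΓ : IsGammaProcess β Γ) (y : Fin n → Y) :
    IsGammaProcess (postShape β y) (gammaPosterior Γ y) := by
  have hp := hΓ.isProbabilityMeasure
  have hγ := ProbabilityTheory.isProbabilityMeasure_gammaMeasure one_pos one_pos
  set π := Measure.pi fun _ : Fin n => ProbabilityTheory.gammaMeasure 1 1
  have hfst : ∀ᵐ p ∂Γ.prod π, IsFiniteMeasure p.1 :=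
    Measure.quasiMeasurePreserving_fst.ae hΓ.ae_isFiniteMeasure
  have hpi : ∀ᵐ e ∂π, ∀ i, 0 < e i := ae_all_iff.2 fun i =>
    (measurePreserving_eval _ i).quasiMeasurePreserving.ae (gammaMeasure_ae_pos _)
  have hsnd : ∀ᵐ p ∂Γ.prod π, ∀ i, 0 < p.2 i := Measure.quasiMeasurePreserving_snd.ae hpi
  refine ⟨Measure.isProbabilityMeasure_map (measurable_addAtoms y).aemeasurable, ?_, ?_⟩
  · have hS : MeasurableSet {μ : Measure Y | μ univ < ∞} :=
      measurableSet_lt (Measure.measurable_coe MeasurableSet.univ) measurable_const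
    have h1 : ∀ᵐ μ ∂gammaPosterior Γ y, μ univ < ∞ := by
      refine (ae_map_iff (measurable_addAtoms y).aemeasurable hS).2 ?_
      filter_upwards [hfst] with p hp
      rw [addAtoms_apply y p MeasurableSet.univ]
      refine ENNReal.add_lt_top.2 ⟨measure_lt_top _ _, ENNReal.sum_lt_top.2 fun i _ => ?_⟩
      simp
    exact h1.mono fun μ hμ => ⟨hμ⟩
  · intro g hg h0 ⟨C, hC⟩
    have hgs := hg.stronglyMeasurable
    have hls : StronglyMeasurable fun y => Real.log (1 + g y) :=
      (Measurable.log (by fun_prop)).stronglyMeasurable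
    have hli : Integrable (fun y => Real.log (1 + g y)) β := by
      refine (integrable_const (Real.log (1 + C))).mono' hls.aestronglyMeasurable
        (ae_of_all _ fun y => ?_)
      rw [Real.norm_of_nonneg (Real.log_nonneg (by linarith [h0 y]))]
      exact Real.log_le_log (by linarith [h0 y]) (by linarith [hC y])
    have hgm : Measurable fun μ : Measure Y => Real.exp (-∫ x, g x ∂μ) :=
      (measurable_integral_measure hg).neg.exp
    rw [gammaPosterior, integral_map (measurable_addAtoms y).aemeasurable hgm.aestronglyMeasurable,
      integral_postShape hls hli]
    have h1 : ∀ᵐ p ∂Γ.prod π, Real.exp (-∫ x, g x ∂addAtoms y p) =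
        Real.exp (-∫ x, g x ∂p.1) * ∏ i, Real.exp (-(g (y i) * p.2 i)) := by
      filter_upwards [hfst, hsnd] with p hp he
      have hgi : Integrable g p.1 := (integrable_const C).mono' hg.aestronglyMeasurable
        (ae_of_all _ fun y => by rw [Real.norm_of_nonneg (h0 y)]; exact hC y)
      have hd : ∀ i ∈ Finset.univ, Integrable g (ENNReal.ofReal (p.2 i) • Measure.dirac (y i)) :=
        fun i _ => (integrable_dirac' hgs (by simp)).smul_measure ENNReal.ofReal_ne_top
      rw [addAtoms, integral_add_measure hgi (integrable_finsetSum_measure.2 hd),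
        integral_finsetSum_measure hd, neg_add, Real.exp_add, ← Finset.sum_neg_distrib,
        Real.exp_sum]
      congr 1
      refine Finset.prod_congr rfl fun i _ => ?_
      rw [integral_smul_measure, integral_dirac' g _ hgs, ENNReal.toReal_ofReal (he i).le,
        smul_eq_mul, mul_comm]
    rw [integral_congr_ae h1, integral_prod_mul (fun μ : Measure Y => Real.exp (-∫ x, g x ∂μ))
      (fun e : Fin n → ℝ => ∏ i, Real.exp (-(g (y i) * e i))), hΓ.laplace_eq g hg h0 ⟨C, hC⟩,
      integral_fintype_prod_eq_prod (𝕜 := ℝ) (f := fun i e => Real.exp (-(g (y i) * e))), neg_add,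
      Real.exp_add, ← Finset.sum_neg_distrib, Real.exp_sum]
    congr 1
    refine Finset.prod_congr rfl fun i _ => ?_
    have := integral_exp_gammaDist_real zero_le_one (c := g (y i)) (by linarith [h0 (y i)])
    rwa [gammaDist, if_neg one_ne_zero, one_mul] at this

/-- The derivative of the Laplace functional in the direction of the total mass. -/
lemma IsGammaProcess.integral_mass_mul_exp [IsFiniteMeasure β] (hΓ : IsGammaProcess β Γ)
    (f : SimpleFunc Y ℝ) (hf : ∀ y, 0 ≤ f y) :
    Integrable (fun μ : Measure Y => μ.real univ * Real.exp (-∫ y, f y ∂μ)) Γ ∧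
    ∫ μ : Measure Y, μ.real univ * Real.exp (-∫ y, f y ∂μ) ∂Γ =
      Real.exp (-∫ y, Real.log (1 + f y) ∂β) * ∫ y, (1 + f y)⁻¹ ∂β := by
  have hp := hΓ.isProbabilityMeasure
  have hT := measurable_measureReal (Y := Y) MeasurableSet.univ
  have hfm := measurable_integral_measure f.measurable
  have hf0 : ∀ μ : Measure Y, 0 ≤ ∫ y, f y ∂μ := fun μ => integral_nonneg hf
  -- For |ε| < 1/4 the ε-derivative below is at most T exp(T/4) ≤ 4 exp(T/2), and exp(T/2) has
  -- finite expectation because 1/2 < 1.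
  have hhalf : Integrable (fun μ : Measure Y => Real.exp (1 / 2 * μ.real univ)) Γ := by
    refine ((hΓ.laplace_neg_simpleFunc (SimpleFunc.const Y (1 / 2 : ℝ))
      (ae_of_all _ fun y => by simp; norm_num)).1).congr (ae_of_all _ fun μ => ?_)
    simp [mul_comm]
  let F : ℝ → Measure Y → ℝ := fun ε μ => Real.exp (-(∫ y, f y ∂μ + ε * μ.real univ))
  have hFm : ∀ ε, Measurable (F ε) := fun ε => (hfm.add (hT.const_mul ε)).neg.exp
  have hball : ∀ ε ∈ Metric.ball (0 : ℝ) (1 / 4), -(1 / 4) < ε ∧ ε < 1 / 4 := by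
    intro ε hε
    rw [Metric.mem_ball, dist_zero_right, Real.norm_eq_abs, abs_lt] at hε
    exact hε
  have hL := hasDerivAt_integral_of_dominated_loc_of_deriv_le (μ := Γ) (F := F) (x₀ := 0)
    (F' := fun ε μ => F ε μ * (-μ.real univ)) (s := Metric.ball 0 (1 / 4))
    (bound := fun μ => 4 * Real.exp (1 / 2 * μ.real univ)) (Metric.ball_mem_nhds 0 (by norm_num))
    (Eventually.of_forall fun ε => (hFm ε).aestronglyMeasurable)
    ((integrable_const (1 : ℝ)).mono' (hFm 0).aestronglyMeasurable (ae_of_all _ fun μ => by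
      rw [Real.norm_of_nonneg (Real.exp_pos _).le, Real.exp_le_one_iff]
      linarith [hf0 μ]))
    ((hFm 0).mul hT.neg).aestronglyMeasurable
    (ae_of_all _ fun μ ε hε => by
      have h1 := hball ε hε
      have hT0 : 0 ≤ μ.real univ := measureReal_nonneg
      rw [norm_mul, Real.norm_of_nonneg (Real.exp_pos _).le, norm_neg, Real.norm_of_nonneg hT0]
      have h2 : F ε μ ≤ Real.exp (1 / 4 * μ.real univ) := Real.exp_le_exp.2 (by
        nlinarith [hf0 μ])
      have h3 : μ.real univ ≤ 4 * Real.exp (1 / 4 * μ.real univ) := by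
        linarith [Real.add_one_le_exp (1 / 4 * μ.real univ)]
      calc F ε μ * μ.real univ ≤ Real.exp (1 / 4 * μ.real univ) *
            (4 * Real.exp (1 / 4 * μ.real univ)) := by gcongr
        _ = 4 * Real.exp (1 / 2 * μ.real univ) := by
            rw [show 1 / 2 * μ.real univ = 1 / 4 * μ.real univ + 1 / 4 * μ.real univ by ring,
              Real.exp_add]
            ring)
    (hhalf.const_mul 4)
    (ae_of_all _ fun μ ε _ => by
      have h1 : HasDerivAt (fun ε : ℝ => -(∫ y, f y ∂μ + ε * μ.real univ)) (-μ.real univ) ε := by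
        have := (((hasDerivAt_id ε).mul_const (μ.real univ)).const_add (∫ y, f y ∂μ)).fun_neg
        simpa only [id, one_mul] using this
      exact h1.exp)
  let H : ℝ → Y → ℝ := fun ε y => Real.log (1 + f y + ε)
  have hHm : ∀ ε, Measurable (H ε) := fun ε =>
    Measurable.log ((f.measurable.const_add 1).add_const ε)
  have hH0 : Integrable (H 0) β :=
    SimpleFunc.integrable_of_isFiniteMeasure (f.map fun x => Real.log (1 + x + 0))
  have hR := hasDerivAt_integral_of_dominated_loc_of_deriv_le (μ := β) (F := H) (x₀ := 0)
    (F' := fun ε y => (1 + f y + ε)⁻¹) (s := Metric.ball 0 (1 / 4))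
    (bound := fun y => 2) (Metric.ball_mem_nhds 0 (by norm_num))
    (Eventually.of_forall fun ε => (hHm ε).aestronglyMeasurable) hH0
    ((f.measurable.const_add 1).add_const 0).inv.aestronglyMeasurable
    (ae_of_all _ fun y ε hε => by
      have h1 := hball ε hε
      have h2 : 1 / 2 ≤ 1 + f y + ε := by linarith [hf y]
      rw [Real.norm_of_nonneg (inv_nonneg.2 (by linarith))]
      calc (1 + f y + ε)⁻¹ ≤ (1 / 2)⁻¹ := inv_anti₀ (by norm_num) h2
        _ = 2 := by norm_num)
    (integrable_const _)
    (ae_of_all _ fun y ε hε => by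
      have h1 := hball ε hε
      have := ((hasDerivAt_id ε).const_add (1 + f y)).log (by simp only [id]; linarith [hf y])
      simpa [one_div] using this)
  -- `laplace_neg_simpleFunc` is used at -(f + ε), which is below 1 even for negative ε, whereas
  -- `laplace_eq` would need f + ε ≥ 0. Differentiating the two sides at 0 gives the formula.
  have heq : (fun ε => ∫ μ, F ε μ ∂Γ) =ᶠ[𝓝 0] fun ε => Real.exp (-∫ y, H ε y ∂β) := by
    filter_upwards [Metric.ball_mem_nhds (0 : ℝ) (by norm_num : (0 : ℝ) < 1 / 4)] with ε hε
    have h1 := hball ε hε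
    have h2 := (hΓ.laplace_neg_simpleFunc (f.map fun x => -(x + ε))
      (ae_of_all _ fun y => by simp only [SimpleFunc.map_apply]; linarith [hf y])).2
    have h3 : ∀ᵐ μ ∂Γ, Real.exp (∫ y, (f.map fun x => -(x + ε)) y ∂μ) = F ε μ := by
      filter_upwards [hΓ.ae_isFiniteMeasure] with μ hμ
      simp only [F, SimpleFunc.map_apply]
      rw [integral_neg, integral_add (SimpleFunc.integrable_of_isFiniteMeasure f)
        (integrable_const _), integral_const, smul_eq_mul, mul_comm ε]
    rw [← integral_congr_ae h3, h2]
    congr 2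
    refine integral_congr_ae (ae_of_all _ fun y => ?_)
    simp only [H, SimpleFunc.map_apply]
    ring_nf
  have hd := (hL.2.congr_of_eventuallyEq heq.symm).unique hR.2.fun_neg.exp
  have hF0 : ∀ μ : Measure Y, F 0 μ * -μ.real univ =
      -(μ.real univ * Real.exp (-∫ y, f y ∂μ)) := fun μ => by
    simp only [F]; ring_nf
  have hi := hL.1
  simp_rw [hF0] at hd hi
  refine ⟨by simpa using hi.neg, ?_⟩
  rw [integral_neg] at hd
  simp only [H, add_zero] at hd
  linarith

end Posterior

/-! ### Fubini for mixtures -/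

section Bind

variable {A B E : Type*} [MeasurableSpace A] [MeasurableSpace B] [NormedAddCommGroup E]
  [NormedSpace ℝ E] {m : Measure A} {κ : A → Measure B} {f : B → E}

/-- A mixture is the composition of a kernel with a constant kernel, so the Fubini theorem for
composed kernels applies. -/
lemma integrable_bind (hκ : Measurable κ) (hf : Integrable f (m.bind κ)) :
    (∀ᵐ a ∂m, Integrable f (κ a)) ∧ Integrable (fun a => ∫ b, f b ∂κ a) m ∧
    ∫ b, f b ∂m.bind κ = ∫ a, ∫ b, f b ∂κ a ∂m := by
  let k : ProbabilityTheory.Kernel A B := ⟨κ, hκ⟩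
  have h0 : m.bind κ = (k.comp (ProbabilityTheory.Kernel.const Unit m)) () :=
    Measure.comp_eq_comp_const_apply (κ := k)
  rw [h0] at hf ⊢
  have h1 := hf.ae_of_comp
  have h2 := hf.integral_comp
  have h3 := ProbabilityTheory.Kernel.integral_comp hf
  rw [ProbabilityTheory.Kernel.const_apply] at h1 h2 h3
  exact ⟨h1, h2, h3⟩

end Bind

/-! ### The Palm formula and the urn mixture -/

section Palm

variable {Y : Type*} [MeasurableSpace Y] {β : Measure Y} {Γ : Measure (Measure Y)} {n : ℕ}

lemma lintegral_mass_ne_top [IsFiniteMeasure β] (hΓ : IsGammaProcess β Γ) :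
    ∫⁻ μ, μ univ ∂Γ ≠ ∞ := by
  have h := (hΓ.integral_mass_mul_exp 0 fun y => le_rfl).1
  have h1 : Integrable (fun μ : Measure Y => μ.real univ) Γ := by simpa using h
  have h2 : ∫⁻ μ, μ univ ∂Γ = ∫⁻ μ, ‖μ.real univ‖ₑ ∂Γ := by
    refine lintegral_congr_ae ?_
    filter_upwards [hΓ.ae_isFiniteMeasure] with μ hμ
    rw [Real.enorm_of_nonneg measureReal_nonneg, ofReal_measureReal]
  rw [h2]
  exact h1.2.ne

/-- The Palm formula: the mass-biased gamma process is a mixture of gamma processes with one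
additional exponential atom. -/
theorem IsGammaProcess.withDensity_mass [IsFiniteMeasure β] (hΓ : IsGammaProcess β Γ) :
    Γ.withDensity (fun μ => μ univ) =
      β.bind fun x => gammaPosterior Γ (fun _ : Fin 1 => x) := by
  have hp := hΓ.isProbabilityMeasure
  have hT : Measurable fun μ : Measure Y => μ univ := Measure.measurable_coe MeasurableSet.univ
  have hκ : Measurable fun x : Y => gammaPosterior Γ (fun _ : Fin 1 => x) :=
    measurable_gammaPosterior.comp (measurable_pi_lambda _ fun _ => measurable_id)
  have hG := fun x : Y => isGammaProcess_gammaPosterior hΓ (fun _ : Fin 1 => x)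
  have hfin1 : IsFiniteMeasure (Γ.withDensity fun μ => μ univ) :=
    isFiniteMeasure_withDensity (lintegral_mass_ne_top hΓ)
  have hfin2 : IsFiniteMeasure (β.bind fun x => gammaPosterior Γ (fun _ : Fin 1 => x)) := by
    constructor
    rw [Measure.bind_apply MeasurableSet.univ hκ.aemeasurable]
    simp [fun x => (hG x).isProbabilityMeasure.measure_univ]
  have hS : MeasurableSet {μ : Measure Y | μ univ < ∞} := measurableSet_lt hT measurable_const
  refine ext_of_laplace_simpleFunc
    ((withDensity_absolutelyContinuous _ _).ae_le hΓ.ae_isFiniteMeasure) ?_ fun f hf => ?_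
  · have h1 : (β.bind fun x => gammaPosterior Γ (fun _ : Fin 1 => x)) {μ : Measure Y | μ univ < ∞}ᶜ
        = 0 := by
      rw [Measure.bind_apply hS.compl hκ.aemeasurable, 
        lintegral_eq_zero_iff (f := fun x => gammaPosterior Γ (fun _ : Fin 1 => x) _)
          ((Measure.measurable_coe hS.compl).comp hκ)]
      refine ae_of_all _ fun x => ?_
      exact measure_eq_zero_iff_ae_notMem.2 ((hG x).ae_isFiniteMeasure.mono fun μ hμ h =>
        h (measure_lt_top μ univ))
    filter_upwards [measure_eq_zero_iff_ae_notMem.1 h1] with μ hμ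
    exact ⟨not_not.1 hμ⟩
  · have hem : Measurable fun μ : Measure Y => Real.exp (-∫ y, f y ∂μ) :=
      (measurable_integral_measure f.measurable).neg.exp
    obtain ⟨C, hC⟩ := f.exists_forall_norm_le
    have hC' : ∃ C, ∀ y, f y ≤ C := ⟨C, fun y => (le_abs_self _).trans (hC y)⟩
    rw [integral_withDensity_eq_integral_toReal_smul₀ hT.aemeasurable
      (hΓ.ae_isFiniteMeasure.mono fun μ hμ => measure_lt_top μ univ)]
    simp only [smul_eq_mul, ← measureReal_def]
    -- The left side is the derivative of the Laplace functional. On the right the atom at x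
    -- contributes 1/(1 + f(x)), so both equal exp(-∫ log(1+f) dβ) ∫ (1+f)^(-1) dβ.
    rw [(hΓ.integral_mass_mul_exp f hf).2, (integrable_bind hκ ?_).2.2]
    · rw [← integral_const_mul]
      refine integral_congr_ae (ae_of_all _ fun x => ?_)
      have hlm : Measurable fun y => Real.log (1 + f y) :=
        Measurable.log (f.measurable.const_add 1)
      have h1 : (1 : ℝ) + f x ≠ 0 := by linarith [hf x]
      simp only
      rw [(hG x).laplace_eq f f.measurable hf hC', integral_postShape hlm.stronglyMeasurable
        (SimpleFunc.integrable_of_isFiniteMeasure (f.map fun t => Real.log (1 + t)))]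
      rw [Fin.sum_univ_one, neg_add, Real.exp_add, Real.exp_neg (Real.log _),
        Real.exp_log (by linarith [hf x])]
    · refine (integrable_const (1 : ℝ)).mono' hem.aestronglyMeasurable (ae_of_all _ fun μ => ?_)
      rw [Real.norm_of_nonneg (Real.exp_pos _).le, Real.exp_le_one_iff]
      have h0 : 0 ≤ ∫ y, f y ∂μ := integral_nonneg hf
      linarith

lemma measurable_snoc : Measurable fun p : (Fin n → Y) × Y =>
    (Fin.snoc p.1 p.2 : Fin (n + 1) → Y) := by
  refine measurable_pi_lambda _ fun i => ?_
  refine Fin.lastCases ?_ (fun j => ?_) i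
  · simpa using measurable_snd
  · simp only [Fin.snoc_castSucc]
    exact (measurable_pi_apply j).comp measurable_fst

lemma postShape_snoc (y : Fin n → Y) (x : Y) :
    postShape β (Fin.snoc y x : Fin (n + 1) → Y) =
      postShape (postShape β y) (fun _ : Fin 1 => x) := by
  simp only [postShape, Fin.sum_univ_castSucc, Fin.snoc_castSucc, Fin.snoc_last, add_assoc]
  simp

lemma measurable_urnStep [IsFiniteMeasure β] : Measurable fun y : Fin n → Y =>
    (postShape β y).map fun x => (Fin.snoc y x : Fin (n + 1) → Y) := by
  refine Measure.measurable_of_measurable_coe _ fun s hs => ?_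
  have hy : ∀ y : Fin n → Y, Measurable fun x => (Fin.snoc y x : Fin (n + 1) → Y) := fun y =>
    measurable_snoc.comp measurable_prodMk_left
  have h1 : ∀ y : Fin n → Y,
      ((postShape β y).map fun x => (Fin.snoc y x : Fin (n + 1) → Y)) s =
      β {x | (Fin.snoc y x : Fin (n + 1) → Y) ∈ s} +
        ∑ i, s.indicator (fun _ => 1) (Fin.snoc y (y i) : Fin (n + 1) → Y) := by
    intro y
    rw [Measure.map_apply (hy y) hs, postShape, Measure.add_apply, Measure.coe_finsetSum,
      Finset.sum_apply]
    congr 1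
    refine Finset.sum_congr rfl fun i _ => ?_
    rw [Measure.dirac_apply' _ (hy y hs)]
    rfl
  simp_rw [h1]
  refine Measurable.add (measurable_measure_prodMk_left (measurable_snoc hs))
    (Finset.measurable_fun_sum _ fun i _ => ?_)
  exact (measurable_const.indicator hs).comp
    (measurable_snoc.comp (measurable_id.prodMk (measurable_pi_apply i)))

/-- Both laws are gamma processes of the same shape, so uniqueness identifies them; this is what
lets the Palm formula be iterated. -/
lemma gammaPosterior_snoc [IsFiniteMeasure β] (hΓ : IsGammaProcess β Γ) (y : Fin n → Y) (x : Y) :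
    gammaPosterior (gammaPosterior Γ y) (fun _ : Fin 1 => x) =
      gammaPosterior Γ (Fin.snoc y x : Fin (n + 1) → Y) := by
  have h1 := isGammaProcess_gammaPosterior (isGammaProcess_gammaPosterior hΓ y)
    (fun _ : Fin 1 => x)
  rw [← postShape_snoc] at h1
  exact h1.unique (isGammaProcess_gammaPosterior hΓ _)

/-- The iterated Palm formula: the gamma process biased by the `n`-th power of the mass is a mixture
over the urn measure of gamma processes with `n` additional exponential atoms. -/
theorem IsGammaProcess.lintegral_mass_pow [IsFiniteMeasure β] (hΓ : IsGammaProcess β Γ) (n : ℕ)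
    {h : Measure Y → ℝ≥0∞} (hh : Measurable h) :
    ∫⁻ μ, (μ univ) ^ n * h μ ∂Γ =
      ∫⁻ y, ∫⁻ μ, h μ ∂gammaPosterior Γ y ∂urnMeasure β n := by
  have hp := hΓ.isProbabilityMeasure
  have hT : Measurable fun μ : Measure Y => μ univ := Measure.measurable_coe MeasurableSet.univ
  induction n generalizing h with
  | zero =>
    have h1 : gammaPosterior Γ (Fin.elim0 : Fin 0 → Y) = Γ := by
      refine (isGammaProcess_gammaPosterior hΓ _).unique ?_
      simpa [postShape] using hΓ
    have h2 : Measurable fun y : Fin 0 → Y => ∫⁻ μ, h μ ∂gammaPosterior Γ y :=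
      (Measure.measurable_lintegral hh).comp measurable_gammaPosterior
    rw [urnMeasure, lintegral_dirac' _ h2, h1]
    simp
  | succ n ih =>
    -- One factor T is absorbed into h. The induction hypothesis handles T^n, and the Palm formula
    -- for the posterior given y then draws the next point from its shape, which is the urn step.
    have h1 : ∀ μ : Measure Y, (μ univ) ^ (n + 1) * h μ = (μ univ) ^ n * (μ univ * h μ) :=
      fun μ => by rw [pow_succ, mul_assoc]
    simp_rw [h1]
    have hinner : Measurable fun y : Fin (n + 1) → Y => ∫⁻ μ, h μ ∂gammaPosterior Γ y :=
      (Measure.measurable_lintegral hh).comp measurable_gammaPosterior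
    have hm : Measurable fun μ : Measure Y => μ univ * h μ := hT.mul hh
    rw [ih hm, urnMeasure, Measure.lintegral_bind measurable_urnStep.aemeasurable
      hinner.aemeasurable]
    refine lintegral_congr fun y => ?_
    have hy : Measurable fun x => (Fin.snoc y x : Fin (n + 1) → Y) :=
      measurable_snoc.comp measurable_prodMk_left
    have hG := isGammaProcess_gammaPosterior hΓ y
    have hGp := hG.isProbabilityMeasure
    have hκ : Measurable fun x : Y =>
        gammaPosterior (gammaPosterior Γ y) (fun _ : Fin 1 => x) :=
      measurable_gammaPosterior.comp (measurable_pi_lambda _ fun _ => measurable_id)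
    rw [lintegral_map hinner hy]
    have h2 := lintegral_withDensity_eq_lintegral_mul (gammaPosterior Γ y) hT hh
    rw [hG.withDensity_mass, Measure.lintegral_bind hκ.aemeasurable hh.aemeasurable] at h2
    simp_rw [gammaPosterior_snoc hΓ] at h2
    exact h2.symm

/-- The Beta-Gamma process as a mixture of Beta-Gamma processes over the Blackwell–MacQueen
distribution. -/
theorem betaGammaLaw_eq_bind [IsFiniteMeasure β] (hΓ : IsGammaProcess β Γ) (h0 : 0 < β.real univ)
    {q : ℝ} (hq : 0 < q) (n : ℕ) {G : (Fin n → Y) → Measure (Measure Y)}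
    (hG : ∀ y, IsGammaProcess (postShape β y) (G y)) :
    Measurable (fun y => betaGammaLaw (postShape β y) (G y) (β.real univ + n - q)) ∧
    betaGammaLaw β Γ (β.real univ - q) = (blackwellMacQueen β n).bind
      fun y => betaGammaLaw (postShape β y) (G y) (β.real univ + n - q) := by
  have hp := hΓ.isProbabilityMeasure
  -- The given family carries no measurability assumption; uniqueness replaces it by the explicit
  -- measurable one.
  have hGeq : G = fun y => gammaPosterior Γ y :=
    funext fun y => (hG y).unique (isGammaProcess_gammaPosterior hΓ y)
  set θ := β.real univ with hθ
  have hd : Measurable fun μ : Measure Y => ENNReal.ofReal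
      (Real.Gamma (θ + n) / Real.Gamma q * μ.real univ ^ (-(θ + n - q))) :=
    measurable_betaGammaDensity _ _
  have hK : ∀ y, betaGammaLaw (postShape β y) (G y) (θ + n - q) =
      (gammaPosterior Γ y).withDensity fun μ => ENNReal.ofReal
      (Real.Gamma (θ + n) / Real.Gamma q * μ.real univ ^ (-(θ + n - q))) := by
    intro y
    rw [betaGammaLaw, postShape_real_univ, hGeq, ← hθ, sub_sub_cancel]
  simp_rw [hK]
  have hm : Measurable fun y : Fin n → Y => (gammaPosterior Γ y).withDensity fun μ =>
      ENNReal.ofReal (Real.Gamma (θ + n) / Real.Gamma q * μ.real univ ^ (-(θ + n - q))) := by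
    refine Measure.measurable_of_measurable_coe _ fun s hs => ?_
    simp_rw [withDensity_apply _ hs, ← lintegral_indicator hs]
    exact (Measure.measurable_lintegral (hd.indicator hs)).comp measurable_gammaPosterior
  refine ⟨hm, ?_⟩
  have hn : (0 : ℝ) ≤ n := Nat.cast_nonneg n
  have hΓθ := Real.Gamma_pos_of_pos h0
  have hΓq := Real.Gamma_pos_of_pos hq
  have hΓn := Real.Gamma_pos_of_pos (show 0 < θ + n by linarith)
  ext s hs
  rw [Measure.bind_apply hs hm.aemeasurable, blackwellMacQueen, lintegral_smul_measure]
  simp_rw [withDensity_apply _ hs, ← lintegral_indicator hs]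
  rw [← hΓ.lintegral_mass_pow n (hd.indicator hs), betaGammaLaw, withDensity_apply _ hs,
    ← lintegral_indicator hs, smul_eq_mul, ← lintegral_const_mul']
  swap
  · exact ENNReal.ofReal_ne_top
  refine lintegral_congr_ae ?_
  filter_upwards [hΓ.ae_isFiniteMeasure, hΓ.ae_pos h0] with μ hμ hpos
  by_cases hμs : μ ∈ s
  · rw [indicator_of_mem hμs, indicator_of_mem hμs, ← ofReal_measureReal (μ := μ) (s := univ),
      ← ENNReal.ofReal_pow measureReal_nonneg, ← ENNReal.ofReal_mul (by positivity),
      ← ENNReal.ofReal_mul (by positivity), ← hθ, sub_sub_cancel]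
    congr 1
    -- The power T^n is paid for by the iterated Palm formula; the constants match because Γ(θ)/Γ(q)
    -- is Γ(θ)/Γ(θ+n) times Γ(θ+n)/Γ(q).
    have : μ.real univ ^ (-(θ - q)) = μ.real univ ^ n * μ.real univ ^ (-(θ + n - q)) := by
      rw [← Real.rpow_natCast, ← Real.rpow_add hpos]
      congr 1
      ring
    rw [this]
    field_simp
  · rw [indicator_of_notMem hμs, indicator_of_notMem hμs, mul_zero, mul_zero]

end Palm

/-! ### Posterior Laplace functionals and joint integrability in the sample and u -/

section Mixture

variable {Y : Type*} [MeasurableSpace Y] {β : Measure Y} {Γ : Measure (Measure Y)} {n : ℕ}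
  {g : Y → ℝ}

lemma measurable_expLog [SFinite β] (hg : Measurable g) (z : ℂ) : Measurable (expLog β z g) := by
  have h : StronglyMeasurable fun p : ℝ × Y => Complex.log (1 + p.1 * z * g p.2) := by
    refine Measurable.stronglyMeasurable ?_
    fun_prop
  exact (h.integral_prod_right (ν := β)).measurable.neg.cexp

/-- Undoing the grouping by distinct values gives one factor per observation, a form visibly
measurable in the sample and suited to factorization over partitions. -/
lemma sampleIntegrand_eq (z : ℂ) (y : Fin n → Y) (u : ℝ) :
    sampleIntegrand β z g y u = expLog β z g u * ∏ i, (1 + u * z * g (y i) : ℂ)⁻¹ := by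
  classical
  rw [sampleIntegrand, Finset.prod_comp (fun v => (1 + u * z * g v : ℂ)⁻¹) y]
  congr 1
  refine Finset.prod_congr (by congr!) fun v _ => ?_
  rw [zpow_neg, zpow_natCast, inv_pow]

lemma dirac_le_postShape (y : Fin n → Y) (i : Fin n) : Measure.dirac (y i) ≤ postShape β y := by
  refine Measure.le_iff.2 fun s hs => ?_
  rw [postShape, Measure.add_apply, Measure.coe_finsetSum, Finset.sum_apply]
  exact (Finset.single_le_sum (f := fun i => Measure.dirac (y i) s) (fun _ _ => zero_le)
    (Finset.mem_univ i)).trans le_add_self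

lemma le_postShape (y : Fin n → Y) : β ≤ postShape β y := Measure.le_add_right le_rfl

/-- Each y i carries an atom of the shape, so an almost-everywhere property holds there outright. -/
lemma of_ae_postShape {p : Y → Prop} (hp : MeasurableSet {x | p x}) {y : Fin n → Y}
    (h : ∀ᵐ x ∂postShape β y, p x) (i : Fin n) : p (y i) :=
  (ae_dirac_iff hp).1 ((Measure.absolutelyContinuous_of_le (dirac_le_postShape y i)).ae_le h)

/-- An atom contributes exp(-log(1 + uzg(y i))), which is the inverse because positivity of the real
part excludes 0. -/
lemma expLog_postShape (hg : Measurable g) {z : ℂ} {y : Fin n → Y} {u : ℝ}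
    (hre : ∀ᵐ x ∂postShape β y, 0 < (1 + u * z * g x : ℂ).re)
    (hi : Integrable (fun x => Complex.log (1 + u * z * g x)) (postShape β y)) :
    expLog (postShape β y) z g u = sampleIntegrand β z g y u := by
  have hm : StronglyMeasurable fun x => Complex.log (1 + u * z * g x) := by
    refine Measurable.stronglyMeasurable ?_
    fun_prop
  rw [sampleIntegrand_eq, expLog, integral_postShape hm ((integrable_postShape hm y).1 hi),
    neg_add, Complex.exp_add, ← Finset.sum_neg_distrib, Complex.exp_sum, expLog]
  congr 1
  refine Finset.prod_congr rfl fun i _ => ?_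
  have h0 : 0 < (1 + u * z * g (y i) : ℂ).re :=
    of_ae_postShape (measurableSet_lt measurable_const (by fun_prop)) hre i
  rw [Complex.exp_neg, Complex.exp_log]
  intro h
  rw [h] at h0
  exact lt_irrefl _ h0

/-- The Laplace functional of a posterior Beta-Gamma process as a beta mixture. -/
theorem laplace_betaGamma_postShape [IsFiniteMeasure β] {q : ℝ}
    (hq : 0 < q) (hr : 0 < β.real univ + n - q) (hg : Measurable g)
    (hlog : Integrable (fun y => Real.log (1 + |g y|)) β) {y : Fin n → Y}
    {G : Measure (Measure Y)} (hG : IsGammaProcess (postShape β y) G) {z : ℂ}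
    (hz : LaplaceConverges (betaGammaLaw (postShape β y) G (β.real univ + n - q)) z g) :
    (∀ᵐ u : ℝ ∂ProbabilityTheory.betaMeasure q (β.real univ + n - q), u ∈ Ioo (0 : ℝ) 1 ∧
      (∀ᵐ x ∂β, 0 < (1 + u * z * g x : ℂ).re) ∧ (∀ i, 0 < (1 + u * z * g (y i) : ℂ).re) ∧
      Integrable (fun x => Complex.log (1 + u * z * g x)) β) ∧
    Integrable (sampleIntegrand β z g y) (ProbabilityTheory.betaMeasure q (β.real univ + n - q)) ∧
    laplaceFunctional (betaGammaLaw (postShape β y) G (β.real univ + n - q)) z g =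
      ∫ u, sampleIntegrand β z g y u ∂ProbabilityTheory.betaMeasure q (β.real univ + n - q) := by
  have hlog' : Integrable (fun y => Real.log (1 + |g y|)) (postShape β y) :=
    (integrable_postShape (Measurable.stronglyMeasurable (by fun_prop)) y).2 hlog
  have h := hG.laplace_betaGamma hq (by rw [postShape_real_univ]; exact hr) hg hlog'
    (by rw [postShape_real_univ]; exact hz)
  rw [postShape_real_univ] at h
  obtain ⟨h1, h2, h3⟩ := h
  have h4 : ∀ᵐ u : ℝ ∂ProbabilityTheory.betaMeasure q (β.real univ + n - q),
      expLog (postShape β y) z g u = sampleIntegrand β z g y u :=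
    h1.mono fun u hu => expLog_postShape hg hu.2.1 hu.2.2
  refine ⟨h1.mono fun u hu => ⟨hu.1,
    (Measure.absolutelyContinuous_of_le (le_postShape y)).ae_le hu.2.1,
    of_ae_postShape (p := fun x => 0 < (1 + u * z * g x : ℂ).re)
      (measurableSet_lt measurable_const (by fun_prop)) hu.2.1,
    hu.2.2.mono_measure (le_postShape y)⟩, h2.congr h4, ?_⟩
  rw [h3]
  exact integral_congr_ae h4

/-- The Laplace functional of a Beta-Gamma process as a mixture over the Blackwell–MacQueen
distribution. -/
theorem laplace_betaGamma_mixture [IsFiniteMeasure β] (hΓ : IsGammaProcess β Γ)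
    (h0 : 0 < β.real univ) {q : ℝ} (hq : 0 < q) {G : (Fin n → Y) → Measure (Measure Y)}
    (hG : ∀ y, IsGammaProcess (postShape β y) (G y)) {z : ℂ}
    (hz : LaplaceConverges (betaGammaLaw β Γ (β.real univ - q)) z g) :
    (∀ᵐ y ∂blackwellMacQueen β n,
      LaplaceConverges (betaGammaLaw (postShape β y) (G y) (β.real univ + n - q)) z g) ∧
    Integrable (fun y => laplaceFunctional
      (betaGammaLaw (postShape β y) (G y) (β.real univ + n - q)) z g) (blackwellMacQueen β n) ∧
    laplaceFunctional (betaGammaLaw β Γ (β.real univ - q)) z g =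
      ∫ y, laplaceFunctional (betaGammaLaw (postShape β y) (G y) (β.real univ + n - q)) z g
        ∂blackwellMacQueen β n := by
  obtain ⟨hm, he⟩ := betaGammaLaw_eq_bind hΓ h0 hq n hG
  rw [LaplaceConverges, he] at hz
  rw [laplaceFunctional, he]
  exact integrable_bind hm hz

/-- The modulus of exp(-zμ(g)) depends on z only through Re z. Passing to Re z supplies a positive
majorant below. -/
lemma laplaceConverges_re {L : Measure (Measure Y)} (hg : Measurable g) {z : ℂ} :
    LaplaceConverges L z g ↔ LaplaceConverges L (z.re : ℂ) g := by
  have h : ∀ μ : Measure Y, ‖Complex.exp (-z * ((∫ y, g y ∂μ : ℝ) : ℂ))‖ =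
      ‖Complex.exp (-(z.re : ℂ) * ((∫ y, g y ∂μ : ℝ) : ℂ))‖ := fun μ => by
    simp [Complex.norm_exp]
  exact ⟨fun hi => hi.congr' (measurable_exp_integral hg _).aestronglyMeasurable (ae_of_all _ h),
    fun hi => hi.congr' (measurable_exp_integral hg _).aestronglyMeasurable
      (ae_of_all _ fun μ => (h μ).symm)⟩

/-- Re log w = log |w| ≥ log Re w whenever Re w > 0. -/
lemma norm_expLog_le {z : ℂ} {u : ℝ} (hre : ∀ᵐ x ∂β, 0 < (1 + u * z * g x : ℂ).re)
    (hi : Integrable (fun x => Complex.log (1 + u * z * g x)) β)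
    (hi' : Integrable (fun x => Complex.log (1 + u * (z.re : ℂ) * g x)) β) :
    ‖expLog β z g u‖ ≤ ‖expLog β (z.re : ℂ) g u‖ := by
  have e := Complex.reCLM.integral_comp_comm hi
  have e' := Complex.reCLM.integral_comp_comm hi'
  simp only [Complex.reCLM_apply] at e e'
  rw [expLog, expLog, Complex.norm_exp, Complex.norm_exp, Real.exp_le_exp, Complex.neg_re,
    Complex.neg_re, neg_le_neg_iff, ← e, ← e']
  refine integral_mono_ae (Complex.reCLM.integrable_comp hi') (Complex.reCLM.integrable_comp hi) ?_
  filter_upwards [hre] with x hx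
  simp only [Complex.log_re]
  have h1 : (1 + u * (z.re : ℂ) * g x : ℂ) = (((1 + u * z * g x : ℂ).re : ℝ) : ℂ) := by
    apply Complex.ext <;> simp
  rw [h1, Complex.norm_real, Real.norm_of_nonneg hx.le]
  exact Real.log_le_log hx (Complex.re_le_norm _)

/-- Each factor is compared through |w| ≥ Re w. At Re z the integrand is real and nonnegative, so
its integral bounds the integral of the modulus. -/
lemma norm_sampleIntegrand_le {z : ℂ} {y : Fin n → Y} {u : ℝ}
    (hre : ∀ᵐ x ∂β, 0 < (1 + u * z * g x : ℂ).re) (hy : ∀ i, 0 < (1 + u * z * g (y i) : ℂ).re)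
    (hi : Integrable (fun x => Complex.log (1 + u * z * g x)) β)
    (hi' : Integrable (fun x => Complex.log (1 + u * (z.re : ℂ) * g x)) β) :
    ‖sampleIntegrand β z g y u‖ ≤ (sampleIntegrand β (z.re : ℂ) g y u).re := by
  have h1 : ∀ x, (1 + u * (z.re : ℂ) * g x : ℂ) = (((1 + u * z * g x : ℂ).re : ℝ) : ℂ) := by
    intro x; apply Complex.ext <;> simp
  have h2 : expLog β (z.re : ℂ) g u =
      ((Real.exp (-∫ x, Real.log (1 + u * z * g x : ℂ).re ∂β) : ℝ) : ℂ) := by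
    rw [expLog]
    push_cast
    rw [← integral_complex_ofReal]
    congr 2
    refine integral_congr_ae (hre.mono fun x hx => ?_)
    simp only
    rw [h1, Complex.ofReal_log hx.le]
  have h3 : sampleIntegrand β (z.re : ℂ) g y u =
      ((‖expLog β (z.re : ℂ) g u‖ * ∏ i, ((1 + u * z * g (y i) : ℂ).re)⁻¹ : ℝ) : ℂ) := by
    rw [sampleIntegrand_eq, h2, Complex.norm_real, Real.norm_of_nonneg (Real.exp_pos _).le]
    push_cast
    congr 1
    refine Finset.prod_congr rfl fun i _ => ?_
    rw [h1]
  rw [h3, Complex.ofReal_re, sampleIntegrand_eq, norm_mul, norm_prod]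
  refine mul_le_mul (norm_expLog_le hre hi hi') (Finset.prod_le_prod (fun _ _ => norm_nonneg _)
    fun i _ => ?_) (Finset.prod_nonneg fun _ _ => norm_nonneg _) (norm_nonneg _)
  rw [norm_inv]
  exact inv_anti₀ (hy i) (Complex.re_le_norm _)

lemma measurable_sampleIntegrand [SFinite β] (hg : Measurable g) (z : ℂ) :
    Measurable fun p : (Fin n → Y) × ℝ => sampleIntegrand β z g p.1 p.2 := by
  simp_rw [sampleIntegrand_eq]
  refine ((measurable_expLog hg z).comp measurable_snd).mul
    (Finset.measurable_fun_prod _ fun i _ => ?_)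
  fun_prop

/-- Integrability in u for each sample does not by itself control the dependence on the sample. The
u-integral of the modulus is bounded by the posterior Laplace functional at Re z, which the mixture
formula at Re z shows to be integrable over the sample. -/
theorem integrable_sampleIntegrand_prod [IsFiniteMeasure β] (hΓ : IsGammaProcess β Γ)
    (h0 : 0 < β.real univ) {q : ℝ} (hq : 0 < q) (hr : 0 < β.real univ + n - q) (hg : Measurable g)
    (hlog : Integrable (fun y => Real.log (1 + |g y|)) β) {z : ℂ}
    (hz : LaplaceConverges (betaGammaLaw β Γ (β.real univ - q)) z g) :
    Integrable (fun p : (Fin n → Y) × ℝ => sampleIntegrand β z g p.1 p.2)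
      ((blackwellMacQueen β n).prod (ProbabilityTheory.betaMeasure q (β.real univ + n - q))) := by
  have := hΓ.isProbabilityMeasure
  have := ProbabilityTheory.isProbabilityMeasureBeta hq hr
  have hG := fun y : Fin n → Y => isGammaProcess_gammaPosterior hΓ y
  have hzr := (laplaceConverges_re hg).1 hz
  obtain ⟨ha, -, -⟩ := laplace_betaGamma_mixture hΓ h0 hq hG hz
  obtain ⟨ha', hb', -⟩ := laplace_betaGamma_mixture hΓ h0 hq hG hzr
  have hms := measurable_sampleIntegrand (n := n) (β := β) hg z
  refine (integrable_prod_iff hms.aestronglyMeasurable).2 ⟨?_, ?_⟩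
  · filter_upwards [ha] with y hy
    exact (laplace_betaGamma_postShape hq hr hg hlog (hG y) hy).2.1
  · refine hb'.norm.mono' hms.norm.stronglyMeasurable.integral_prod_right'.aestronglyMeasurable ?_
    filter_upwards [ha, ha'] with y hy hy'
    obtain ⟨h1, h2, -⟩ := laplace_betaGamma_postShape hq hr hg hlog (hG y) hy
    obtain ⟨h1', h2', h3'⟩ := laplace_betaGamma_postShape hq hr hg hlog (hG y) hy'
    rw [Real.norm_of_nonneg (integral_nonneg fun _ => norm_nonneg _), h3']
    refine le_trans ?_ (Complex.re_le_norm _)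
    rw [← Complex.reCLM_apply, ← ContinuousLinearMap.integral_comp_comm _ h2']
    refine integral_mono_ae h2.norm (Complex.reCLM.integrable_comp h2') ?_
    filter_upwards [h1, h1'] with u hu hu'
    exact norm_sampleIntegrand_le hu.2.1 hu.2.2.1 hu.2.2.2 hu'.2.2.2

end Mixture

/-! ### Recursion for weighted sums over set partitions -/

section Blocks

variable {ι κ R : Type*} [DecidableEq ι] [DecidableEq κ] [CommSemiring R] {a : ι} {s : Finset ι}

/-- Insert a new element into the part `C` of a partition, or as a singleton if `C` is empty. -/
def insertPart (ha : a ∉ s) (p : Finpartition s) (C : Finset ι) (hC : C ∈ insert ∅ p.parts) :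
    Finpartition (insert a s) :=
  Finpartition.ofExistsUnique (insert (insert a C) (p.parts.erase C))
    (by
      have hCs : C ⊆ s := by
        rcases Finset.mem_insert.1 hC with rfl | h
        · simp
        · exact p.subset h
      intro t ht
      rcases Finset.mem_insert.1 ht with rfl | h
      · exact Finset.insert_subset_insert _ hCs
      · exact (p.subset (Finset.mem_of_mem_erase h)).trans (Finset.subset_insert _ _))
    (by
      have hp : ∀ t ∈ p.parts, a ∉ t := fun t ht h => ha (p.subset ht h)
      have hdis : ∀ b, b ∈ C → C ∈ p.parts := fun b hb => by
        rcases Finset.mem_insert.1 hC with rfl | h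
        · simp at hb
        · exact h
      intro b hb
      by_cases hbC : b ∈ insert a C
      · refine ⟨insert a C, ⟨Finset.mem_insert_self _ _, hbC⟩, ?_⟩
        rintro t ⟨ht, hbt⟩
        rcases Finset.mem_insert.1 ht with h | h
        · exact h
        · obtain ⟨h1, h2⟩ := Finset.mem_erase.1 h
          rcases Finset.mem_insert.1 hbC with rfl | h3
          · exact absurd hbt (hp t h2)
          · exact absurd (p.eq_of_mem_parts h2 (hdis b h3) hbt h3) h1
      · rw [Finset.mem_insert, not_or] at hbC
        have hbs : b ∈ s := Finset.mem_of_mem_insert_of_ne hb hbC.1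
        refine ⟨p.part b, ⟨Finset.mem_insert_of_mem (Finset.mem_erase.2
          ⟨fun h => hbC.2 (h ▸ p.mem_part hbs), p.part_mem.2 hbs⟩), p.mem_part hbs⟩, ?_⟩
        rintro t ⟨ht, hbt⟩
        rcases Finset.mem_insert.1 ht with rfl | h
        · exact absurd hbt (by simp [hbC.1, hbC.2])
        · exact (p.part_eq_of_mem (Finset.mem_of_mem_erase h) hbt).symm)
    (by
      rw [Finset.mem_insert, not_or]
      exact ⟨(Finset.insert_ne_empty _ _).symm, fun h =>
        p.empty_notMem_parts (Finset.mem_of_mem_erase h)⟩)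

lemma insertPart_parts (ha : a ∉ s) (p : Finpartition s) (C : Finset ι)
    (hC : C ∈ insert ∅ p.parts) :
    (insertPart ha p C hC).parts = insert (insert a C) (p.parts.erase C) := rfl

lemma subset_of_mem_insert_parts {p : Finpartition s} {C : Finset ι} (hC : C ∈ insert ∅ p.parts) :
    C ⊆ s := by
  rcases Finset.mem_insert.1 hC with rfl | h
  · simp
  · exact p.subset h

/-- The part containing a is `insert a C`, since a lies in no other part; the remaining parts then
determine p. -/
lemma insertPart_injective (ha : a ∉ s) {p p' : Finpartition s} {C C' : Finset ι}
    {hC : C ∈ insert ∅ p.parts} {hC' : C' ∈ insert ∅ p'.parts}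
    (h : insertPart ha p C hC = insertPart ha p' C' hC') : p = p' ∧ C = C' := by
  have hparts : insert (insert a C) (p.parts.erase C) =
      insert (insert a C') (p'.parts.erase C') := congrArg Finpartition.parts h
  have hn : ∀ (r : Finpartition s) (D E : Finset ι), insert a D ∉ r.parts.erase E :=
    fun r D E h => ha (r.subset (Finset.mem_of_mem_erase h) (Finset.mem_insert_self _ _))
  have haC : a ∉ C := fun h => ha (subset_of_mem_insert_parts hC h)
  have haC' : a ∉ C' := fun h => ha (subset_of_mem_insert_parts hC' h)
  have h1 : insert a C = insert a C' := by
    have : insert a C ∈ insert (insert a C') (p'.parts.erase C') :=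
      hparts ▸ Finset.mem_insert_self _ _
    exact (Finset.mem_insert.1 this).resolve_right (hn _ _ _)
  have h2 : C = C' := by rw [← Finset.erase_insert haC, h1, Finset.erase_insert haC']
  subst h2
  refine ⟨?_, rfl⟩
  have h3 : p.parts.erase C = p'.parts.erase C := by
    rw [← Finset.erase_insert (hn p C C), hparts, Finset.erase_insert (hn p' C C)]
  ext1
  by_cases h0 : C = ∅
  · subst h0
    rwa [Finset.erase_eq_of_notMem p.empty_notMem_parts,
      Finset.erase_eq_of_notMem p'.empty_notMem_parts] at h3
  · rw [← Finset.insert_erase ((Finset.mem_insert.1 hC).resolve_left h0), h3,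
      Finset.insert_erase ((Finset.mem_insert.1 hC').resolve_left h0)]

/-- Take p to be P with a deleted, and C the rest of the part of a, which is empty exactly when a
was a singleton. -/
lemma insertPart_surjective (ha : a ∉ s) (P : Finpartition (insert a s)) :
    ∃ (p : Finpartition s) (C : Finset ι) (hC : C ∈ insert ∅ p.parts),
      insertPart ha p C hC = P := by
  have hs : insert a s \ {a} = s := by
    rw [Finset.sdiff_singleton_eq_erase, Finset.erase_insert ha]
  obtain ⟨p, hp⟩ : ∃ p : Finpartition s,
      ∀ t, t ∈ p.parts ↔ ∃ d ∈ P.parts, ¬ d ⊆ {a} ∧ d.erase a = t := by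
    refine ⟨(P.avoid {a}).copy hs, fun t => ?_⟩
    rw [Finpartition.copy, Finpartition.mem_avoid]
    simp only [Finset.sdiff_singleton_eq_erase]
  have haP : a ∈ P.part a := P.mem_part (Finset.mem_insert_self _ _)
  have hPa : P.part a ∈ P.parts := P.part_mem.2 (Finset.mem_insert_self _ _)
  have hsub : ∀ d : Finset ι, ¬ d ⊆ {a} ↔ d.erase a ≠ ∅ := fun d => by
    rw [← Finset.sdiff_singleton_eq_erase, Ne, Finset.sdiff_eq_empty_iff_subset]
  have hother : ∀ d ∈ P.parts, d ≠ P.part a → a ∉ d := fun d hd hne had =>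
    hne (P.part_eq_of_mem hd had).symm
  refine ⟨p, (P.part a).erase a, ?_, ?_⟩
  · rw [Finset.mem_insert, or_iff_not_imp_left]
    exact fun h => (hp _).2 ⟨_, hPa, (hsub _).2 h, rfl⟩
  · ext1
    rw [insertPart_parts, Finset.insert_erase haP]
    ext t
    rw [Finset.mem_insert, Finset.mem_erase, hp]
    constructor
    · rintro (rfl | ⟨hne, d, hd, -, rfl⟩)
      · exact hPa
      · have hda : d ≠ P.part a := fun h => hne (by rw [h])
        rwa [Finset.erase_eq_of_notMem (hother d hd hda)]
    · intro ht
      by_cases hta : t = P.part a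
      · exact Or.inl hta
      · have hat := hother t ht hta
        have hte : t.erase a = t := Finset.erase_eq_of_notMem hat
        refine Or.inr ⟨fun h => hta ?_, t, ht, (hsub t).2 (hte.symm ▸ P.ne_empty ht), hte⟩
        obtain ⟨b, hb⟩ := P.nonempty_of_mem_parts ht
        exact P.eq_of_mem_parts ht hPa hb (Finset.mem_of_mem_erase (h ▸ hb))

/-- The sum over all partitions of `s` of the products of `(|C| - 1)! m(C)` over the parts `C`. -/
def blockSum (s : Finset ι) (m : Finset ι → R) : R :=
  ∑ p : Finpartition s, ∏ C ∈ p.parts, ((C.card - 1).factorial : R) * m C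

lemma blockSum_empty (m : Finset ι → R) : blockSum ∅ m = 1 := by
  have h : ∀ p : Finpartition (∅ : Finset ι), p.parts = ∅ := fun p =>
    p.parts_eq_empty_iff.2 rfl
  rw [blockSum, Finset.sum_congr rfl fun p _ => by rw [h p, Finset.prod_empty]]
  have : Fintype.card (Finpartition (∅ : Finset ι)) = 1 :=
    Fintype.card_eq_one_iff.2 ⟨Finpartition.empty _, fun p => by
      ext1; rw [h p, h]⟩
  simp [this]

/-- Adding a to a part C changes (|C|-1)! into |C|! = |C| (|C|-1)!, and the factor |C| is a sum over
the elements j of C that a may join. This mirrors the urn step: a fresh draw, or a copy of draw j.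
-/
lemma blockSum_insert (ha : a ∉ s) (m : Finset ι → R) :
    blockSum (insert a s) m = m {a} * blockSum s m +
      ∑ j ∈ s, blockSum s fun C => if j ∈ C then m (insert a C) else m C := by
  let w : Finset ι → R := fun C => ((C.card - 1).factorial : R) * m C
  -- The weight |C|! is also correct for C = ∅, where the new singleton has weight 0! = 1.
  have h1 : blockSum (insert a s) m = ∑ x ∈ Finset.univ.sigma
      (fun p : Finpartition s => insert ∅ p.parts),
      (x.2.card.factorial : R) * m (insert a x.2) * ∏ D ∈ x.1.parts.erase x.2, w D := by
    symm
    refine Finset.sum_bij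
      (fun x hx => insertPart ha x.1 x.2 (Finset.mem_sigma.1 hx).2) (fun _ _ => Finset.mem_univ _)
      ?_ ?_ ?_
    · rintro ⟨p, C⟩ hx ⟨p', C'⟩ hx' h
      obtain ⟨h1, h2⟩ := insertPart_injective ha h
      simp only at h1 h2
      rw [h1, h2]
    · intro P _
      obtain ⟨p, C, hC, h⟩ := insertPart_surjective ha P
      exact ⟨⟨p, C⟩, Finset.mem_sigma.2 ⟨Finset.mem_univ _, hC⟩, h⟩
    · rintro ⟨p, C⟩ hx
      have hC := (Finset.mem_sigma.1 hx).2
      have haC : a ∉ C := fun h => ha (subset_of_mem_insert_parts hC h)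
      rw [insertPart_parts, Finset.prod_insert fun h => ha
        (p.subset (Finset.mem_of_mem_erase h) (Finset.mem_insert_self _ _)),
        Finset.card_insert_of_notMem haC, Nat.add_sub_cancel]
  rw [h1, Finset.sum_sigma]
  simp only [blockSum]
  rw [Finset.sum_comm, Finset.mul_sum, ← Finset.sum_add_distrib]
  refine Finset.sum_congr rfl fun p _ => ?_
  rw [Finset.sum_insert p.empty_notMem_parts, Finset.erase_eq_of_notMem p.empty_notMem_parts]
  congr 1
  · simp [w]
  · have hsum : ∀ f : ι → R, ∑ j ∈ s, f j = ∑ C ∈ p.parts, ∑ j ∈ C, f j := fun f => by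
      conv_lhs => rw [← p.biUnion_parts]
      exact Finset.sum_biUnion p.disjoint
    rw [hsum]
    refine Finset.sum_congr rfl fun C hC => ?_
    have h2 : ∀ j ∈ C, (∏ D ∈ p.parts, ((D.card - 1).factorial : R) *
        (if j ∈ D then m (insert a D) else m D)) =
        ((C.card - 1).factorial : R) * m (insert a C) * ∏ D ∈ p.parts.erase C, w D := by
      intro j hj
      rw [← Finset.mul_prod_erase _ _ hC, if_pos hj]
      congr 1
      refine Finset.prod_congr rfl fun D hD => ?_
      obtain ⟨h1, h2⟩ := Finset.mem_erase.1 hD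
      rw [if_neg fun h => h1 (p.eq_of_mem_parts h2 hC h hj)]
    rw [Finset.sum_congr rfl h2, Finset.sum_const, nsmul_eq_mul, ← mul_assoc, ← mul_assoc,
      ← Nat.cast_mul, Nat.mul_factorial_pred (Finset.card_ne_zero.2 (p.nonempty_of_mem_parts hC))]

/-- Induction through the recursion avoids transporting partitions along the embedding. -/
lemma blockSum_map (e : κ ↪ ι) (t : Finset κ) (m : Finset ι → R) :
    blockSum (t.map e) m = blockSum t fun C => m (C.map e) := by
  induction t using Finset.induction_on generalizing m with
  | empty => rw [Finset.map_empty, blockSum_empty, blockSum_empty]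
  | insert a t ha ih =>
    have ha' : e a ∉ t.map e := by simpa using ha
    rw [Finset.map_insert, blockSum_insert ha', blockSum_insert ha, ih, Finset.sum_map,
      Finset.map_singleton]
    congr 1
    refine Finset.sum_congr rfl fun j _ => ?_
    rw [ih]
    congr 1
    funext C
    simp [Finset.map_insert]

end Blocks

/-! ### The urn measure as a sum over partitions -/

section Partition

variable {Y : Type*} [MeasurableSpace Y] {β : Measure Y} {Γ : Measure (Measure Y)} {n : ℕ}
  {g : Y → ℝ}

/-- The last coordinate is either a fresh draw or a copy of y j; in the second case its constraint
moves to coordinate j and intersects the one already there. -/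
lemma map_snoc_pi [IsFiniteMeasure β] {A : Fin (n + 1) → Set Y} (hA : ∀ i, MeasurableSet (A i))
    (y : Fin n → Y) :
    ((postShape β y).map fun x => (Fin.snoc y x : Fin (n + 1) → Y)) (univ.pi A) =
      (univ.pi fun i : Fin n => A i.castSucc).indicator (fun _ => β (A (Fin.last n))) y +
      ∑ j, (univ.pi (Function.update (fun i : Fin n => A i.castSucc) j
        (A j.castSucc ∩ A (Fin.last n)))).indicator (fun _ => 1) y := by
  classical
  have hy : Measurable fun x => (Fin.snoc y x : Fin (n + 1) → Y) :=
    measurable_snoc.comp measurable_prodMk_left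
  have h0 : (fun x => (Fin.snoc y x : Fin (n + 1) → Y)) ⁻¹' univ.pi A =
      {x | (∀ i : Fin n, y i ∈ A i.castSucc) ∧ x ∈ A (Fin.last n)} := by
    ext x
    simp [Set.mem_pi, Fin.forall_fin_succ']
  have h1 : ∀ j, y ∈ univ.pi (Function.update (fun i : Fin n => A i.castSucc) j
      (A j.castSucc ∩ A (Fin.last n))) ↔
      (∀ i : Fin n, y i ∈ A i.castSucc) ∧ y j ∈ A (Fin.last n) := by
    intro j
    simp only [Set.mem_pi, mem_univ, true_imp_iff]
    constructor
    · intro h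
      have hj := h j
      rw [Function.update_self] at hj
      refine ⟨fun i => ?_, hj.2⟩
      by_cases hij : i = j
      · exact hij ▸ hj.1
      · simpa [hij] using h i
    · rintro ⟨h, h'⟩ i
      by_cases hij : i = j
      · subst hij
        rw [Function.update_self]
        exact ⟨h i, h'⟩
      · simpa [hij] using h i
  rw [Measure.map_apply hy (MeasurableSet.univ_pi hA), h0]
  simp only [indicator_apply, h1]
  by_cases h : ∀ i : Fin n, y i ∈ A i.castSucc
  · have h2 : y ∈ univ.pi fun i : Fin n => A i.castSucc := fun i _ => h i
    simp only [h, h2, implies_true, true_and, if_true]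
    rw [postShape, Measure.add_apply, Measure.coe_finsetSum, Finset.sum_apply]
    simp_rw [ofPred_mem_eq, Measure.dirac_apply' _ (hA (Fin.last n)), indicator_apply, Pi.one_apply]
  · have h2 : y ∉ univ.pi fun i : Fin n => A i.castSucc := fun h' => h fun i => h' i trivial
    simp [h, h2]

/-- The urn measure of a rectangle. -/
lemma urnMeasure_pi [IsFiniteMeasure β] (n : ℕ) {A : Fin n → Set Y}
    (hA : ∀ i, MeasurableSet (A i)) :
    urnMeasure β n (univ.pi A) = blockSum Finset.univ fun C => β (⋂ i ∈ C, A i) := by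
  induction n with
  | zero =>
    rw [urnMeasure, Measure.dirac_apply' _ (MeasurableSet.univ_pi hA), Finset.univ_eq_empty,
      blockSum_empty]
    simp [Set.mem_pi]
  | succ n ih =>
    have hA' : ∀ j, ∀ i, MeasurableSet (Function.update (fun i : Fin n => A i.castSucc) j
        (A j.castSucc ∩ A (Fin.last n)) i) := fun j i => by
      by_cases hij : i = j
      · subst hij
        rw [Function.update_self]
        exact (hA _).inter (hA _)
      · rw [Function.update_of_ne hij]
        exact hA _
    rw [urnMeasure, Measure.bind_apply (MeasurableSet.univ_pi hA) measurable_urnStep.aemeasurable]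
    simp_rw [map_snoc_pi hA]
    rw [lintegral_add_left (measurable_const.indicator (MeasurableSet.univ_pi fun i => hA _)),
      lintegral_finsetSum _ fun j _ =>
        measurable_const.indicator (MeasurableSet.univ_pi (hA' j)),
      lintegral_indicator_const (MeasurableSet.univ_pi fun i => hA _), ih fun i => hA _]
    simp_rw [fun j => lintegral_indicator_const (μ := urnMeasure β n)
      (MeasurableSet.univ_pi (hA' j)) 1, one_mul, fun j => ih (hA' j)]
    have hlast : Fin.last n ∉ (Finset.univ : Finset (Fin n)).map Fin.castSuccEmb := by simp
    have huniv : (Finset.univ : Finset (Fin (n + 1))) =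
        insert (Fin.last n) (Finset.univ.map Fin.castSuccEmb) := by
      rw [Fin.univ_castSuccEmb, Finset.cons_eq_insert]
    have hinter : ∀ C : Finset (Fin n), ⋂ i ∈ C.map Fin.castSuccEmb, A i =
        ⋂ i ∈ C, A i.castSucc := fun C => by
      ext x; simp
    -- The recursion at the last index matches `map_snoc_pi` term by term: the singleton with the
    -- fresh draw, and joining j with the updated rectangle.
    rw [huniv, blockSum_insert hlast, blockSum_map, Finset.sum_map]
    congr 1
    · simp_rw [hinter]
      simp
    · refine Finset.sum_congr rfl fun j _ => ?_
      rw [blockSum_map]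
      congr 1
      funext C
      rw [Finset.set_biInter_insert, hinter]
      simp only [Fin.coe_castSuccEmb, Finset.mem_map, Fin.castSucc_inj, exists_eq_right]
      split_ifs with hj
      · congr 1
        ext x
        simp only [mem_iInter, mem_inter_iff]
        constructor
        · intro h
          have hx := h j hj
          rw [Function.update_self] at hx
          refine ⟨hx.2, fun i hi => ?_⟩
          by_cases hij : i = j
          · exact hij ▸ hx.1
          · simpa [hij] using h i hi
        · rintro ⟨h, h'⟩ i hi
          by_cases hij : i = j
          · subst hij
            rw [Function.update_self]
            exact ⟨h' i hi, h⟩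
          · simpa [hij] using h' i hi
      · congr 1
        refine iInter₂_congr fun i hi => ?_
        rw [Function.update_of_ne (by rintro rfl; exact hj hi)]

/-- The map sending a labelling of the parts of a partition to the sample constant on the parts. -/
def partSample (p : Finpartition (Finset.univ : Finset (Fin n))) (x : p.parts → Y) (i : Fin n) :
    Y :=
  x ⟨p.part i, p.part_mem.2 (Finset.mem_univ i)⟩

lemma measurable_partSample (p : Finpartition (Finset.univ : Finset (Fin n))) :
    Measurable (partSample (Y := Y) p) :=
  measurable_pi_lambda _ fun _ => measurable_pi_apply _

lemma filter_part_eq (p : Finpartition (Finset.univ : Finset (Fin n))) (C : p.parts) :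
    (Finset.univ.filter fun i => (⟨p.part i, p.part_mem.2 (Finset.mem_univ i)⟩ : p.parts) = C) =
      C := by
  ext i
  rw [Finset.mem_filter, Subtype.ext_iff, p.part_eq_iff_mem C.2]
  simp

/-- The law of a sample constant on the parts of `p`, with independent values of law `β`. -/
noncomputable def partMeasure (β : Measure Y) (p : Finpartition (Finset.univ : Finset (Fin n))) :
    Measure (Fin n → Y) :=
  (Measure.pi fun _ : p.parts => β).map (partSample p)

instance isFiniteMeasure_partMeasure [IsFiniteMeasure β]
    (p : Finpartition (Finset.univ : Finset (Fin n))) : IsFiniteMeasure (partMeasure β p) := by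
  unfold partMeasure; infer_instance

lemma partMeasure_pi [IsFiniteMeasure β] (p : Finpartition (Finset.univ : Finset (Fin n)))
    {A : Fin n → Set Y} (hA : ∀ i, MeasurableSet (A i)) :
    partMeasure β p (univ.pi A) = ∏ C ∈ p.parts, β (⋂ i ∈ C, A i) := by
  have h : partSample p ⁻¹' univ.pi A =
      univ.pi fun C : p.parts => ⋂ i ∈ (C : Finset (Fin n)), A i := by
    ext x
    simp only [mem_preimage, Set.mem_pi, mem_univ, true_imp_iff, mem_iInter, partSample]
    constructor
    · intro h C i hi
      have := h i
      rwa [show (⟨p.part i, p.part_mem.2 (Finset.mem_univ i)⟩ : p.parts) = C from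
        Subtype.ext (p.part_eq_of_mem C.2 hi)] at this
    · intro h i
      exact h _ i (p.mem_part (Finset.mem_univ i))
  rw [partMeasure, Measure.map_apply (measurable_partSample p) (MeasurableSet.univ_pi hA), h,
    Measure.pi_pi]
  exact Finset.prod_coe_sort p.parts fun C => β (⋂ i ∈ C, A i)

/-- The urn measure as a weighted sum over the partitions of the sample. -/
theorem urnMeasure_eq_sum [IsFiniteMeasure β] (n : ℕ) :
    urnMeasure β n = ∑ p : Finpartition (Finset.univ : Finset (Fin n)),
      ((∏ C ∈ p.parts, (C.card - 1).factorial : ℕ) : ℝ≥0) • partMeasure β p := by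
  -- Measurable rectangles form a π-system generating the product σ-algebra, and both measures are
  -- finite.
  have hrect : ∀ A : Fin n → Set Y, (∀ i, MeasurableSet (A i)) → urnMeasure β n (univ.pi A) =
      (∑ p : Finpartition (Finset.univ : Finset (Fin n)),
        ((∏ C ∈ p.parts, (C.card - 1).factorial : ℕ) : ℝ≥0) • partMeasure β p) (univ.pi A) := by
    intro A hA
    rw [urnMeasure_pi n hA, Measure.coe_finsetSum, Finset.sum_apply, blockSum]
    refine Finset.sum_congr rfl fun p _ => ?_
    rw [Measure.smul_apply, partMeasure_pi p hA, Finset.prod_mul_distrib, ENNReal.smul_def,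
      smul_eq_mul]
    push_cast
    rfl
  have huniv := hrect (fun _ => univ) fun _ => MeasurableSet.univ
  rw [pi_univ] at huniv
  have : IsFiniteMeasure (urnMeasure β n) := ⟨huniv ▸ measure_lt_top _ _⟩
  refine ext_of_generate_finite _ generateFrom_pi.symm isPiSystem_pi ?_ huniv
  rintro _ ⟨A, hA, rfl⟩
  exact hrect A fun i => hA i trivial

/-- Every weight is a positive integer, hence at least 1. This passes integrability from the urn to
each partition. -/
lemma partMeasure_le_urnMeasure [IsFiniteMeasure β]
    (p : Finpartition (Finset.univ : Finset (Fin n))) : partMeasure β p ≤ urnMeasure β n := by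
  have h1 : (1 : ℝ≥0) ≤ ((∏ C ∈ p.parts, (C.card - 1).factorial : ℕ) : ℝ≥0) := by
    exact_mod_cast Nat.one_le_iff_ne_zero.2
      (Finset.prod_ne_zero_iff.2 fun C _ => Nat.factorial_ne_zero _)
  rw [urnMeasure_eq_sum]
  refine Measure.le_iff.2 fun s _ => ?_
  rw [Measure.coe_finsetSum, Finset.sum_apply]
  refine le_trans ?_ (Finset.single_le_sum (f := fun p : Finpartition _ =>
    (((∏ C ∈ p.parts, (C.card - 1).factorial : ℕ) : ℝ≥0) • partMeasure β p) s)
    (fun _ _ => zero_le) (Finset.mem_univ p))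
  simp only [Measure.smul_apply, ENNReal.smul_def, smul_eq_mul]
  exact le_mul_of_one_le_left zero_le (by exact_mod_cast h1)

lemma integral_urnMeasure [IsFiniteMeasure β] {f : (Fin n → Y) → ℂ}
    (hf : Integrable f (urnMeasure β n)) : ∫ y, f y ∂urnMeasure β n =
      ∑ p : Finpartition (Finset.univ : Finset (Fin n)),
        (∏ C ∈ p.parts, ((C.card - 1).factorial : ℂ)) * ∫ y, f y ∂partMeasure β p := by
  rw [urnMeasure_eq_sum, integral_finsetSum_measure]
  · refine Finset.sum_congr rfl fun p _ => ?_
    rw [integral_smul_nnreal_measure, NNReal.smul_def]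
    simp
  · exact fun p _ => (hf.mono_measure (partMeasure_le_urnMeasure p)).smul_measure_nnreal

/-- The sample is constant on each part with independent values across parts, so the product groups
into powers and the integral factorizes. -/
lemma integral_prod_partMeasure [IsFiniteMeasure β]
    (p : Finpartition (Finset.univ : Finset (Fin n))) {f : Y → ℂ} (hf : Measurable f) :
    ∫ y, ∏ i, f (y i) ∂partMeasure β p = ∏ C ∈ p.parts, ∫ x, f x ^ C.card ∂β := by
  have hm : Measurable fun y : Fin n → Y => ∏ i, f (y i) :=
    Finset.measurable_fun_prod _ fun i _ => hf.comp (measurable_pi_apply i)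
  rw [partMeasure, integral_map (measurable_partSample p).aemeasurable hm.aestronglyMeasurable]
  have h : ∀ x : p.parts → Y, ∏ i, f (partSample p x i) = ∏ C : p.parts, f (x C) ^ C.1.card := by
    intro x
    rw [← Finset.prod_fiberwise Finset.univ fun i : Fin n =>
      (⟨p.part i, p.part_mem.2 (Finset.mem_univ i)⟩ : p.parts)]
    refine Finset.prod_congr rfl fun C _ => ?_
    rw [← Finset.prod_const, filter_part_eq]
    refine Finset.prod_congr rfl fun i hi => ?_
    rw [partSample, show (⟨p.part i, p.part_mem.2 (Finset.mem_univ i)⟩ : p.parts) = C from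
        Subtype.ext (p.part_eq_of_mem C.2 hi)]
  simp_rw [h]
  rw [integral_fintype_prod_eq_prod (𝕜 := ℂ) (f := fun (C : p.parts) y => f y ^ C.1.card)]
  exact Finset.prod_coe_sort p.parts fun C => ∫ x, f x ^ C.card ∂β

end Partition

/-! ### Laplace functionals as sums over partitions -/

section Ewens

variable {Y : Type*} [MeasurableSpace Y] {β : Measure Y} {Γ : Measure (Measure Y)} {n : ℕ}
  {g : Y → ℝ}

lemma integral_sampleIntegrand_partMeasure [IsFiniteMeasure β] (hg : Measurable g) (z : ℂ) (u : ℝ)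
    (p : Finpartition (Finset.univ : Finset (Fin n))) :
    ∫ y, sampleIntegrand β z g y u ∂partMeasure β p =
      expLog β z g u * ∏ C ∈ p.parts, ∫ x, (1 + u * z * g x : ℂ) ^ (-(C.card : ℤ)) ∂β := by
  simp_rw [sampleIntegrand_eq]
  rw [integral_const_mul, integral_prod_partMeasure p (f := fun x => (1 + u * z * g x : ℂ)⁻¹)
    (by fun_prop)]
  simp only [inv_pow, zpow_neg, zpow_natCast]

/-- The Laplace functional of a Beta-Gamma process as a sum over the partitions of a sample. -/
theorem laplace_betaGamma_partition [IsFiniteMeasure β] (hΓ : IsGammaProcess β Γ)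
    (h0 : 0 < β.real univ) {q : ℝ} (hq : 0 < q) (hr : 0 < β.real univ + n - q) (hg : Measurable g)
    (hlog : Integrable (fun y => Real.log (1 + |g y|)) β) {z : ℂ}
    (hz : LaplaceConverges (betaGammaLaw β Γ (β.real univ - q)) z g) :
    (∀ p : Finpartition (Finset.univ : Finset (Fin n)), Integrable (fun u : ℝ => expLog β z g u *
      ∏ C ∈ p.parts, ∫ x, (1 + u * z * g x : ℂ) ^ (-(C.card : ℤ)) ∂β)
      (ProbabilityTheory.betaMeasure q (β.real univ + n - q))) ∧
    laplaceFunctional (betaGammaLaw β Γ (β.real univ - q)) z g =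
      ((Real.Gamma (β.real univ) / Real.Gamma (β.real univ + n) : ℝ) : ℂ) *
      ∑ p : Finpartition (Finset.univ : Finset (Fin n)),
        (∏ C ∈ p.parts, ((C.card - 1).factorial : ℂ)) * ∫ u : ℝ, expLog β z g u *
          ∏ C ∈ p.parts, ∫ x, (1 + u * z * g x : ℂ) ^ (-(C.card : ℤ)) ∂β
          ∂ProbabilityTheory.betaMeasure q (β.real univ + n - q) := by
  have := hΓ.isProbabilityMeasure
  have := ProbabilityTheory.isProbabilityMeasureBeta hq hr
  have hG := fun y : Fin n → Y => isGammaProcess_gammaPosterior hΓ y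
  have hJ := integrable_sampleIntegrand_prod (n := n) hΓ h0 hq hr hg hlog hz
  obtain ⟨ha, -, hmix⟩ := laplace_betaGamma_mixture hΓ h0 hq hG hz
  have hms := measurable_sampleIntegrand (n := n) (β := β) hg z
  have hc : 0 < Real.Gamma (β.real univ) / Real.Gamma (β.real univ + n) :=
    div_pos (Real.Gamma_pos_of_pos h0) (Real.Gamma_pos_of_pos (by positivity))
  have hc0 : ENNReal.ofReal (Real.Gamma (β.real univ) / Real.Gamma (β.real univ + n)) ≠ 0 := by
    simpa using hc
  -- The normalizing constant is positive and finite, so integrability is the same for the urn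
  -- measure and its normalization.
  have hurn : ∀ {f : (Fin n → Y) → ℂ}, Integrable f (blackwellMacQueen β n) ↔
      Integrable f (urnMeasure β n) := fun {f} =>
    integrable_smul_measure hc0 ENNReal.ofReal_ne_top
  -- Joint integrability descends to every partition, so the sample can be integrated out before u
  -- in each term.
  have hJp : ∀ p : Finpartition (Finset.univ : Finset (Fin n)), Integrable
      (fun x : (Fin n → Y) × ℝ => sampleIntegrand β z g x.1 x.2)
      ((partMeasure β p).prod (ProbabilityTheory.betaMeasure q (β.real univ + n - q))) := by
    intro p
    obtain ⟨h1, h2⟩ := (integrable_prod_iff hms.aestronglyMeasurable).1 hJ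
    refine (integrable_prod_iff hms.aestronglyMeasurable).2 ⟨?_, ?_⟩
    · exact ((Measure.absolutelyContinuous_of_le (partMeasure_le_urnMeasure p)).trans
        (Measure.absolutelyContinuous_smul hc0)).ae_le h1
    · exact ((integrable_smul_measure hc0 ENNReal.ofReal_ne_top).1 h2).mono_measure
        (partMeasure_le_urnMeasure p)
  have hfub : ∀ p : Finpartition (Finset.univ : Finset (Fin n)), ∫ y, ∫ u, sampleIntegrand β z g y u
      ∂ProbabilityTheory.betaMeasure q (β.real univ + n - q) ∂partMeasure β p =
      ∫ u : ℝ, expLog β z g u *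
          ∏ C ∈ p.parts, ∫ x, (1 + u * z * g x : ℂ) ^ (-(C.card : ℤ)) ∂β
          ∂ProbabilityTheory.betaMeasure q (β.real univ + n - q) := by
    intro p
    rw [integral_integral_swap (hJp p)]
    simp_rw [integral_sampleIntegrand_partMeasure hg]
  refine ⟨fun p => ?_, ?_⟩
  · simpa only [integral_sampleIntegrand_partMeasure hg] using (hJp p).integral_prod_right
  · have h1 : laplaceFunctional (betaGammaLaw β Γ (β.real univ - q)) z g =
        ∫ y, ∫ u, sampleIntegrand β z g y u
          ∂ProbabilityTheory.betaMeasure q (β.real univ + n - q) ∂blackwellMacQueen β n := by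
      rw [hmix]
      refine integral_congr_ae ?_
      filter_upwards [ha] with y hy
      exact (laplace_betaGamma_postShape hq hr hg hlog (hG y) hy).2.2
    rw [h1, blackwellMacQueen, integral_smul_measure, ENNReal.toReal_ofReal hc.le,
      integral_urnMeasure (hurn.1 hJ.integral_prod_left), Complex.real_smul]
    simp_rw [hfub]

end Ewens

/-! ### Specialization to the shape θH -/

section Shape

variable {Y : Type*} [MeasurableSpace Y]

lemma betaGammaLaw_zero {β : Measure Y} {Γ : Measure (Measure Y)} (h0 : 0 < β.real univ) :
    betaGammaLaw β Γ 0 = Γ := by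
  simp [betaGammaLaw, div_self (Real.Gamma_pos_of_pos h0).ne']

/-- Each part releases one factor θ, which supplies the power of θ in the Ewens weight. -/
lemma prod_integral_smul (H : Measure Y) {θ : ℝ} (hθ : 0 < θ) {n : ℕ} (z : ℂ) (g : Y → ℝ)
    (p : Finpartition (Finset.univ : Finset (Fin n))) (u : ℝ) :
    expLog (ENNReal.ofReal θ • H) z g u * ∏ C ∈ p.parts,
      ∫ x, (1 + u * z * g x : ℂ) ^ (-(C.card : ℤ)) ∂(ENNReal.ofReal θ • H) =
      (θ : ℂ) ^ p.parts.card * partitionIntegrand θ H z g p u := by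
  simp_rw [integral_smul_measure, ENNReal.toReal_ofReal hθ.le, Complex.real_smul,
    Finset.prod_mul_distrib, Finset.prod_const, partitionIntegrand]
  ring

/-- The Laplace functional of a Beta-Gamma process as a sum over partitions with Ewens weights. -/
theorem laplace_betaGamma_ewens {H : Measure Y} [IsProbabilityMeasure H] {θ : ℝ} (hθ : 0 < θ)
    {Γ : Measure (Measure Y)} (hΓ : IsGammaProcess (ENNReal.ofReal θ • H) Γ) {n : ℕ} {q : ℝ}
    (hq : 0 < q) (hr : 0 < θ + n - q) {g : Y → ℝ} (hg : Measurable g)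
    (hlog : Integrable (fun y => Real.log (1 + |g y|)) (ENNReal.ofReal θ • H)) {z : ℂ}
    (hz : LaplaceConverges (betaGammaLaw (ENNReal.ofReal θ • H) Γ (θ - q)) z g) :
    (∀ p : Finpartition (Finset.univ : Finset (Fin n)), Integrable (partitionIntegrand θ H z g p)
      (ProbabilityTheory.betaMeasure q (θ + n - q))) ∧
    laplaceFunctional (betaGammaLaw (ENNReal.ofReal θ • H) Γ (θ - q)) z g =
      ∑ p : Finpartition (Finset.univ : Finset (Fin n)), (ewensWeight θ p : ℂ) *
        ∫ u, partitionIntegrand θ H z g p u ∂ProbabilityTheory.betaMeasure q (θ + n - q) := by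
  have hu : (ENNReal.ofReal θ • H).real univ = θ := by
    simp [hθ.le]
  have : IsFiniteMeasure (ENNReal.ofReal θ • H) := H.smul_finite ENNReal.ofReal_ne_top
  have h := laplace_betaGamma_partition hΓ (by rwa [hu]) (n := n) hq (by rwa [hu]) hg hlog
    (by rwa [hu])
  simp_rw [hu, prod_integral_smul H hθ] at h
  have hθ0 : ∀ k : ℕ, (θ : ℂ) ^ k ≠ 0 := fun k => pow_ne_zero k (by exact_mod_cast hθ.ne')
  refine ⟨fun p => ?_, ?_⟩
  · have h1 := (h.1 p).const_mul ((θ : ℂ) ^ p.parts.card)⁻¹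
    simpa only [inv_mul_cancel_left₀ (hθ0 _)] using h1
  · rw [h.2, Finset.mul_sum]
    refine Finset.sum_congr rfl fun p _ => ?_
    rw [integral_const_mul, ewensWeight]
    push_cast
    ring

end Shape

end DirichletBetaGamma

/-! ### The main theorem -/

open DirichletBetaGamma in
theorem theorem2p1 {Y : Type*} [TopologicalSpace Y] [PolishSpace Y] [MeasurableSpace Y]
    [BorelSpace Y] (H : Measure Y) [IsProbabilityMeasure H] (θ : ℝ) (hθ : 0 < θ)
    (α : Measure Y) (hα : α = ENNReal.ofReal θ • H)
    (D Γ : Measure (Measure Y)) (hD : IsDirichletProcess α D) (hΓ : IsGammaProcess α Γ)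
    (g : Y → ℝ) (hg : Measurable g) (hlog : Integrable (fun y => Real.log (1 + |g y|)) α) :
    -- the linear functionals exist, and the Laplace functional converges if `Re z * g ≥ 0`
    ((∀ᵐ P ∂D, Integrable g P) ∧ (∀ᵐ μ ∂Γ, Integrable g μ) ∧
      (∀ q : ℝ, 0 < q → ∀ z : ℂ, (∀ᵐ y ∂H, 0 ≤ z.re * g y) →
        LaplaceConverges (betaGammaLaw α Γ (θ - q)) z g)) ∧
    -- (i)
    (∀ q : ℝ, 0 < q →
      IsProbabilityMeasure (betaGammaLaw α Γ (θ - q)) ∧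
      ∀ z : ℂ, LaplaceConverges (betaGammaLaw α Γ (θ - q)) z g →
        Integrable (fun P : Measure Y => (1 + z * ((∫ y, g y ∂P : ℝ) : ℂ)) ^ (-(q : ℂ))) D ∧
        ∫ P, (1 + z * ((∫ y, g y ∂P : ℝ) : ℂ)) ^ (-(q : ℂ)) ∂D =
          laplaceFunctional (betaGammaLaw α Γ (θ - q)) z g) ∧
    -- (ii), the mixture over the Blackwell–MacQueen sample
    (∀ q : ℝ, 0 < q → ∀ n : ℕ, 0 < θ + n - q →
      ∀ G : (Fin n → Y) → Measure (Measure Y), (∀ y, IsGammaProcess (postShape α y) (G y)) →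
      (∀ y, ∀ᵐ μ ∂G y, Integrable g μ) ∧
      ∀ z : ℂ, LaplaceConverges (betaGammaLaw α Γ (θ - q)) z g →
        (∀ᵐ y ∂blackwellMacQueen α n,
          LaplaceConverges (betaGammaLaw (postShape α y) (G y) (θ + n - q)) z g) ∧
        Integrable (fun y => laplaceFunctional
          (betaGammaLaw (postShape α y) (G y) (θ + n - q)) z g) (blackwellMacQueen α n) ∧
        laplaceFunctional (betaGammaLaw α Γ (θ - q)) z g =
          ∫ y, laplaceFunctional (betaGammaLaw (postShape α y) (G y) (θ + n - q)) z g
            ∂blackwellMacQueen α n ∧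
        (∀ y : Fin n → Y,
          LaplaceConverges (betaGammaLaw (postShape α y) (G y) (θ + n - q)) z g →
          Integrable (sampleIntegrand α z g y)
            (ProbabilityTheory.betaMeasure q (θ + n - q)) ∧
          laplaceFunctional (betaGammaLaw (postShape α y) (G y) (θ + n - q)) z g =
            ∫ u, sampleIntegrand α z g y u ∂ProbabilityTheory.betaMeasure q (θ + n - q))) ∧
    -- (ii), the explicit form for nonatomic `H`
    ((∀ y, H {y} = 0) → ∀ q : ℝ, 0 < q → ∀ n : ℕ, 0 < θ + n - q →
      ∀ z : ℂ, LaplaceConverges (betaGammaLaw α Γ (θ - q)) z g →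
        (∀ p : Finpartition (Finset.univ : Finset (Fin n)),
          Integrable (partitionIntegrand θ H z g p)
            (ProbabilityTheory.betaMeasure q (θ + n - q))) ∧
        laplaceFunctional (betaGammaLaw α Γ (θ - q)) z g =
          ∑ p : Finpartition (Finset.univ : Finset (Fin n)), (ewensWeight θ p : ℂ) *
            ∫ u, partitionIntegrand θ H z g p u
              ∂ProbabilityTheory.betaMeasure q (θ + n - q)) ∧
    -- (ii), the representations of the gamma process itself
    (∀ n : ℕ, 1 ≤ n → ∀ z : ℂ, LaplaceConverges Γ z g →
      (∀ G : (Fin n → Y) → Measure (Measure Y), (∀ y, IsGammaProcess (postShape α y) (G y)) →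
        laplaceFunctional Γ z g =
          ∫ y, laplaceFunctional (betaGammaLaw (postShape α y) (G y) n) z g
            ∂blackwellMacQueen α n) ∧
      ((∀ y, H {y} = 0) →
        laplaceFunctional Γ z g =
          ∑ p : Finpartition (Finset.univ : Finset (Fin n)), (ewensWeight θ p : ℂ) *
            ∫ u, partitionIntegrand θ H z g p u ∂ProbabilityTheory.betaMeasure θ n)) ∧
    -- (iii)
    (∀ q : ℝ, 0 < q → 0 < θ - q →
      ∀ z : ℂ, LaplaceConverges (betaGammaLaw α Γ (θ - q)) z g →
        Integrable (expLog α z g) (ProbabilityTheory.betaMeasure q (θ - q)) ∧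
        ∫ P, (1 + z * ((∫ y, g y ∂P : ℝ) : ℂ)) ^ (-(q : ℂ)) ∂D =
          ∫ u, expLog α z g u ∂ProbabilityTheory.betaMeasure q (θ - q)) := by
  subst hα
  have hu : (ENNReal.ofReal θ • H).real Set.univ = θ := by simp [hθ.le]
  have hfin : IsFiniteMeasure (ENNReal.ofReal θ • H) := H.smul_finite ENNReal.ofReal_ne_top
  have h0 : 0 < (ENNReal.ofReal θ • H).real Set.univ := by rwa [hu]
  have hmk := fun (q : ℝ) (hq : 0 < q) (z : ℂ) => markov_krein hΓ hD h0 hq hg (z := z)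
  have hmix := fun (q : ℝ) (hq : 0 < q) (n : ℕ) (G : (Fin n → Y) → Measure (Measure Y))
    (hG : ∀ y, IsGammaProcess (postShape (ENNReal.ofReal θ • H) y) (G y)) (z : ℂ) =>
    laplace_betaGamma_mixture (g := g) hΓ h0 hq hG (z := z)
  have hbeta := fun (q : ℝ) (hq : 0 < q) (hr : 0 < (ENNReal.ofReal θ • H).real Set.univ - q)
    (z : ℂ) => hΓ.laplace_betaGamma hq hr hg hlog (z := z)
  rw [hu] at hmk hmix hbeta
  -- At q = θ the power of T is trivial, and the Beta-Gamma law is the gamma process itself.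
  have hzero : betaGammaLaw (ENNReal.ofReal θ • H) Γ (θ - θ) = Γ := by
    rw [sub_self, betaGammaLaw_zero h0]
  refine ⟨⟨hD.ae_integrable hΓ h0 hg hlog, hΓ.ae_integrable hg hlog, fun q hq z hz => ?_⟩,
    fun q hq => ⟨?_, hmk q hq⟩, fun q hq n hr G hG => ⟨fun y => ?_, fun z hz => ?_⟩,
    fun _ q hq n hr z hz => laplace_betaGamma_ewens hθ hΓ hq hr hg hlog hz,
    fun n hn z hz => ?_, fun q hq hr z hz => ?_⟩
  · have h := laplaceConverges_of_nonneg hΓ h0 hq hg (z := z)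
      (Measure.smul_absolutelyContinuous.ae_le hz)
    rwa [hu] at h
  · have h := isProbabilityMeasure_betaGammaLaw hΓ h0 hq
    rwa [hu] at h
  · exact (hG y).ae_integrable hg
      ((integrable_postShape (Measurable.stronglyMeasurable (by fun_prop)) y).2 hlog)
  · obtain ⟨h1, h2, h3⟩ := hmix q hq n G hG z hz
    refine ⟨h1, h2, h3, fun y hy => ?_⟩
    have h := laplace_betaGamma_postShape hq (by rwa [hu]) hg hlog (hG y) (z := z)
      (by rwa [hu])
    rw [hu] at h
    exact h.2
  · rw [← hzero] at hz
    -- The second beta parameter becomes n, which is positive because n ≥ 1.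
    have hn' : θ + n - θ = n := by ring
    have hr : 0 < θ + n - θ := by
      rw [hn']
      exact_mod_cast hn
    refine ⟨fun G hG => ?_, fun _ => ?_⟩
    · have h := (hmix θ hθ n G hG z hz).2.2
      rwa [hzero, hn'] at h
    · have h := (laplace_betaGamma_ewens (n := n) hθ hΓ hθ hr hg hlog hz).2
      rwa [hzero, hn'] at h
  · obtain ⟨-, h1, h2⟩ := hbeta q hq hr z hz
    exact ⟨h1, (hmk q hq z hz).2.trans h2⟩
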